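/- **Setting.** Let $G$ be a biconnected plane series-parallel graph of maximum degree at most $4$, with a reference edge $e=(s,t)$ on the external face, the external face being to the right of $e$ when going from $s$ to $t$. (If a given two-terminal series-parallel graph is not biconnected, $G$ denotes it together with a dummy edge $e$ joining its terminals in the external face.) Let $T$ be an SPQ$^*$-tree of $G$ with respect to $e$: the root is the parallel composition of $e$ and the rest of the graph; a Q$^*$-node of length $\ell\ge 1$ is a chain of $\ell$ edges; an S-node is a series composition of at least two children, none of which is an S-node and no two consecutive of which are Q$^*$-nodes; a P-node is a parallel composition of two or three children, ordered from left to right according to the embedding, and a non-root P-node has no P-node child. For a node $\nu$ with source pole $u$ and sink pole $v$, $G_\nu$ is its pertinent graph, and $\mathrm{indeg}_\nu(w)$, $\mathrm{outdeg}_\nu(w)$ are the numbers of edges of $G$ at the pole $w$ inside and outside $G_\nu$. An *orthogonal representation* $H$ of $G$ assigns to each angle at a vertex a positive multiple of $90^\circ$ and to each edge a finite sequence of left and right bends, such that the angles at each vertex sum up to $360^\circ$ and the number of right turns minus the number of left turns along the boundary of a face, traversed with the face on the right, is $4$ for an internal face and $-4$ for the external face (an angle of $a\cdot 90^\circ$ in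 the face counts $2-a$). $G_\nu$ is *rectilinear planar* if $G$ has an orthogonal representation $H$ in which no edge of $G_\nu$ bends; the restriction $H_\nu$ of $H$ to $G_\nu$ (with the angles at the poles) is then a *rectilinear planar representation* of $G_\nu$. The *alias vertices* of a pole $w$ of $\nu$ are: $w$ itself if $\mathrm{indeg}_\nu(w)=1$; otherwise one dummy vertex on the first segment of each edge at $w$ outside $G_\nu$. For alias vertices $u'$ of $u$ and $v'$ of $v$, let $n(u',v')$ be the number of right turns minus the number of left turns on the path that goes from $u'$ to $u$, along a simple path of $G_\nu$ to $v$, and on to $v'$. The *spirality* of $H_\nu$ is $\frac12\big(n(u',v')+n(u'',v'')\big)$, where $u',u''$ are the alias vertices of $u$ and $v',v''$ those of $v$ ($u'=u''$, resp. $v'=v''$, if there is only one), $u'$ preceding $u''$ counterclockwise around $u$ and $v'$ preceding $v''$ clockwise around $v$ otherwise; it does not depend on the simple path. The *representability condition* and the *representability interval* $I_\nu$ of a non-root node $\nu$ are defined bottom-up. The condition of $\nu$ includes the conditions of its children, and $[m_i,M_i]$ (with indices $l,c,r$ from left to right for P-nodes) are the intervals of the children. For a P-node with two children let $\gamma=\mathrm{outdeg}_\nu(u)+\mathrm{outdeg}_\nu(v)-2$;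 for a pole $w$ with $\mathrm{indeg}_\nu(w)=3$ let $\rho_w=1$ if $w$ has indegree two in the right child and $\rho_w=0$ if it has indegree two in the left child. * Q$^*$-node of length $\ell$: no condition; $I_\nu=[-\ell+1,\ell-1]$. * S-node with $h$ children: no further condition; $I_\nu=[\sum_{i=1}^h m_i,\sum_{i=1}^h M_i]$. * P-node with three children: $[m_l-2,M_l-2]\cap[m_c,M_c]\cap[m_r+2,M_r+2]\ne\emptyset$; $I_\nu=[\max\{m_l-2,m_c,m_r+2\},\min\{M_l-2,M_c,M_r+2\}]$. * P-node with two children, both poles of indegree two: $[m_l-M_r,M_l-m_r]\cap[2,4-\gamma]\ne\emptyset$; $I_\nu=[\max\{m_l-2,m_r\}+\frac\gamma2,\min\{M_l,M_r+2\}-\frac\gamma2]$. * P-node with two children, exactly one pole $w$ of indegree three: $[m_l-M_r,M_l-m_r]\cap[\frac52,\frac72-\gamma]\ne\emptyset$; $I_\nu=[\max\{m_l-\frac32,m_r+1\}+\frac{\gamma-\rho_w}2,\min\{M_l-\frac12,M_r+2\}-\frac{\gamma+\rho_w}2]$. * P-node with two children, both poles of indegree three: $3\in[m_l-M_r,M_l-m_r]$;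 $I_\nu=[\max\{m_l-1,m_r+2\}-\frac{\rho_u+\rho_v}2,\min\{M_l-1,M_r+2\}-\frac{\rho_u+\rho_v}2]$. **Theorem.** Let $\nu$ be any non-root node of $T$. Then $G_\nu$ is rectilinear planar if and only if $\nu$ satisfies its representability condition. If it does, then $G_\nu$ has a rectilinear planar representation of spirality $k$ if and only if $k\in I_\nu$ and $k$ is an integer or a semi-integer (an odd multiple of $\frac12$), according to whether the total number of alias vertices of the two poles of $\nu$ is even or odd. -/

import Mathlib

/-- The cyclic list `L` closes up under the permutation `r`: each entry is mapped to the next one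
and the last entry to the first one. -/
def ClosedUnder {D : Type*} (r : Equiv.Perm D) (L : List D) : Prop :=
  List.IsChain (fun a b => r a = b) (L ++ L.head?.toList)

/-- A finite connected plane graph, given up to homeomorphism by its rotation system and its
external face.  Every edge consists of two opposite darts `d`, `rev d`; `org d` is the vertex that
the dart `d` leaves; `rot d` is the dart that follows `d` in counterclockwise order around
`org d`.  The face to the right of `d` is traversed, keeping it on the right, by
`d ↦ rot (rev d)`; the external face is the face to the right of the dart `outer`.
Planarity is Euler's formula `|V| - |E| + |F| = 2`.  Parallel edges are not excluded. -/
structure PlaneGraph (V D : Type*) [Fintype V] [Fintype D] where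
  org : D → V
  rev : D → D
  rot : Equiv.Perm D
  outer : D
  rev_rev : ∀ d, rev (rev d) = d
  rev_ne : ∀ d, rev d ≠ d
  org_rot : ∀ d, org (rot d) = org d
  sameCycle_of_org_eq : ∀ d d', org d = org d' → rot.SameCycle d d'
  org_surjective : Function.Surjective org
  connected : ∀ x y : V,
    Relation.ReflTransGen (fun a b => ∃ d, org d = a ∧ org (rev d) = b) x y
  euler : 2 * (Nat.card V + Nat.card (Quotient (Equiv.Perm.SameCycle.setoid
      (Equiv.trans (Function.Involutive.toPerm rev rev_rev) rot)))) = Nat.card D + 4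

/-- A rooted ordered decomposition tree whose nodes are labelled with their source pole and sink
pole.  A Q*-node carries the directed chain of darts from its source to its sink.  The children of
an S-node (at least two) are listed from source to sink; the children of a P-node (two or three)
are listed from left to right. -/
inductive SPQTree (V D : Type*) where
  | Q (u v : V) (p : List D) : SPQTree V D
  | S (u v : V) (n : ℕ) (c : Fin (n + 2) → SPQTree V D) : SPQTree V D
  | P2 (u v : V) (l r : SPQTree V D) : SPQTree V D
  | P3 (u v : V) (l m r : SPQTree V D) : SPQTree V D

namespace SPQTree

variable {V D : Type*}

/-- The source pole of a node. -/
def source : SPQTree V D → V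
  | Q u _ _ => u
  | S u _ _ _ => u
  | P2 u _ _ _ => u
  | P3 u _ _ _ _ => u

/-- The sink pole of a node. -/
def sink : SPQTree V D → V
  | Q _ v _ => v
  | S _ v _ _ => v
  | P2 _ v _ _ => v
  | P3 _ v _ _ _ => v

def IsQ : SPQTree V D → Prop
  | Q _ _ _ => True
  | _ => False

def IsS : SPQTree V D → Prop
  | S _ _ _ _ => True
  | _ => False

def IsP : SPQTree V D → Prop
  | P2 _ _ _ _ => True
  | P3 _ _ _ _ _ => True
  | _ => False

/-- `IsChild μ ν`: the node `μ` is a child of the node `ν`. -/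
inductive IsChild : SPQTree V D → SPQTree V D → Prop
  | series (u v : V) (n : ℕ) (c : Fin (n + 2) → SPQTree V D) (i : Fin (n + 2)) :
      IsChild (c i) (S u v n c)
  | left2 (u v : V) (l r : SPQTree V D) : IsChild l (P2 u v l r)
  | right2 (u v : V) (l r : SPQTree V D) : IsChild r (P2 u v l r)
  | left3 (u v : V) (l m r : SPQTree V D) : IsChild l (P3 u v l m r)
  | mid3 (u v : V) (l m r : SPQTree V D) : IsChild m (P3 u v l m r)
  | right3 (u v : V) (l m r : SPQTree V D) : IsChild r (P3 u v l m r)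

/-- `ν` is a node of the tree `T` other than its root. -/
def IsNonRootNode (ν T : SPQTree V D) : Prop := Relation.TransGen IsChild ν T

end SPQTree

/-- A left or right turn of an edge at a bend. -/
inductive Turn where
  | left
  | right

namespace Turn

/-- The same bend seen when the edge is traversed in the opposite direction. -/
def flip : Turn → Turn
  | left => right
  | right => left

/-- Right turns count `+1`, left turns count `-1`. -/
def val : Turn → ℤ
  | left => -1
  | right => 1

end Turn

namespace PlaneGraph

variable {V D : Type*} [Fintype V] [DecidableEq V] [Fintype D] [DecidableEq D]

/-- The permutation of the darts whose cycles are the boundaries of the faces, each traversed with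
the face on its right. -/
def face (G : PlaneGraph V D) : Equiv.Perm D :=
  Equiv.trans (Function.Involutive.toPerm G.rev G.rev_rev) G.rot

/-- The degree of a vertex. -/
def degree (G : PlaneGraph V D) (w : V) : ℕ := (Finset.univ.filter fun d => G.org d = w).card

/-! ### Decomposition trees of a plane graph -/

/-- The darts (both directions of every edge) of the pertinent graph of a node. -/
def darts (G : PlaneGraph V D) : SPQTree V D → Finset D
  | .Q _ _ p => p.toFinset ∪ (p.map G.rev).toFinset
  | .S _ _ _ c => Finset.univ.biUnion fun i => G.darts (c i)
  | .P2 _ _ l r => G.darts l ∪ G.darts r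
  | .P3 _ _ l m r => G.darts l ∪ G.darts m ∪ G.darts r

/-- The vertices of the pertinent graph of a node. -/
def verts (G : PlaneGraph V D) (ν : SPQTree V D) : Finset V := (G.darts ν).image G.org

/-- The darts of the pertinent graph that leave its source pole, from left to right. -/
def sourceFan (G : PlaneGraph V D) : SPQTree V D → List D
  | .Q _ _ p => p.head?.toList
  | .S _ _ _ c => G.sourceFan (c 0)
  | .P2 _ _ l r => G.sourceFan l ++ G.sourceFan r
  | .P3 _ _ l m r => G.sourceFan l ++ G.sourceFan m ++ G.sourceFan r

/-- The darts of the pertinent graph that leave its sink pole, from left to right (where left and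
right refer to the direction from the source to the sink). -/
def sinkFan (G : PlaneGraph V D) : SPQTree V D → List D
  | .Q _ _ p => (p.getLast?.map G.rev).toList
  | .S _ _ n c => G.sinkFan (c (Fin.last (n + 1)))
  | .P2 _ _ l r => G.sinkFan l ++ G.sinkFan r
  | .P3 _ _ l m r => G.sinkFan l ++ G.sinkFan m ++ G.sinkFan r

/-- `L` lists all darts that leave `w`, each once, in counterclockwise cyclic order. -/
def IsRotationAt (G : PlaneGraph V D) (w : V) (L : List D) : Prop :=
  L.Nodup ∧ (∀ d, d ∈ L ↔ G.org d = w) ∧ ClosedUnder G.rot L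

/-- `p` is the sequence of darts of a simple path from `u` to `v`, where `u ≠ v`. -/
def IsSimplePath (G : PlaneGraph V D) (u v : V) (p : List D) : Prop :=
  (p.map G.org).head? = some u ∧
  (p.map fun d => G.org (G.rev d)).getLast? = some v ∧
  List.IsChain (fun d d' => G.org (G.rev d) = G.org d') p ∧
  (p.map G.org ++ [v]).Nodup

/-- Two components in parallel between the poles `u` and `v` share nothing but these poles. -/
def ParallelDisjoint (G : PlaneGraph V D) (u v : V) (μ μ' : SPQTree V D) : Prop :=
  Disjoint (G.darts μ) (G.darts μ') ∧ ∀ w ∈ G.verts μ ∩ G.verts μ', w = u ∨ w = v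

/-- `ν` is the decomposition tree of the two-terminal series-parallel subgraph of `G` formed by
its darts, ordered according to the plane embedding of `G`.
* A Q*-node is a chain of edges.
* For an S-node, consecutive children share exactly the sink of the first, which is the source of
  the second, and other children share nothing.  Around such a vertex one sees, counterclockwise,
  the edges of the first child from left to right and then those of the second child from right to
  left.  No child is an S-node and no two consecutive children are Q*-nodes (a maximal chain is a
  single Q*-node).
* The children of a P-node share exactly their two poles, and none of them is a P-node. -/
def IsDecomposition (G : PlaneGraph V D) : SPQTree V D → Prop
  | .Q u v p => G.IsSimplePath u v p
  | .S u v n c =>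
      (∀ i, G.IsDecomposition (c i)) ∧
      (c 0).source = u ∧ (c (Fin.last (n + 1))).sink = v ∧
      (∀ i : Fin (n + 1), (c i.castSucc).sink = (c i.succ).source ∧
        G.IsRotationAt (c i.castSucc).sink
          (G.sinkFan (c i.castSucc) ++ (G.sourceFan (c i.succ)).reverse) ∧
        ¬ ((c i.castSucc).IsQ ∧ (c i.succ).IsQ)) ∧
      (∀ i, ¬ (c i).IsS) ∧
      (∀ i j, i < j → Disjoint (G.darts (c i)) (G.darts (c j)) ∧
        ∀ w ∈ G.verts (c i) ∩ G.verts (c j), (j : ℕ) = i + 1 ∧ w = (c i).sink)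
  | .P2 u v l r =>
      G.IsDecomposition l ∧ G.IsDecomposition r ∧
      (l.source = u ∧ l.sink = v) ∧ (r.source = u ∧ r.sink = v) ∧
      ¬ l.IsP ∧ ¬ r.IsP ∧ G.ParallelDisjoint u v l r
  | .P3 u v l m r =>
      G.IsDecomposition l ∧ G.IsDecomposition m ∧ G.IsDecomposition r ∧
      (l.source = u ∧ l.sink = v) ∧ (m.source = u ∧ m.sink = v) ∧ (r.source = u ∧ r.sink = v) ∧
      ¬ l.IsP ∧ ¬ m.IsP ∧ ¬ r.IsP ∧
      G.ParallelDisjoint u v l m ∧ G.ParallelDisjoint u v m r ∧ G.ParallelDisjoint u v l r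

/-- `T` is an SPQ*-tree of the plane graph `G` with respect to a reference edge `e` from `s` to `t`
on the external face: its root is the parallel composition of the rest `η` of the graph and of `e`,
where `e` is to the right of `η` and the external face is to the right of `e`. -/
def IsSPQTree (G : PlaneGraph V D) (T : SPQTree V D) : Prop :=
  ∃ (s t : V) (e : D) (η : SPQTree V D), T = .P2 s t η (.Q s t [e]) ∧
    G.org e = s ∧ G.org (G.rev e) = t ∧
    G.IsDecomposition η ∧ η.source = s ∧ η.sink = t ∧
    (∀ d, d ∈ G.darts η ↔ d ≠ e ∧ d ≠ G.rev e) ∧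
    G.IsRotationAt s (e :: (G.sourceFan η).reverse) ∧
    G.IsRotationAt t (G.sinkFan η ++ [G.rev e]) ∧
    G.face.SameCycle G.outer e

/-- The degree of `w` inside the pertinent graph of `ν`. -/
def indeg (G : PlaneGraph V D) (ν : SPQTree V D) (w : V) : ℕ :=
  (Finset.univ.filter fun d => G.org d = w ∧ d ∈ G.darts ν).card

/-- The degree of `w` outside the pertinent graph of `ν`. -/
def outdeg (G : PlaneGraph V D) (ν : SPQTree V D) (w : V) : ℕ :=
  (Finset.univ.filter fun d => G.org d = w ∧ d ∉ G.darts ν).card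

/-! ### Orthogonal representations -/

open Classical in
/-- An (embedding-preserving, planar) orthogonal representation of `G`: the angles at the vertices
and the sequences of bends along the edges.  `ang d` is the angle, in units of 90 degrees, from
`d` counterclockwise to the next dart `rot d`; `bends d` is the sequence of bends met while
traversing `d`.  The angles at a vertex sum up to 360 degrees.  Along the boundary of a face,
traversed with the face on the right, the number of right turns minus the number of left turns is
`4`, and it is `-4` for the external face; an angle of `90 a` degrees in the face
contributes `2 - a` to this number. -/
structure OrthoRep (G : PlaneGraph V D) where
  ang : D → ℕ
  bends : D → List Turn
  ang_pos : ∀ d, 1 ≤ ang d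
  bends_rev : ∀ d, bends (G.rev d) = ((bends d).map Turn.flip).reverse
  vertex_sum : ∀ w, ∑ d with G.org d = w, ang d = 4
  face_sum : ∀ d, ∑ d' with G.face.SameCycle d d',
      (((bends d').map Turn.val).sum + (2 - (ang (G.rev d') : ℤ))) =
        if G.face.SameCycle G.outer d then -4 else 4

namespace OrthoRep

variable {G : PlaneGraph V D}

/-- The angle, in units of 90 degrees, from `a` counterclockwise to `b`, for two darts `a`, `b`
that leave the same vertex. -/
noncomputable def angle (H : OrthoRep G) (a b : D) : ℕ :=
  ∑ i ∈ Finset.range (sInf {n : ℕ | (G.rot ^ n) a = b}), H.ang ((G.rot ^ i) a)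

/-- The turn made at the end of `d` by a path that continues with `d'`: `1` for a right turn, `-1`
for a left turn, `0` for none. -/
noncomputable def turn (H : OrthoRep G) (d d' : D) : ℤ := 2 - (H.angle (G.rev d) d' : ℤ)

/-- Right turns minus left turns at the intermediate vertices of a path. -/
noncomputable def vertexTurns (H : OrthoRep G) : List D → ℤ
  | [] => 0
  | [_] => 0
  | d :: d' :: p => H.turn d d' + H.vertexTurns (d' :: p)

/-- Right turns minus left turns at the bends of a path. -/
def bendTurns (H : OrthoRep G) (p : List D) : ℤ :=
  (p.map fun d => ((H.bends d).map Turn.val).sum).sum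

/-- The restriction of `H` to the pertinent graph of `ν` has no bend. -/
def IsRectilinearOn (H : OrthoRep G) (ν : SPQTree V D) : Prop := ∀ d ∈ G.darts ν, H.bends d = []

end OrthoRep

/-! ### Spirality -/

/-- The alias vertices of a pole `w` of `ν`: `none` stands for `w` itself, and `some x` for the
dummy vertex that splits the first segment of the dart `x`, which leaves `w` outside of the
pertinent graph. -/
def aliases (G : PlaneGraph V D) (ν : SPQTree V D) (w : V) : Finset (Option D) :=
  if G.indeg ν w = 1 then {none}
  else (Finset.univ.filter fun d => G.org d = w ∧ d ∉ G.darts ν).image some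

/-- Right turns minus left turns along the spine that leads from the alias vertex `a` of the
source to the source, then along the path `p` to the sink, and then to the alias vertex `b` of the
sink. -/
noncomputable def spineTurns {G : PlaneGraph V D} (H : OrthoRep G) (a : Option D) (p : List D)
    (b : Option D) : ℤ :=
  H.vertexTurns ((a.map G.rev).toList ++ p ++ b.toList) + H.bendTurns p

/-- `p` is a simple path from the source to the sink of `ν` inside its pertinent graph; `a`, `a'`
are the alias vertices of the source and `b`, `b'` those of the sink (`a = a'` resp. `b = b'` if
there is only one).  If there are two, `a` precedes `a'` counterclockwise around the source, resp.
`b` precedes `b'` clockwise around the sink. -/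
def IsSpinePair (G : PlaneGraph V D) (ν : SPQTree V D) (p : List D) (a a' b b' : Option D) :
    Prop :=
  G.IsSimplePath ν.source ν.sink p ∧ (∀ d ∈ p, d ∈ G.darts ν) ∧
  G.aliases ν ν.source = {a, a'} ∧ G.aliases ν ν.sink = {b, b'} ∧
  (a ≠ a' → a.map G.rot = a') ∧ (b ≠ b' → b'.map G.rot = b)

/-- The restriction of `H` to the pertinent graph of `ν` has spirality `k`: this is the common
value, for all paths, of the mean of the spines given by the alias vertices. -/
def HasSpirality {G : PlaneGraph V D} (H : OrthoRep G) (ν : SPQTree V D) (k : ℚ) : Prop :=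
  (∃ p a a' b b', G.IsSpinePair ν p a a' b b') ∧
  ∀ p a a' b b', G.IsSpinePair ν p a a' b b' →
    ((spineTurns H a p b : ℚ) + (spineTurns H a' p b' : ℚ)) / 2 = k

/-- The component `ν` of `G` is rectilinear planar. -/
def IsRectilinearPlanar (G : PlaneGraph V D) (ν : SPQTree V D) : Prop :=
  ∃ H : OrthoRep G, H.IsRectilinearOn ν

/-- The component `ν` of `G` has a rectilinear planar representation with spirality `k`. -/
def IsRectilinearPlanarWith (G : PlaneGraph V D) (ν : SPQTree V D) (k : ℚ) : Prop :=
  ∃ H : OrthoRep G, H.IsRectilinearOn ν ∧ HasSpirality H ν k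

/-! ### Representability conditions and intervals -/

/-- `γ = α + β - 2`, where `α` and `β` are the outdegrees of the two poles. -/
def gamma (G : PlaneGraph V D) (ν : SPQTree V D) : ℚ :=
  (G.outdeg ν ν.source : ℚ) + (G.outdeg ν ν.sink : ℚ) - 2

/-- `ρ(d)` for a pole `w` of indegree three of a P-node with two children, where `d` is the side
of the child in which `w` has indegree two: `1` if this is the right child `r`, `0` if it is the
left child. -/
def rho (G : PlaneGraph V D) (r : SPQTree V D) (w : V) : ℚ := if G.indeg r w = 2 then 1 else 0

/-- `ν` is a P-node with two children both of whose poles have indegree two. -/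
def IsType2 (G : PlaneGraph V D) (ν : SPQTree V D) : Prop :=
  G.indeg ν ν.source = 2 ∧ G.indeg ν ν.sink = 2

/-- `ν` is a P-node with two children both of whose poles have indegree three. -/
def IsType3dd (G : PlaneGraph V D) (ν : SPQTree V D) : Prop :=
  G.indeg ν ν.source = 3 ∧ G.indeg ν ν.sink = 3

open Classical in
/-- The two endpoints of the representability interval.  In the last case of a P-node with two
children exactly one pole has indegree three. -/
noncomputable def interval (G : PlaneGraph V D) : SPQTree V D → ℚ × ℚ
  | .Q _ _ p => (-(p.length : ℚ) + 1, (p.length : ℚ) - 1)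
  | .S _ _ _ c => (∑ i, (G.interval (c i)).1, ∑ i, (G.interval (c i)).2)
  | .P3 _ _ l m r =>
      (max (max ((G.interval l).1 - 2) (G.interval m).1) ((G.interval r).1 + 2),
        min (min ((G.interval l).2 - 2) (G.interval m).2) ((G.interval r).2 + 2))
  | .P2 u v l r =>
      if G.IsType2 (.P2 u v l r) then
        (max ((G.interval l).1 - 2) (G.interval r).1 + G.gamma (.P2 u v l r) / 2,
          min (G.interval l).2 ((G.interval r).2 + 2) - G.gamma (.P2 u v l r) / 2)
      else if G.IsType3dd (.P2 u v l r) then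
        (max ((G.interval l).1 - 1) ((G.interval r).1 + 2) - (G.rho r u + G.rho r v) / 2,
          min ((G.interval l).2 - 1) ((G.interval r).2 + 2) - (G.rho r u + G.rho r v) / 2)
      else
        let w := if G.indeg (.P2 u v l r) u = 3 then u else v
        (max ((G.interval l).1 - 3 / 2) ((G.interval r).1 + 1)
            + (G.gamma (.P2 u v l r) - G.rho r w) / 2,
          min ((G.interval l).2 - 1 / 2) ((G.interval r).2 + 2)
            - (G.gamma (.P2 u v l r) + G.rho r w) / 2)

open Classical in
/-- The representability condition, evaluated bottom-up: the children satisfy theirs (so that their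
representability intervals are available) and the condition that belongs to the type of the node
holds for the intervals of the children. -/
def RepresentabilityCondition (G : PlaneGraph V D) : SPQTree V D → Prop
  | .Q _ _ _ => True
  | .S _ _ _ c => ∀ i, G.RepresentabilityCondition (c i)
  | .P3 _ _ l m r =>
      G.RepresentabilityCondition l ∧ G.RepresentabilityCondition m ∧
      G.RepresentabilityCondition r ∧
      (Set.Icc ((G.interval l).1 - 2) ((G.interval l).2 - 2) ∩
        Set.Icc (G.interval m).1 (G.interval m).2 ∩
        Set.Icc ((G.interval r).1 + 2) ((G.interval r).2 + 2)).Nonempty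
  | .P2 u v l r =>
      G.RepresentabilityCondition l ∧ G.RepresentabilityCondition r ∧
      if G.IsType2 (.P2 u v l r) then
        (Set.Icc ((G.interval l).1 - (G.interval r).2) ((G.interval l).2 - (G.interval r).1) ∩
          Set.Icc 2 (4 - G.gamma (.P2 u v l r))).Nonempty
      else if G.IsType3dd (.P2 u v l r) then
        3 ∈ Set.Icc ((G.interval l).1 - (G.interval r).2) ((G.interval l).2 - (G.interval r).1)
      else
        (Set.Icc ((G.interval l).1 - (G.interval r).2) ((G.interval l).2 - (G.interval r).1) ∩
          Set.Icc (5 / 2) (7 / 2 - G.gamma (.P2 u v l r))).Nonempty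

/-- The values in the representability interval: those that are integers or semi-integers (odd
multiples of `1/2`), according to whether the total number of alias vertices of the two poles is
even or odd. -/
def IsRepresentabilityValue (G : PlaneGraph V D) (ν : SPQTree V D) (k : ℚ) : Prop :=
  k ∈ Set.Icc (G.interval ν).1 (G.interval ν).2 ∧
  ∃ z : ℤ, k = z + (((G.aliases ν ν.source).card + (G.aliases ν ν.sink).card : ℕ) : ℚ) / 2

end PlaneGraph

set_option linter.unusedSectionVars false

/-! ### Closed lists of a permutation -/

namespace ClosedUnder

variable {D : Type*} {r : Equiv.Perm D}

theorem isChain_concat_iff_map_eq (x y : D) (l : List D) :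
    List.IsChain (fun a b => r a = b) (x :: (l ++ [y])) ↔ (x :: l).map r = l ++ [y] := by
  induction l generalizing x with
  | nil => simp
  | cons z l ih =>
    rw [List.cons_append, List.isChain_cons_cons, ih, List.map_cons (l := z :: l),
      List.cons.injEq]

theorem iff_map_eq_rotate (L : List D) : ClosedUnder r L ↔ L.map r = L.rotate 1 := by
  cases L with
  | nil => simp [ClosedUnder]
  | cons x l =>
    have := isChain_concat_iff_map_eq (r := r) x x l
    simpa [ClosedUnder] using this

theorem append_comm {L₁ L₂ : List D} (h : ClosedUnder r (L₁ ++ L₂)) :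
    ClosedUnder r (L₂ ++ L₁) := by
  rw [← List.rotate_append_length_eq L₁ L₂]
  generalize L₁.length = n
  rw [iff_map_eq_rotate] at h ⊢
  rw [List.map_rotate, h, List.rotate_rotate, List.rotate_rotate, Nat.add_comm]

theorem apply_mem {L : List D} (h : ClosedUnder r L) {d : D} (hd : d ∈ L) : r d ∈ L := by
  rw [iff_map_eq_rotate] at h
  have : r d ∈ L.map r := List.mem_map_of_mem hd
  rw [h] at this
  simpa using this

theorem sameCycle_head {x : D} {l : List D}
    (h : List.IsChain (fun a b => r a = b) (x :: l)) : ∀ d ∈ x :: l, r.SameCycle x d := by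
  induction l generalizing x with
  | nil => simp [Equiv.Perm.SameCycle.refl]
  | cons y l ih =>
    rw [List.isChain_cons_cons] at h
    intro d hd
    rcases List.mem_cons.1 hd with rfl | hd
    · exact Equiv.Perm.SameCycle.refl _ _
    · have := ih h.2 d hd
      rw [← h.1] at this
      exact (Equiv.Perm.sameCycle_apply_left).1 this

theorem sameCycle {L : List D} (h : ClosedUnder r L) {d d' : D} (hd : d ∈ L) (hd' : d' ∈ L) :
    r.SameCycle d d' := by
  cases L with
  | nil => simp at hd
  | cons x l =>
    have h' : List.IsChain (fun a b => r a = b) (x :: (l ++ [x])) := by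
      simpa [ClosedUnder] using h
    have key := sameCycle_head h'
    exact (key d (by simp at hd ⊢; tauto)).symm.trans (key d' (by simp at hd' ⊢; tauto))

theorem mem_of_sameCycle [Finite D] {L : List D} (h : ClosedUnder r L) {d d' : D} (hd : d ∈ L)
    (hs : r.SameCycle d d') : d' ∈ L := by
  obtain ⟨n, rfl⟩ := hs.exists_nat_pow_eq
  clear hs
  induction n with
  | zero => simpa using hd
  | succ n ih =>
    rw [pow_succ', Equiv.Perm.mul_apply]
    exact h.apply_mem ih

theorem sum_sameCycle [Fintype D] [DecidableEq D] {M : Type*} [AddCommMonoid M] {L : List D}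
    (h : ClosedUnder r L) (hn : L.Nodup) {d : D} (hd : d ∈ L) (f : D → M)
    [DecidablePred fun d' => r.SameCycle d d'] :
    ∑ d' with r.SameCycle d d', f d' = (L.map f).sum := by
  rw [← List.sum_toFinset f hn]
  refine Finset.sum_congr ?_ fun _ _ => rfl
  ext d'
  simp only [Finset.mem_filter, Finset.mem_univ, true_and, List.mem_toFinset]
  exact ⟨h.mem_of_sameCycle hd, h.sameCycle hd⟩

end ClosedUnder

namespace PlaneGraph

variable {V D : Type*} [Fintype V] [DecidableEq V] [Fintype D] [DecidableEq D]
  {G : PlaneGraph V D}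

/-! ### Angles around a vertex -/

/-- The sum of the values of `A` from `a` counterclockwise up to (but excluding) `b`. -/
noncomputable def angleSum (G : PlaneGraph V D) (A : D → ℕ) (a b : D) : ℕ :=
  ∑ i ∈ Finset.range (sInf {n : ℕ | (G.rot ^ n) a = b}), A ((G.rot ^ i) a)

theorem angleSum_rot (A : D → ℕ) {a b : D} (hab : a ≠ b) (h : ∃ n : ℕ, (G.rot ^ n) (G.rot a) = b) :
    G.angleSum A a b = A a + G.angleSum A (G.rot a) b := by
  have hs : ∀ n : ℕ, (G.rot ^ (n + 1)) a = (G.rot ^ n) (G.rot a) := fun n => by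
    rw [pow_succ, Equiv.Perm.mul_apply]
  have key : sInf {n : ℕ | (G.rot ^ n) a = b} = sInf {n : ℕ | (G.rot ^ n) (G.rot a) = b} + 1 := by
    apply le_antisymm
    · apply Nat.sInf_le
      have : sInf {n : ℕ | (G.rot ^ n) (G.rot a) = b} ∈ {n : ℕ | (G.rot ^ n) (G.rot a) = b} :=
        Nat.sInf_mem h
      simpa [hs] using this
    · have hne : {n : ℕ | (G.rot ^ n) a = b}.Nonempty := by
        obtain ⟨n, hn⟩ := h
        exact ⟨n + 1, by simpa [hs] using hn⟩
      have hm := Nat.sInf_mem hne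
      generalize sInf {n : ℕ | (G.rot ^ n) a = b} = m at hm ⊢
      cases m with
      | zero => exact absurd (by simpa using hm) hab
      | succ m =>
        simp only [Set.mem_ofPred_eq, hs] at hm
        exact Nat.succ_le_succ (Nat.sInf_le hm)
  rw [angleSum, key, Finset.sum_range_succ', angleSum, add_comm]
  simp [hs]

theorem angleSum_self (A : D → ℕ) (a : D) : G.angleSum A a a = 0 := by
  have : sInf {n : ℕ | (G.rot ^ n) a = a} = 0 := by
    rw [Nat.sInf_eq_zero]; left; simp
  rw [angleSum, this]; simp

theorem exists_pow_of_isChain {a b : D} {l : List D}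
    (h : List.IsChain (fun x y => G.rot x = y) (a :: (l ++ [b]))) :
    ∃ n : ℕ, (G.rot ^ n) (G.rot a) = b := by
  induction l generalizing a with
  | nil => exact ⟨0, by simpa using h⟩
  | cons c l ih =>
    rw [List.cons_append, List.isChain_cons_cons] at h
    obtain ⟨n, hn⟩ := ih h.2
    exact ⟨n + 1, by rw [pow_succ, Equiv.Perm.mul_apply, h.1, hn]⟩

theorem angleSum_of_isChain (A : D → ℕ) {a b : D} {l : List D}
    (h : List.IsChain (fun x y => G.rot x = y) (a :: (l ++ [b]))) (hb : b ∉ a :: l) :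
    G.angleSum A a b = ((a :: l).map A).sum := by
  have hp := exists_pow_of_isChain h
  induction l generalizing a with
  | nil =>
    rw [angleSum_rot A (by simpa [eq_comm] using hb) hp]
    have : G.rot a = b := by simpa using h
    simp [this, angleSum_self]
  | cons c l ih =>
    rw [angleSum_rot A (by intro e; simp [e] at hb) hp]
    rw [List.cons_append, List.isChain_cons_cons] at h
    rw [h.1, ih h.2 (by simp at hb ⊢; tauto) (exists_pow_of_isChain h.2)]
    simp

theorem org_pow_rot (G : PlaneGraph V D) (n : ℕ) (d : D) : G.org ((G.rot ^ n) d) = G.org d := by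
  induction n with
  | zero => simp
  | succ n ih => rw [pow_succ', Equiv.Perm.mul_apply, G.org_rot, ih]

theorem org_rot_symm (G : PlaneGraph V D) (d : D) : G.org (G.rot.symm d) = G.org d := by
  rw [← G.org_rot (G.rot.symm d), Equiv.apply_symm_apply]

theorem angleSum_congr {A A' : D → ℕ} {a : D} (h : ∀ d, G.org d = G.org a → A d = A' d) (b : D) :
    G.angleSum A a b = G.angleSum A' a b :=
  Finset.sum_congr rfl fun i _ => h _ (G.org_pow_rot i a)

/-- The angles at `w` are positive and sum up to 360 degrees. -/
def AnglesAt (G : PlaneGraph V D) (A : D → ℕ) (w : V) : Prop :=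
  (∀ d, G.org d = w → 1 ≤ A d) ∧ ∑ d with G.org d = w, A d = 4

theorem AnglesAt.congr {A A' : D → ℕ} {w : V} (h : ∀ d, G.org d = w → A d = A' d)
    (hA : G.AnglesAt A w) : G.AnglesAt A' w := by
  refine ⟨fun d hd => h d hd ▸ hA.1 d hd, ?_⟩
  rw [← hA.2]
  exact Finset.sum_congr rfl fun d hd => (h d (by simpa using hd)).symm

namespace IsRotationAt

variable {w : V} {L : List D}

theorem append_comm {L₁ L₂ : List D} (h : G.IsRotationAt w (L₁ ++ L₂)) :
    G.IsRotationAt w (L₂ ++ L₁) :=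
  ⟨(List.perm_append_comm.nodup_iff).1 h.1, fun d => by rw [← h.2.1 d]; simp [or_comm],
    h.2.2.append_comm⟩

theorem sum_eq (h : G.IsRotationAt w L) (A : D → ℕ) :
    ∑ d with G.org d = w, A d = (L.map A).sum := by
  rw [← List.sum_toFinset A h.1]
  refine Finset.sum_congr ?_ fun _ _ => rfl
  ext d
  simp [h.2.1 d]

theorem degree_eq (h : G.IsRotationAt w L) : G.degree w = L.length := by
  rw [degree, ← List.toFinset_card_of_nodup h.1]
  congr 1
  ext d
  simp [h.2.1 d]

theorem anglesAt_iff (h : G.IsRotationAt w L) (A : D → ℕ) :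
    G.AnglesAt A w ↔ (∀ d ∈ L, 1 ≤ A d) ∧ (L.map A).sum = 4 := by
  simp only [AnglesAt, h.sum_eq, h.2.1]

theorem angleSum_eq {a b : D} {l m : List D} (h : G.IsRotationAt w (a :: l ++ b :: m))
    (A : D → ℕ) : G.angleSum A a b = ((a :: l).map A).sum := by
  apply angleSum_of_isChain
  · have := h.2.2
    unfold ClosedUnder at this
    have e : (a :: l ++ b :: m) ++ (a :: l ++ b :: m).head?.toList =
      (a :: (l ++ [b])) ++ (m ++ (a :: l ++ b :: m).head?.toList) := by simp
    rw [e] at this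
    exact (List.isChain_append.1 this).1
  · have := h.1
    rw [List.nodup_append] at this
    intro hb
    exact this.2.2 b hb b (by simp) rfl

theorem rot_eq {a b : D} {l m : List D} (h : G.IsRotationAt w (l ++ a :: b :: m)) :
    G.rot a = b := by
  have := h.2.2
  unfold ClosedUnder at this
  rw [List.append_assoc] at this
  have h2 := (List.isChain_append.1 this).2.1
  rw [List.cons_append, List.cons_append, List.isChain_cons_cons] at h2
  exact h2.1

theorem rot_getLast {a b : D} {l : List D} (h : G.IsRotationAt w (b :: l ++ [a])) :
    G.rot a = b := by
  have h2 : G.IsRotationAt w ([] ++ a :: b :: l) := h.append_comm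
  exact h2.rot_eq

theorem angles_two {p q : D} (h : G.IsRotationAt w [p, q]) (A : D → ℕ) :
    G.angleSum A p q = A p := by
  simpa using (show G.IsRotationAt w (p :: [] ++ q :: []) from h).angleSum_eq A

theorem angles_three {p q r : D} (h : G.IsRotationAt w [p, q, r]) (A : D → ℕ) :
    G.angleSum A p q = A p ∧ G.angleSum A p r = A p + A q :=
  ⟨by simpa using (show G.IsRotationAt w (p :: [] ++ q :: [r]) from h).angleSum_eq A,
    by simpa using (show G.IsRotationAt w (p :: [q] ++ r :: []) from h).angleSum_eq A⟩

theorem angles_four {p q r s : D} (h : G.IsRotationAt w [p, q, r, s]) (A : D → ℕ) :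
    G.angleSum A p q = A p ∧ G.angleSum A p r = A p + A q ∧
      G.angleSum A p s = A p + A q + A r :=
  ⟨by simpa using (show G.IsRotationAt w (p :: [] ++ q :: [r, s]) from h).angleSum_eq A,
    by simpa using (show G.IsRotationAt w (p :: [q] ++ r :: [s]) from h).angleSum_eq A,
    by simpa [add_assoc] using (show G.IsRotationAt w (p :: [q, r] ++ s :: []) from h).angleSum_eq A⟩

/-- Turning from `a` to `b` and on to `a` again is a full turn. -/
theorem angleSum_add {a b : D} (h : G.IsRotationAt w L) (ha : a ∈ L) (hb : b ∈ L) (hab : a ≠ b)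
    {A : D → ℕ} (hA : G.AnglesAt A w) : G.angleSum A a b + G.angleSum A b a = 4 := by
  obtain ⟨l₁, l₂, rfl⟩ := List.append_of_mem ha
  have h1 : G.IsRotationAt w ((a :: l₂) ++ l₁) := h.append_comm
  have hb' : b ∈ l₂ ++ l₁ := by
    simp only [List.mem_append, List.mem_cons] at hb ⊢
    rcases hb with hb | rfl | hb
    · exact Or.inr hb
    · exact absurd rfl hab
    · exact Or.inl hb
  obtain ⟨m₁, m₂, hm⟩ := List.append_of_mem hb'
  rw [List.cons_append, hm] at h1
  have h2 : G.IsRotationAt w (a :: m₁ ++ b :: m₂) := h1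
  have h3 : G.IsRotationAt w (b :: m₂ ++ a :: m₁) := h2.append_comm
  rw [h2.angleSum_eq, h3.angleSum_eq, ← ((h2.anglesAt_iff A).1 hA).2]
  simp [add_assoc]

/-- Around a vertex of degree four all angles are 90 degrees. -/
theorem eq_one (h : G.IsRotationAt w L) (hL : L.length = 4) {A : D → ℕ} (hA : G.AnglesAt A w)
    {d : D} (hd : G.org d = w) : A d = 1 := by
  rw [h.anglesAt_iff] at hA
  match L, hL with
  | [p, q, r, s], _ =>
    have := (h.2.1 d).2 hd
    simp at hA this
    rcases this with rfl | rfl | rfl | rfl <;> omega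

end IsRotationAt

end PlaneGraph

namespace PlaneGraph

variable {V D : Type*} [Fintype V] [DecidableEq V] [Fintype D] [DecidableEq D]
  {G : PlaneGraph V D}

/-! ### Turns at a pole -/

/-- Twice the mean turn made by the spines that reach the vertex from outside of the fan `F`
(a list of consecutive darts in counterclockwise order) and continue with the dart `d` of `F`.
If the fan consists of one dart, spines start at the vertex itself. -/
noncomputable def poleTurn (G : PlaneGraph V D) (A : D → ℕ) (F : List D) (d : D) : ℤ :=
  if F.length = 1 then 0
  else 4 - (F.getLast?.elim 0 fun f => (G.angleSum A (G.rot f) d : ℤ)) -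
    (F.head?.elim 0 fun f => (G.angleSum A (G.rot.symm f) d : ℤ))

theorem poleTurn_congr {A A' : D → ℕ} {w : V} (h : ∀ d, G.org d = w → A d = A' d) {F : List D}
    (hF : ∀ f ∈ F, G.org f = w) (d : D) : G.poleTurn A F d = G.poleTurn A' F d := by
  have h1 : ∀ a, G.org a = w → G.angleSum A a d = G.angleSum A' a d := fun a ha =>
    angleSum_congr (fun d hd => h d (hd.trans ha)) d
  rcases F.eq_nil_or_concat with rfl | ⟨l, f, rfl⟩
  · simp [poleTurn]
  · have e1 := h1 (G.rot f) (by rw [G.org_rot]; exact hF f (by simp))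
    cases l with
    | nil => simp [poleTurn]
    | cons g l =>
      have e2 := h1 (G.rot.symm g) (by rw [G.org_rot_symm]; exact hF g (by simp))
      have hl : (g :: (l ++ [f])).getLast? = some f := by rw [← List.cons_append, List.getLast?_concat]
      simp [poleTurn, e1, e2, hl]

theorem poleTurn_singleton (A : D → ℕ) (f d : D) : G.poleTurn A [f] d = 0 := by
  simp [poleTurn]

namespace IsRotationAt

variable {w : V}

theorem poleTurn_eq {x d : D} {F : List D} (h : G.IsRotationAt w (F ++ [x])) (hF : F.length ≠ 1)
    (hF' : F ≠ []) (A : D → ℕ) : G.poleTurn A F d = 4 - 2 * (G.angleSum A x d : ℤ) := by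
  obtain ⟨l, f, rfl⟩ := (F.eq_nil_or_concat).resolve_left hF'
  have h1 : G.rot f = x :=
    (show G.IsRotationAt w (l ++ f :: x :: []) by simpa using h).rot_eq
  cases l with
  | nil => simp at hF
  | cons g l =>
    have h2 : G.rot x = g :=
      (show G.IsRotationAt w (g :: (l ++ [f]) ++ [x]) by simpa using h).rot_getLast
    have h3 : G.rot.symm g = x := by rw [← h2, Equiv.symm_apply_apply]
    have hl : (g :: (l ++ [f])).getLast? = some f := by rw [← List.cons_append, List.getLast?_concat]
    simp [poleTurn, h1, h3, hl]
    ring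

theorem poleTurn_two {f g x y : D} (h : G.IsRotationAt w [f, g, x, y]) {A : D → ℕ}
    (hA : G.AnglesAt A w) : G.poleTurn A [f, g] f = 1 ∧ G.poleTurn A [f, g] g = -1 := by
  have h1 : G.rot g = x := (show G.IsRotationAt w ([f] ++ g :: x :: [y]) from h).rot_eq
  have h2 : G.rot y = f := (show G.IsRotationAt w (f :: [g, x] ++ [y]) from h).rot_getLast
  have h3 : G.rot.symm f = y := by rw [← h2, Equiv.symm_apply_apply]
  have hx : G.IsRotationAt w [x, y, f, g] :=
    append_comm (L₁ := [f, g]) (L₂ := [x, y]) h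
  have hy : G.IsRotationAt w [y, f, g, x] :=
    append_comm (L₁ := [f, g, x]) (L₂ := [y]) h
  have e : ∀ d ∈ [f, g, x, y], A d = 1 := fun d hd => h.eq_one rfl hA ((h.2.1 d).1 hd)
  have := hx.angles_four A
  have := hy.angles_four A
  simp only [List.forall_mem_cons] at e
  constructor <;> simp [poleTurn, *]

end IsRotationAt

/-- When a fan `F₁ ++ F₂` is split into two fans, the turns at the pole change by constants. -/
def Offsets (G : PlaneGraph V D) (A : D → ℕ) (F₁ F₂ : List D) (δ₁ δ₂ : ℤ) : Prop :=
  (∀ d ∈ F₁, G.poleTurn A (F₁ ++ F₂) d = G.poleTurn A F₁ d + δ₁) ∧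
  (∀ d ∈ F₂, G.poleTurn A (F₁ ++ F₂) d = G.poleTurn A F₂ d - δ₂)

theorem Offsets.congr {A A' : D → ℕ} {w : V} (h : ∀ d, G.org d = w → A d = A' d)
    {F₁ F₂ : List D} (h₁ : ∀ f ∈ F₁, G.org f = w) (h₂ : ∀ f ∈ F₂, G.org f = w) {δ₁ δ₂ : ℤ}
    (hO : G.Offsets A F₁ F₂ δ₁ δ₂) : G.Offsets A' F₁ F₂ δ₁ δ₂ := by
  have h₃ : ∀ f ∈ F₁ ++ F₂, G.org f = w := by
    intro f hf
    rcases List.mem_append.1 hf with hf | hf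
    exacts [h₁ f hf, h₂ f hf]
  refine ⟨fun d hd => ?_, fun d hd => ?_⟩
  · rw [← poleTurn_congr h h₃, ← poleTurn_congr h h₁, hO.1 d hd]
  · rw [← poleTurn_congr h h₃, ← poleTurn_congr h h₂, hO.2 d hd]

/-- The possible offsets for fans of `i` and `j` darts at a vertex with `x` further darts. -/
def AllowedOffsets (i j x : ℕ) (δ₁ δ₂ : ℤ) : Prop :=
  (i = 1 ∧ j = 1 ∧ x = 1 ∧ (δ₁ = 0 ∧ δ₂ = 2 ∨ δ₁ = 2 ∧ δ₂ = 0 ∨ δ₁ = 2 ∧ δ₂ = 2)) ∨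
  (i = 1 ∧ j = 1 ∧ x = 2 ∧ δ₁ = 1 ∧ δ₂ = 1) ∨
  (i = 1 ∧ j = 2 ∧ x = 1 ∧ δ₁ = 2 ∧ δ₂ = 1) ∨
  (i = 2 ∧ j = 1 ∧ x = 1 ∧ δ₁ = 1 ∧ δ₂ = 2)

theorem list_length_cases {F₁ F₂ X : List D} (h₁ : F₁ ≠ []) (h₂ : F₂ ≠ []) (h₃ : X ≠ [])
    (h : (F₁ ++ F₂ ++ X).length ≤ 4) :
    (∃ f g x, F₁ = [f] ∧ F₂ = [g] ∧ X = [x]) ∨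
    (∃ f g x y, F₁ = [f] ∧ F₂ = [g] ∧ X = [x, y]) ∨
    (∃ f g g' x, F₁ = [f] ∧ F₂ = [g, g'] ∧ X = [x]) ∨
    (∃ f f' g x, F₁ = [f, f'] ∧ F₂ = [g] ∧ X = [x]) := by
  match F₁, F₂, X, h₁, h₂, h₃ with
  | [f], [g], [x], _, _, _ => simp
  | [f], [g], [x, y], _, _, _ => simp
  | [f], [g, g'], [x], _, _, _ => simp
  | [f, f'], [g], [x], _, _, _ => simp
  | f :: f' :: f'' :: F, g :: F', x :: X, _, _, _ => simp at h; omega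
  | f :: f' :: F, g :: g' :: F', x :: X, _, _, _ => simp at h; omega
  | f :: f' :: F, g :: F', x :: y :: X, _, _, _ => simp at h; omega
  | f :: F, g :: g' :: F', x :: y :: X, _, _, _ => simp at h; omega
  | f :: F, g :: g' :: g'' :: F', x :: X, _, _, _ => simp at h; omega
  | f :: F, g :: F', x :: y :: z :: X, _, _, _ => simp at h; omega

theorem exists_offsets {w : V} {F₁ F₂ X : List D} (h : G.IsRotationAt w (F₁ ++ F₂ ++ X))
    (h₁ : F₁ ≠ []) (h₂ : F₂ ≠ []) (h₃ : X ≠ []) (hd : G.degree w ≤ 4) {A : D → ℕ}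
    (hA : G.AnglesAt A w) :
    ∃ δ₁ δ₂, G.Offsets A F₁ F₂ δ₁ δ₂ ∧ AllowedOffsets F₁.length F₂.length X.length δ₁ δ₂ := by
  rw [h.degree_eq] at hd
  have hA' := (h.anglesAt_iff A).1 hA
  rcases list_length_cases h₁ h₂ h₃ hd with ⟨f, g, x, rfl, rfl, rfl⟩ | ⟨f, g, x, y, rfl, rfl, rfl⟩ |
    ⟨f, g, g', x, rfl, rfl, rfl⟩ | ⟨f, f', g, x, rfl, rfl, rfl⟩
  · have h' : G.IsRotationAt w ([f, g] ++ [x]) := h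
    have hx : G.IsRotationAt w [x, f, g] := h'.append_comm
    have := hx.angles_three A
    simp at hA'
    refine ⟨4 - 2 * A x, 4 - 2 * A g, ⟨?_, ?_⟩, ?_⟩
    · simp [poleTurn_singleton, h'.poleTurn_eq (by simp) (by simp), *]
    · simp [poleTurn_singleton, h'.poleTurn_eq (by simp) (by simp), *]
      omega
    · simp [AllowedOffsets]; omega
  · have h' : G.IsRotationAt w [f, g, x, y] := h
    have := h'.poleTurn_two hA
    refine ⟨1, 1, ⟨?_, ?_⟩, ?_⟩ <;> simp [poleTurn_singleton, AllowedOffsets, *]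
  · have h' : G.IsRotationAt w ([f, g, g'] ++ [x]) := h
    have hx : G.IsRotationAt w [x, f, g, g'] := h'.append_comm
    have hg : G.IsRotationAt w [g, g', x, f] :=
      IsRotationAt.append_comm (L₁ := [f]) (L₂ := [g, g', x]) h
    have := hx.angles_four A
    have := hg.poleTurn_two hA
    have e : ∀ d ∈ [f, g, g', x], A d = 1 := fun d hd => h.eq_one rfl hA ((h.2.1 d).1 hd)
    simp only [List.forall_mem_cons] at e
    refine ⟨2, 1, ⟨?_, ?_⟩, ?_⟩ <;>
      simp [poleTurn_singleton, AllowedOffsets, h'.poleTurn_eq (by simp) (by simp), *]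
  · have h' : G.IsRotationAt w ([f, f', g] ++ [x]) := h
    have hx : G.IsRotationAt w [x, f, f', g] := h'.append_comm
    have hg : G.IsRotationAt w [f, f', g, x] := h
    have := hx.angles_four A
    have := hg.poleTurn_two hA
    have e : ∀ d ∈ [f, f', g, x], A d = 1 := fun d hd => h.eq_one rfl hA ((h.2.1 d).1 hd)
    simp only [List.forall_mem_cons] at e
    refine ⟨1, 2, ⟨?_, ?_⟩, ?_⟩ <;>
      simp [poleTurn_singleton, AllowedOffsets, h'.poleTurn_eq (by simp) (by simp), *]

theorem AllowedOffsets.unique {i j x : ℕ} {δ₁ δ₂ ε₁ ε₂ : ℤ} (h : AllowedOffsets i j x δ₁ δ₂)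
    (h' : AllowedOffsets i j x ε₁ ε₂) (hij : i ≠ 1 ∨ j ≠ 1) : ε₁ = δ₁ ∧ ε₂ = δ₂ := by
  unfold AllowedOffsets at h h'
  omega

theorem exists_angles_of_offsets {w : V} {F₁ F₂ X : List D}
    (h : G.IsRotationAt w (F₁ ++ F₂ ++ X)) (h₁ : F₁ ≠ []) (h₂ : F₂ ≠ []) (h₃ : X ≠ [])
    (hd : G.degree w ≤ 4) {δ₁ δ₂ : ℤ}
    (hδ : AllowedOffsets F₁.length F₂.length X.length δ₁ δ₂) :
    ∃ A : D → ℕ, G.AnglesAt A w ∧ G.Offsets A F₁ F₂ δ₁ δ₂ := by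
  have hl := hd
  rw [h.degree_eq] at hl
  have big : (F₁ ++ F₂ ++ X).length = 4 →
      (∀ ε₁ ε₂, AllowedOffsets F₁.length F₂.length X.length ε₁ ε₂ → ε₁ = δ₁ ∧ ε₂ = δ₂) →
      ∃ A : D → ℕ, G.AnglesAt A w ∧ G.Offsets A F₁ F₂ δ₁ δ₂ := fun h4 hu => by
    have hA : G.AnglesAt (fun _ => 1) w := by
      rw [h.anglesAt_iff]; simpa using h4
    obtain ⟨ε₁, ε₂, hO, ha⟩ := exists_offsets h h₁ h₂ h₃ hd hA
    obtain ⟨rfl, rfl⟩ := hu _ _ ha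
    exact ⟨_, hA, hO⟩
  rcases list_length_cases h₁ h₂ h₃ hl with ⟨f, g, x, rfl, rfl, rfl⟩ | ⟨f, g, x, y, rfl, rfl, rfl⟩ |
    ⟨f, g, g', x, rfl, rfl, rfl⟩ | ⟨f, f', g, x, rfl, rfl, rfl⟩
  · have hn := h.1
    simp at hn
    obtain ⟨⟨n1, n2⟩, n3⟩ := hn
    simp [AllowedOffsets] at hδ
    let A : D → ℕ := fun d => if d = f then ((δ₁ + δ₂) / 2).toNat else
      if d = g then ((4 - δ₂) / 2).toNat else ((4 - δ₁) / 2).toNat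
    have ef : A f = ((δ₁ + δ₂) / 2).toNat := by simp [A]
    have eg : A g = ((4 - δ₂) / 2).toNat := by simp [A, Ne.symm n1]
    have ex : A x = ((4 - δ₁) / 2).toNat := by simp [A, Ne.symm n2, Ne.symm n3]
    have hA : G.AnglesAt A w := by
      rw [h.anglesAt_iff]
      simp [ef, eg, ex]
      omega
    have h' : G.IsRotationAt w ([f, g] ++ [x]) := h
    have hx : G.IsRotationAt w [x, f, g] := h'.append_comm
    have := hx.angles_three A
    refine ⟨A, hA, ?_, ?_⟩ <;>
    · simp [poleTurn_singleton, h'.poleTurn_eq (by simp) (by simp), this, ef, eg, ex]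
      omega
  all_goals
    refine big rfl fun ε₁ ε₂ hε => ?_
    simp [AllowedOffsets] at hδ hε
    omega

theorem poleTurn_sub_poleTurn {w : V} {F₁ F₂ X : List D} {f g : D}
    (h : G.IsRotationAt w (F₁ ++ [f] ++ (g :: F₂) ++ X)) (h₃ : X ≠ []) (hd : G.degree w ≤ 4)
    {A : D → ℕ} (hA : G.AnglesAt A w) :
    G.poleTurn A (F₁ ++ [f] ++ (g :: F₂)) f - G.poleTurn A (F₁ ++ [f] ++ (g :: F₂)) g =
      2 * A f := by
  have hl := hd
  rw [h.degree_eq] at hl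
  rcases list_length_cases (by simp) (by simp) h₃ hl with ⟨f', g', x, e1, e2, rfl⟩ |
    ⟨f', g', x, y, e1, e2, rfl⟩ | ⟨f', g', g'', x, e1, e2, rfl⟩ | ⟨f', f'', g', x, e1, e2, rfl⟩
  · rw [e1, e2] at h ⊢
    obtain ⟨rfl, rfl⟩ : F₁ = [] ∧ f = f' := by
      cases F₁ <;> simp_all
    obtain ⟨rfl, rfl⟩ : g = g' ∧ F₂ = [] := by simpa using e2
    have h' : G.IsRotationAt w ([f, g] ++ [x]) := h
    have hx : G.IsRotationAt w [x, f, g] := h'.append_comm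
    have := hx.angles_three A
    simp [h'.poleTurn_eq (by simp) (by simp), this]
    ring
  · rw [e1, e2] at h ⊢
    obtain ⟨rfl, rfl⟩ : F₁ = [] ∧ f = f' := by
      cases F₁ <;> simp_all
    obtain ⟨rfl, rfl⟩ : g = g' ∧ F₂ = [] := by simpa using e2
    have h' : G.IsRotationAt w [f, g, x, y] := h
    have := h'.poleTurn_two hA
    have e := h'.eq_one rfl hA ((h'.2.1 f).1 (by simp))
    simp [this, e]
  · rw [e1, e2] at h ⊢
    obtain ⟨rfl, rfl⟩ : F₁ = [] ∧ f = f' := by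
      cases F₁ <;> simp_all
    obtain ⟨rfl, rfl⟩ : g = g' ∧ F₂ = [g''] := by simpa using e2
    have h' : G.IsRotationAt w ([f, g, g''] ++ [x]) := h
    have hx : G.IsRotationAt w [x, f, g, g''] := h'.append_comm
    have := hx.angles_four A
    simp [h'.poleTurn_eq (by simp) (by simp), this]
    ring
  · rw [e1, e2] at h ⊢
    obtain ⟨rfl, rfl⟩ : F₁ = [f'] ∧ f = f'' := by
      cases F₁ with
      | nil => simp at e1
      | cons a l => cases l <;> simp_all
    obtain ⟨rfl, rfl⟩ : g = g' ∧ F₂ = [] := by simpa using e2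
    have h' : G.IsRotationAt w ([f', f, g] ++ [x]) := h
    have hx : G.IsRotationAt w [x, f', f, g] := h'.append_comm
    have := hx.angles_four A
    simp [h'.poleTurn_eq (by simp) (by simp), this]
    ring

/-! ### Turns at the vertex between two components in series -/

/-- The turn from a dart of the fan `F` to a dart of the fan `F'` is the sum of the turns at the
pole, seen from both sides, up to the constant `τ / 2`. -/
def JunctionTurn (G : PlaneGraph V D) (A : D → ℕ) (F F' : List D) (τ : ℤ) : Prop :=
  ∀ d ∈ F, ∀ d' ∈ F',
    2 * (2 - (G.angleSum A d d' : ℤ)) = -G.poleTurn A F d + G.poleTurn A F' d' + τ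

theorem JunctionTurn.congr {A A' : D → ℕ} {w : V} (h : ∀ d, G.org d = w → A d = A' d)
    {F F' : List D} (h₁ : ∀ f ∈ F, G.org f = w) (h₂ : ∀ f ∈ F', G.org f = w) {τ : ℤ}
    (hJ : G.JunctionTurn A F F' τ) : G.JunctionTurn A' F F' τ := by
  intro d hd d' hd'
  rw [← poleTurn_congr h h₁, ← poleTurn_congr h h₂, ← hJ d hd d' hd',
    angleSum_congr (fun x hx => h x (hx.trans (h₁ d hd)))]

/-- The possible constants for fans of `i` and `j` darts. -/
def AllowedJunction (i j : ℕ) (τ : ℤ) : Prop :=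
  τ = 0 ∨ i = 1 ∧ j = 1 ∧ (τ = 2 ∨ τ = -2)

theorem exists_junctionTurn {w : V} {F F' : List D} (h : G.IsRotationAt w (F ++ F'))
    (h₁ : F ≠ []) (h₂ : F' ≠ []) (hd : G.degree w ≤ 4) {A : D → ℕ} (hA : G.AnglesAt A w) :
    ∃ τ, G.JunctionTurn A F F' τ ∧ AllowedJunction F.length F'.length τ := by
  rw [h.degree_eq] at hd
  have hA' := (h.anglesAt_iff A).1 hA
  have h' := h.append_comm
  have hne : ∀ d ∈ F, ∀ d' ∈ F', G.angleSum A d d' + G.angleSum A d' d = 4 := fun d hd d' hd' =>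
    h.angleSum_add (by simp [hd]) (by simp [hd']) ((List.nodup_append.1 h.1).2.2 d hd d' hd') hA
  by_cases e1 : F.length = 1
  · obtain ⟨f, rfl⟩ := List.length_eq_one_iff.1 e1
    by_cases e2 : F'.length = 1
    · obtain ⟨g, rfl⟩ := List.length_eq_one_iff.1 e2
      have h2 := (show G.IsRotationAt w [f, g] from h).angles_two A
      simp at hA'
      refine ⟨2 * (2 - A f), ?_, ?_⟩
      · simp [JunctionTurn, poleTurn_singleton, h2]
      · simp [AllowedJunction]; omega
    · refine ⟨0, fun d hd d' hd' => ?_, Or.inl rfl⟩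
      obtain rfl : d = f := by simpa using hd
      rw [h'.poleTurn_eq e2 h₂, poleTurn_singleton]
      ring
  · by_cases e2 : F'.length = 1
    · obtain ⟨g, rfl⟩ := List.length_eq_one_iff.1 e2
      refine ⟨0, fun d hf d' hd' => ?_, Or.inl rfl⟩
      obtain rfl : d' = g := by simpa using hd'
      rw [h.poleTurn_eq e1 h₁, poleTurn_singleton]
      have := hne d hf d' hd'
      omega
    · have : F.length ≠ 0 := by simpa using h₁
      have : F'.length ≠ 0 := by simpa using h₂
      rw [List.length_append] at hd
      obtain ⟨f, g, rfl⟩ := List.length_eq_two.1 (show F.length = 2 by omega)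
      obtain ⟨x, y, rfl⟩ := List.length_eq_two.1 (show F'.length = 2 by omega)
      have h2 : G.IsRotationAt w [f, g, x, y] := h
      have h3 : G.IsRotationAt w [x, y, f, g] := h'
      have h4 : G.IsRotationAt w [g, x, y, f] :=
        IsRotationAt.append_comm (L₁ := [f]) (L₂ := [g, x, y]) h
      have a1 := h2.poleTurn_two hA
      have a2 := h3.poleTurn_two hA
      have a3 := h2.angles_four A
      have a4 := h4.angles_four A
      have e : ∀ d ∈ [f, g, x, y], A d = 1 := fun d hd => h.eq_one rfl hA ((h.2.1 d).1 hd)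
      simp only [List.forall_mem_cons] at e
      refine ⟨0, ?_, Or.inl rfl⟩
      simp [JunctionTurn, a1, a2, a3, a4, e]

theorem exists_angles_of_junctionTurn {w : V} {F F' : List D} (h : G.IsRotationAt w (F ++ F'))
    (h₁ : F.length = 1) (h₂ : F'.length = 1) {τ : ℤ}
    (hτ : AllowedJunction F.length F'.length τ) :
    ∃ A : D → ℕ, G.AnglesAt A w ∧ G.JunctionTurn A F F' τ := by
  obtain ⟨f, rfl⟩ := List.length_eq_one_iff.1 h₁
  obtain ⟨g, rfl⟩ := List.length_eq_one_iff.1 h₂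
  have hn := h.1
  simp at hn
  simp [AllowedJunction] at hτ
  let A : D → ℕ := fun d => if d = f then ((4 - τ) / 2).toNat else ((4 + τ) / 2).toNat
  have ef : A f = ((4 - τ) / 2).toNat := by simp [A]
  have eg : A g = ((4 + τ) / 2).toNat := by simp [A, Ne.symm hn]
  refine ⟨A, ?_, ?_⟩
  · rw [h.anglesAt_iff]
    simp [ef, eg]
    omega
  · have h2 := (show G.IsRotationAt w [f, g] from h).angles_two A
    simp [JunctionTurn, poleTurn_singleton, h2, ef]
    omega

end PlaneGraph

/-! ### Series-parallel terms -/

/-- Two-terminal series-parallel graphs, built from single edges by binary series compositions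
(from source to sink) and binary parallel compositions (from left to right). -/
inductive SPTerm (D : Type*) where
  | edge (d : D) : SPTerm D
  | ser (a b : SPTerm D) : SPTerm D
  | par (a b : SPTerm D) : SPTerm D

namespace SPTerm

variable {V D : Type*} [Fintype V] [DecidableEq V] [Fintype D] [DecidableEq D]

/-- The source pole. -/
def src (G : PlaneGraph V D) : SPTerm D → V
  | edge d => G.org d
  | ser a _ => a.src G
  | par a _ => a.src G

/-- The sink pole. -/
def snk (G : PlaneGraph V D) : SPTerm D → V
  | edge d => G.org (G.rev d)
  | ser _ b => b.snk G
  | par a _ => a.snk G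

/-- The darts, in both directions. -/
def darts (G : PlaneGraph V D) : SPTerm D → Finset D
  | edge d => {d, G.rev d}
  | ser a b => a.darts G ∪ b.darts G
  | par a b => a.darts G ∪ b.darts G

/-- The vertices. -/
def verts (G : PlaneGraph V D) (t : SPTerm D) : Finset V := (t.darts G).image G.org

/-- The darts that leave the source, from left to right. -/
def srcFan : SPTerm D → List D
  | edge d => [d]
  | ser a _ => a.srcFan
  | par a b => a.srcFan ++ b.srcFan

/-- The darts that leave the sink, from left to right. -/
def snkFan (G : PlaneGraph V D) : SPTerm D → List D
  | edge d => [G.rev d]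
  | ser _ b => b.snkFan G
  | par a b => a.snkFan G ++ b.snkFan G

/-- The left boundary, from the source to the sink. -/
def left : SPTerm D → List D
  | edge d => [d]
  | ser a b => a.left ++ b.left
  | par a _ => a.left

/-- The right boundary, from the source to the sink. -/
def right : SPTerm D → List D
  | edge d => [d]
  | ser a b => a.right ++ b.right
  | par _ b => b.right

/-- The vertices at which the angles matter for the shape of the component: all but the poles at
which it has a single dart. -/
def own (G : PlaneGraph V D) : SPTerm D → Finset V
  | edge _ => ∅
  | ser a b => insert (a.snk G) (a.own G ∪ b.own G)
  | par a b => insert (a.src G) (insert (a.snk G) (a.own G ∪ b.own G))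

/-- The paths from the source to the sink. -/
def Thru : SPTerm D → List D → Prop
  | edge d, p => p = [d]
  | ser a b, p => ∃ p₁ p₂, p = p₁ ++ p₂ ∧ a.Thru p₁ ∧ b.Thru p₂
  | par a b, p => a.Thru p ∨ b.Thru p

/-- The term describes a part of the plane graph `G`. -/
def Valid (G : PlaneGraph V D) : SPTerm D → Prop
  | edge d => G.org d ≠ G.org (G.rev d)
  | ser a b => a.Valid G ∧ b.Valid G ∧ a.snk G = b.src G ∧
      G.IsRotationAt (a.snk G) (a.snkFan G ++ b.srcFan.reverse) ∧
      Disjoint (a.darts G) (b.darts G) ∧ ∀ w ∈ a.verts G, w ∈ b.verts G → w = a.snk G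
  | par a b => a.Valid G ∧ b.Valid G ∧ a.src G = b.src G ∧ a.snk G = b.snk G ∧
      Disjoint (a.darts G) (b.darts G) ∧
      ∀ w ∈ a.verts G, w ∈ b.verts G → w = a.src G ∨ w = a.snk G

/-- At both poles the component occupies consecutive positions, but not all of them. -/
def Placed (G : PlaneGraph V D) (t : SPTerm D) : Prop :=
  (∃ X, X ≠ [] ∧ G.IsRotationAt (t.src G) (t.srcFan.reverse ++ X)) ∧
  (∃ Y, Y ≠ [] ∧ G.IsRotationAt (t.snk G) (t.snkFan G ++ Y))

/-- The relation between the subterms and the term. -/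
inductive Sub : SPTerm D → SPTerm D → Prop
  | refl (t : SPTerm D) : Sub t t
  | serLeft {s a : SPTerm D} (b : SPTerm D) : Sub s a → Sub s (ser a b)
  | serRight {s b : SPTerm D} (a : SPTerm D) : Sub s b → Sub s (ser a b)
  | parLeft {s a : SPTerm D} (b : SPTerm D) : Sub s a → Sub s (par a b)
  | parRight {s b : SPTerm D} (a : SPTerm D) : Sub s b → Sub s (par a b)

variable {G : PlaneGraph V D}

theorem srcFan_ne_nil (t : SPTerm D) : t.srcFan ≠ [] := by
  induction t <;> simp_all [srcFan]

theorem snkFan_ne_nil (G : PlaneGraph V D) (t : SPTerm D) : t.snkFan G ≠ [] := by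
  induction t <;> simp_all [snkFan]

theorem length_srcFan_pos (t : SPTerm D) : 0 < t.srcFan.length :=
  List.length_pos_of_ne_nil t.srcFan_ne_nil

theorem length_snkFan_pos (G : PlaneGraph V D) (t : SPTerm D) : 0 < (t.snkFan G).length :=
  List.length_pos_of_ne_nil (t.snkFan_ne_nil G)

theorem org_mem_verts {t : SPTerm D} {d : D} (h : d ∈ t.darts G) : G.org d ∈ t.verts G :=
  Finset.mem_image_of_mem _ h

theorem rev_mem_darts {t : SPTerm D} {d : D} (h : d ∈ t.darts G) : G.rev d ∈ t.darts G := by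
  induction t with
  | edge e =>
    simp only [darts, Finset.mem_insert, Finset.mem_singleton] at h ⊢
    rcases h with rfl | rfl
    · exact Or.inr rfl
    · exact Or.inl (G.rev_rev _)
  | ser a b iha ihb =>
    simp only [darts, Finset.mem_union] at h ⊢
    exact h.imp iha ihb
  | par a b iha ihb =>
    simp only [darts, Finset.mem_union] at h ⊢
    exact h.imp iha ihb

theorem org_rev_mem_verts {t : SPTerm D} {d : D} (h : d ∈ t.darts G) :
    G.org (G.rev d) ∈ t.verts G :=
  org_mem_verts (rev_mem_darts h)

theorem verts_ser (a b : SPTerm D) : (ser a b).verts G = a.verts G ∪ b.verts G :=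
  Finset.image_union _ _

theorem verts_par (a b : SPTerm D) : (par a b).verts G = a.verts G ∪ b.verts G :=
  Finset.image_union _ _

theorem src_mem_verts (t : SPTerm D) : t.src G ∈ t.verts G := by
  induction t with
  | edge d => exact org_mem_verts (by simp [darts])
  | ser a b iha _ => rw [verts_ser]; exact Finset.mem_union_left _ iha
  | par a b iha _ => rw [verts_par]; exact Finset.mem_union_left _ iha

theorem snk_mem_verts (t : SPTerm D) : t.snk G ∈ t.verts G := by
  induction t with
  | edge d => exact org_mem_verts (by simp [darts])
  | ser a b _ ihb => rw [verts_ser]; exact Finset.mem_union_right _ ihb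
  | par a b iha _ => rw [verts_par]; exact Finset.mem_union_left _ iha

theorem Valid.src_ne_snk {t : SPTerm D} (h : t.Valid G) : t.src G ≠ t.snk G := by
  induction t with
  | edge d => exact h
  | ser a b iha ihb =>
    intro e
    have h1 : a.src G = b.snk G := e
    exact iha h.1 (h.2.2.2.2.2 _ a.src_mem_verts (h1 ▸ b.snk_mem_verts))
  | par a b iha ihb => exact iha h.1

theorem Valid.src_notMem_right {a b : SPTerm D} (h : (ser a b).Valid G) :
    a.src G ∉ b.verts G := fun hm =>
  h.1.src_ne_snk (h.2.2.2.2.2 _ a.src_mem_verts hm)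

theorem Valid.snk_notMem_left {a b : SPTerm D} (h : (ser a b).Valid G) :
    b.snk G ∉ a.verts G := fun hm => by
  have := h.2.2.2.2.2 _ hm b.snk_mem_verts
  rw [h.2.2.1] at this
  exact h.2.1.src_ne_snk this.symm

theorem Valid.mem_srcFan {t : SPTerm D} (h : t.Valid G) (d : D) :
    d ∈ t.srcFan ↔ d ∈ t.darts G ∧ G.org d = t.src G := by
  induction t with
  | edge e =>
    simp only [srcFan, darts, src, List.mem_singleton, Finset.mem_insert, Finset.mem_singleton]
    constructor
    · rintro rfl; exact ⟨Or.inl rfl, rfl⟩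
    · rintro ⟨rfl | rfl, e⟩
      · rfl
      · exact absurd e.symm h
  | ser a b iha ihb =>
    simp only [srcFan, darts, src, Finset.mem_union, iha h.1]
    constructor
    · rintro ⟨h1, h2⟩; exact ⟨Or.inl h1, h2⟩
    · rintro ⟨h1 | h1, h2⟩
      · exact ⟨h1, h2⟩
      · exact absurd (h2 ▸ org_mem_verts h1) h.src_notMem_right
  | par a b iha ihb =>
    simp only [srcFan, darts, src, Finset.mem_union, List.mem_append, iha h.1, ihb h.2.1,
      ← h.2.2.1]
    tauto

theorem Valid.mem_snkFan {t : SPTerm D} (h : t.Valid G) (d : D) :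
    d ∈ t.snkFan G ↔ d ∈ t.darts G ∧ G.org d = t.snk G := by
  induction t with
  | edge e =>
    simp only [snkFan, darts, snk, List.mem_singleton, Finset.mem_insert, Finset.mem_singleton]
    constructor
    · rintro rfl; exact ⟨Or.inr rfl, rfl⟩
    · rintro ⟨rfl | rfl, e⟩
      · exact absurd e h
      · rfl
  | ser a b iha ihb =>
    simp only [snkFan, darts, snk, Finset.mem_union, ihb h.2.1]
    constructor
    · rintro ⟨h1, h2⟩; exact ⟨Or.inr h1, h2⟩
    · rintro ⟨h1 | h1, h2⟩
      · exact absurd (h2 ▸ org_mem_verts h1) h.snk_notMem_left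
      · exact ⟨h1, h2⟩
  | par a b iha ihb =>
    simp only [snkFan, darts, snk, Finset.mem_union, List.mem_append, iha h.1, ihb h.2.1,
      ← h.2.2.2.1]
    tauto

/-! ### Placement of the subterms -/

theorem Placed.ser_left {a b : SPTerm D} (h : (ser a b).Valid G) (hp : (ser a b).Placed G) :
    a.Placed G :=
  ⟨hp.1, _, by simpa using b.srcFan_ne_nil, h.2.2.2.1⟩

theorem Placed.ser_right {a b : SPTerm D} (h : (ser a b).Valid G) (hp : (ser a b).Placed G) :
    b.Placed G :=
  ⟨⟨_, a.snkFan_ne_nil G, h.2.2.1 ▸ h.2.2.2.1.append_comm⟩, hp.2⟩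

theorem Placed.par_left {a b : SPTerm D} (hp : (par a b).Placed G) : a.Placed G := by
  obtain ⟨⟨X, hX, hx⟩, Y, hY, hy⟩ := hp
  refine ⟨⟨X ++ b.srcFan.reverse, by simp [hX], ?_⟩, b.snkFan G ++ Y, by simp [hY], ?_⟩
  · rw [← List.append_assoc]
    apply PlaneGraph.IsRotationAt.append_comm
    simpa [srcFan, src] using hx
  · simpa [snkFan, snk] using hy

theorem Placed.par_right {a b : SPTerm D} (h : (par a b).Valid G) (hp : (par a b).Placed G) :
    b.Placed G := by
  obtain ⟨⟨X, hX, hx⟩, Y, hY, hy⟩ := hp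
  refine ⟨⟨a.srcFan.reverse ++ X, by simp [hX], ?_⟩, Y ++ a.snkFan G, by simp [hY], ?_⟩
  · simpa [srcFan, src, ← h.2.2.1] using hx
  · rw [← List.append_assoc, ← h.2.2.2.1]
    apply PlaneGraph.IsRotationAt.append_comm
    simpa [snkFan, snk] using hy

theorem Sub.valid_placed {s t : SPTerm D} (hs : Sub s t) (h : t.Valid G) (hp : t.Placed G) :
    s.Valid G ∧ s.Placed G := by
  induction hs with
  | refl => exact ⟨h, hp⟩
  | serLeft b _ ih => exact ih h.1 (hp.ser_left h)
  | serRight a _ ih => exact ih h.2.1 (hp.ser_right h)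
  | parLeft b _ ih => exact ih h.1 hp.par_left
  | parRight a _ ih => exact ih h.2.1 (hp.par_right h)

theorem Sub.darts_subset {s t : SPTerm D} (hs : Sub s t) : s.darts G ⊆ t.darts G := by
  induction hs with
  | refl => exact Finset.Subset.refl _
  | serLeft b _ ih => exact ih.trans Finset.subset_union_left
  | serRight a _ ih => exact ih.trans Finset.subset_union_right
  | parLeft b _ ih => exact ih.trans Finset.subset_union_left
  | parRight a _ ih => exact ih.trans Finset.subset_union_right

/-! ### Owned vertices -/

theorem own_subset_verts (t : SPTerm D) : t.own G ⊆ t.verts G := by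
  induction t with
  | edge d => simp [own]
  | ser a b iha ihb =>
    rw [verts_ser, own, Finset.insert_subset_iff]
    exact ⟨Finset.mem_union_left _ a.snk_mem_verts, Finset.union_subset_union iha ihb⟩
  | par a b iha ihb =>
    rw [verts_par, own, Finset.insert_subset_iff, Finset.insert_subset_iff]
    exact ⟨Finset.mem_union_left _ a.src_mem_verts, Finset.mem_union_left _ a.snk_mem_verts,
      Finset.union_subset_union iha ihb⟩

theorem Sub.own_subset {s t : SPTerm D} (hs : Sub s t) : s.own G ⊆ t.own G := by
  induction hs with
  | refl => exact Finset.Subset.refl _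
  | serLeft b _ ih =>
    exact (ih.trans Finset.subset_union_left).trans (Finset.subset_insert _ _)
  | serRight a _ ih =>
    exact (ih.trans Finset.subset_union_right).trans (Finset.subset_insert _ _)
  | parLeft b _ ih =>
    exact (ih.trans Finset.subset_union_left).trans
      ((Finset.subset_insert _ _).trans (Finset.subset_insert _ _))
  | parRight a _ ih =>
    exact (ih.trans Finset.subset_union_right).trans
      ((Finset.subset_insert _ _).trans (Finset.subset_insert _ _))

theorem Valid.src_mem_own {t : SPTerm D} (h : t.Valid G) :
    t.src G ∈ t.own G ↔ 2 ≤ t.srcFan.length := by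
  induction t with
  | edge d => simp [own, srcFan]
  | ser a b iha ihb =>
    simp only [own, src, srcFan, Finset.mem_insert, Finset.mem_union, ← iha h.1]
    have h1 : a.src G ∉ b.own G := fun hm => h.src_notMem_right (b.own_subset_verts hm)
    have h2 := h.1.src_ne_snk
    tauto
  | par a b iha ihb =>
    have := a.length_srcFan_pos
    have := b.length_srcFan_pos
    simp only [own, src, srcFan, Finset.mem_insert, true_or, List.length_append, true_iff]
    omega

theorem Valid.snk_mem_own {t : SPTerm D} (h : t.Valid G) :
    t.snk G ∈ t.own G ↔ 2 ≤ (t.snkFan G).length := by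
  induction t with
  | edge d => simp [own, snkFan]
  | ser a b iha ihb =>
    simp only [own, snk, snkFan, Finset.mem_insert, Finset.mem_union, ← ihb h.2.1]
    have h1 : b.snk G ∉ a.own G := fun hm => h.snk_notMem_left (a.own_subset_verts hm)
    have h2 : b.snk G ≠ a.snk G := fun e => h.snk_notMem_left (e ▸ a.snk_mem_verts)
    tauto
  | par a b iha ihb =>
    have := a.length_snkFan_pos G
    have := b.length_snkFan_pos G
    simp only [own, snk, snkFan, Finset.mem_insert, true_or, or_true, List.length_append,
      true_iff]
    omega

theorem Valid.mem_own_or {t : SPTerm D} (h : t.Valid G) {w : V} (hw : w ∈ t.verts G) :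
    w ∈ t.own G ∨ w = t.src G ∨ w = t.snk G := by
  induction t with
  | edge d =>
    simp only [verts, darts, Finset.image_insert, Finset.image_singleton, Finset.mem_insert,
      Finset.mem_singleton] at hw
    exact Or.inr hw
  | ser a b iha ihb =>
    simp only [verts_ser, own, src, snk, Finset.mem_insert, Finset.mem_union] at hw ⊢
    have h1 := h.2.2.1
    rcases hw with hw | hw
    · rcases iha h.1 hw with h | h | h <;> tauto
    · rcases ihb h.2.1 hw with h | h | h <;> simp_all
  | par a b iha ihb =>
    simp only [verts_par, own, src, snk, Finset.mem_insert, Finset.mem_union] at hw ⊢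
    have h1 := h.2.2.1
    have h2 := h.2.2.2.1
    rcases hw with hw | hw
    · rcases iha h.1 hw with h | h | h <;> tauto
    · rcases ihb h.2.1 hw with h | h | h <;> simp_all

/-! ### Paths from the source to the sink -/

theorem thru_left (t : SPTerm D) : t.Thru t.left := by
  induction t with
  | edge d => rfl
  | ser a b iha ihb => exact ⟨_, _, rfl, iha, ihb⟩
  | par a b iha ihb => exact Or.inl iha

theorem thru_right (t : SPTerm D) : t.Thru t.right := by
  induction t with
  | edge d => rfl
  | ser a b iha ihb => exact ⟨_, _, rfl, iha, ihb⟩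
  | par a b iha ihb => exact Or.inr ihb

theorem Thru.ne_nil {t : SPTerm D} {p : List D} (hp : t.Thru p) : p ≠ [] := by
  induction t generalizing p with
  | edge d => obtain rfl : p = [d] := hp; simp
  | ser a b iha ihb =>
    obtain ⟨p₁, p₂, rfl, h1, h2⟩ := hp
    simp [iha h1]
  | par a b iha ihb => exact hp.elim iha ihb

theorem Thru.exists_head {t : SPTerm D} {p : List D} (hp : t.Thru p) :
    ∃ d ∈ t.srcFan, p.head? = some d := by
  induction t generalizing p with
  | edge d => obtain rfl : p = [d] := hp; simp [srcFan]
  | ser a b iha ihb =>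
    obtain ⟨p₁, p₂, rfl, h1, h2⟩ := hp
    obtain ⟨d, hd, e⟩ := iha h1
    exact ⟨d, hd, by simp [e]⟩
  | par a b iha ihb =>
    rcases hp with hp | hp
    · obtain ⟨d, hd, e⟩ := iha hp
      exact ⟨d, by simp [srcFan, hd], e⟩
    · obtain ⟨d, hd, e⟩ := ihb hp
      exact ⟨d, by simp [srcFan, hd], e⟩

theorem Thru.exists_getLast {t : SPTerm D} {p : List D} (hp : t.Thru p) :
    ∃ d, G.rev d ∈ t.snkFan G ∧ p.getLast? = some d := by
  induction t generalizing p with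
  | edge d => obtain rfl : p = [d] := hp; exact ⟨d, by simp [snkFan]⟩
  | ser a b iha ihb =>
    obtain ⟨p₁, p₂, rfl, h1, h2⟩ := hp
    obtain ⟨d, hd, e⟩ := ihb h2
    exact ⟨d, hd, by simp [e]⟩
  | par a b iha ihb =>
    rcases hp with hp | hp
    · obtain ⟨d, hd, e⟩ := iha hp
      exact ⟨d, by simp [snkFan, hd], e⟩
    · obtain ⟨d, hd, e⟩ := ihb hp
      exact ⟨d, by simp [snkFan, hd], e⟩

theorem Thru.subset {t : SPTerm D} {p : List D} (hp : t.Thru p) : ∀ d ∈ p, d ∈ t.darts G := by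
  induction t generalizing p with
  | edge d => obtain rfl : p = [d] := hp; simp [darts]
  | ser a b iha ihb =>
    obtain ⟨p₁, p₂, rfl, h1, h2⟩ := hp
    intro d hd
    simp only [darts, Finset.mem_union, List.mem_append] at hd ⊢
    exact hd.imp (iha h1 d) (ihb h2 d)
  | par a b iha ihb =>
    intro d hd
    simp only [darts, Finset.mem_union]
    exact hp.imp (fun h => iha h d hd) (fun h => ihb h d hd)

theorem Thru.isSimplePath {t : SPTerm D} (h : t.Valid G) {p : List D} (hp : t.Thru p) :
    G.IsSimplePath (t.src G) (t.snk G) p := by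
  induction t generalizing p with
  | edge d =>
    obtain rfl : p = [d] := hp
    have : G.org d ≠ G.org (G.rev d) := h
    simp [PlaneGraph.IsSimplePath, src, snk, this]
  | ser a b iha ihb =>
    obtain ⟨p₁, p₂, rfl, h1, h2⟩ := hp
    obtain ⟨a1, a2, a3, a4⟩ := iha h.1 h1
    obtain ⟨b1, b2, b3, b4⟩ := ihb h.2.1 h2
    refine ⟨?_, ?_, ?_, ?_⟩
    · simp only [List.map_append, List.head?_append, a1, src]; rfl
    · simp only [List.map_append, List.getLast?_append, b2, snk]; rfl
    · refine List.isChain_append.2 ⟨a3, b3, fun x hx y hy => ?_⟩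
      rw [Option.mem_def] at hx hy
      simp only [List.getLast?_map, hx, Option.map_some, Option.some.injEq] at a2
      simp only [List.head?_map, hy, Option.map_some, Option.some.injEq] at b1
      rw [a2, b1, h.2.2.1]
    · simp only [List.map_append, List.append_assoc, snk]
      refine List.nodup_append.2 ⟨(List.nodup_append.1 a4).1, b4, fun x hx y hy => ?_⟩
      rintro rfl
      have hxa : x ∈ a.verts G := by
        obtain ⟨d, hd, rfl⟩ := List.mem_map.1 hx
        exact org_mem_verts (h1.subset d hd)
      have hxb : x ∈ b.verts G := by
        rcases List.mem_append.1 hy with hy | hy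
        · obtain ⟨d, hd, rfl⟩ := List.mem_map.1 hy
          exact org_mem_verts (h2.subset d hd)
        · rw [List.mem_singleton.1 hy]; exact b.snk_mem_verts
      exact (List.nodup_append.1 a4).2.2 x hx _ (by simp) (h.2.2.2.2.2 x hxa hxb)
  | par a b iha ihb =>
    rcases hp with hp | hp
    · exact iha h.1 hp
    · have := ihb h.2.1 hp
      rwa [← h.2.2.1, ← h.2.2.2.1] at this

theorem Thru.nodup {t : SPTerm D} (h : t.Valid G) {p : List D} (hp : t.Thru p) : p.Nodup :=
  List.Nodup.of_map _ (List.nodup_append.1 (hp.isSimplePath h).2.2.2).1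

theorem forall_mem_of_isChain {S T : Finset D} {bad : V → Prop}
    (hST : ∀ d ∈ S, ∀ d' ∈ T, G.org (G.rev d) = G.org d' → bad (G.org d')) (d : D) (q : List D)
    (hc : List.IsChain (fun d d' => G.org (G.rev d) = G.org d') (d :: q)) (hd : d ∈ S)
    (hb : ∀ x ∈ q, ¬ bad (G.org x)) (hq : ∀ x ∈ q, x ∈ S ∨ x ∈ T) : ∀ x ∈ q, x ∈ S := by
  induction q generalizing d with
  | nil => simp
  | cons e q ih =>
    rw [List.isChain_cons_cons] at hc
    have he : e ∈ S := by
      rcases hq e (by simp) with h | h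
      · exact h
      · exact absurd (hST d hd e h hc.1) (hb e (by simp))
    intro x hx
    rcases List.mem_cons.1 hx with rfl | hx
    · exact he
    · exact ih e hc.2 he (fun x hx => hb x (by simp [hx])) (fun x hx => hq x (by simp [hx])) x hx

theorem Valid.exists_split {a b : SPTerm D} (h : (ser a b).Valid G) (d : D) (q : List D)
    (hc : List.IsChain (fun d d' => G.org (G.rev d) = G.org d') (d :: q)) (hd : d ∈ a.darts G)
    (hq : ∀ x ∈ q, x ∈ a.darts G ∨ x ∈ b.darts G)
    (hn : ((d :: q).map G.org).Nodup)
    (hl : ((d :: q).map fun d => G.org (G.rev d)).getLast? = some (b.snk G)) :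
    ∃ p₁ e p₂, d :: q = (d :: p₁) ++ e :: p₂ ∧ (∀ x ∈ d :: p₁, x ∈ a.darts G) ∧
      (∀ x ∈ e :: p₂, x ∈ b.darts G) ∧ G.org e = a.snk G := by
  induction q generalizing d with
  | nil =>
    simp only [List.map_cons, List.map_nil, List.getLast?_singleton, Option.some.injEq] at hl
    exact absurd (hl ▸ org_rev_mem_verts hd) h.snk_notMem_left
  | cons e q ih =>
    rw [List.isChain_cons_cons] at hc
    by_cases he : e ∈ a.darts G
    · obtain ⟨p₁, e', p₂, e1, e2, e3, e4⟩ := ih e hc.2 he (fun x hx => hq x (by simp [hx]))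
        (by rw [List.map_cons, List.nodup_cons] at hn; exact hn.2) (by simpa using hl)
      refine ⟨e :: p₁, e', p₂, by rw [e1]; rfl, ?_, e3, e4⟩
      intro x hx
      rcases List.mem_cons.1 hx with rfl | hx
      · exact hd
      · exact e2 x hx
    · have he' : e ∈ b.darts G := (hq e (by simp)).resolve_left he
      have ho : G.org e = a.snk G :=
        h.2.2.2.2.2 _ (hc.1 ▸ org_rev_mem_verts hd) (org_mem_verts he')
      refine ⟨[], e, q, rfl, by simpa using hd, ?_, ho⟩
      have key := forall_mem_of_isChain (G := G) (S := b.darts G) (T := a.darts G)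
        (bad := fun w => w = a.snk G)
        (fun x hx y hy hxy => h.2.2.2.2.2 _ (org_mem_verts hy) (hxy ▸ org_rev_mem_verts hx))
        e q hc.2 he' ?_ (fun x hx => (hq x (by simp [hx])).symm)
      · intro x hx
        rcases List.mem_cons.1 hx with rfl | hx
        · exact he'
        · exact key x hx
      · intro x hx hxe
        rw [List.map_cons, List.map_cons, List.nodup_cons, List.nodup_cons] at hn
        exact hn.2.1 (by rw [ho, ← hxe]; exact List.mem_map_of_mem hx)

theorem thru_of_isSimplePath {t : SPTerm D} (h : t.Valid G) {p : List D}
    (hp : G.IsSimplePath (t.src G) (t.snk G) p) (hd : ∀ d ∈ p, d ∈ t.darts G) : t.Thru p := by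
  induction t generalizing p with
  | edge d =>
    obtain ⟨h1, h2, h3, h4⟩ := hp
    cases p with
    | nil => simp at h1
    | cons x q =>
      have hne : G.org d ≠ G.org (G.rev d) := h
      simp only [List.map_cons, List.head?_cons, Option.some.injEq, src] at h1
      have hx : x = d := by
        have := hd x (by simp)
        simp only [darts, Finset.mem_insert, Finset.mem_singleton] at this
        rcases this with rfl | rfl
        · rfl
        · exact absurd h1.symm hne
      subst hx
      cases q with
      | nil => rfl
      | cons y q =>
        rw [List.isChain_cons_cons] at h3
        simp [snk, h3.1] at h4
  | ser a b iha ihb =>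
    obtain ⟨h1, h2, h3, h4⟩ := hp
    cases p with
    | nil => simp at h1
    | cons x q =>
      simp only [List.map_cons, List.head?_cons, Option.some.injEq, src] at h1
      have hd' : ∀ y ∈ x :: q, y ∈ a.darts G ∨ y ∈ b.darts G := fun y hy => by
        simpa [darts] using hd y hy
      have hx : x ∈ a.darts G := by
        rcases hd' x (by simp) with hx | hx
        · exact hx
        · exact absurd (h1 ▸ org_mem_verts hx) h.src_notMem_right
      obtain ⟨p₁, e, p₂, e1, e2, e3, e4⟩ := h.exists_split x q h3 hx
        (fun y hy => hd' y (by simp [hy])) (List.nodup_append.1 h4).1 h2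
      rw [e1] at h2 h3 h4
      obtain ⟨c1, c2, c3⟩ := List.isChain_append.1 h3
      rw [List.map_append, List.getLast?_append_of_ne_nil _ (by simp)] at h2
      refine ⟨_, _, e1, iha h.1 ⟨by simpa using h1, ?_, c1, ?_⟩ e2,
        ihb h.2.1 ⟨by simp [e4, h.2.2.1], h2, c2, ?_⟩ e3⟩
      · obtain ⟨l, z, hz⟩ := ((x :: p₁).eq_nil_or_concat).resolve_left (by simp)
        rw [hz] at c3 ⊢
        have := c3 z (by simp) e (by simp)
        simp [this, e4]
      · rw [List.map_append, List.append_assoc, List.nodup_append] at h4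
        refine List.nodup_append.2 ⟨h4.1, by simp, fun y hy z hz => ?_⟩
        rw [List.mem_singleton.1 hz, ← e4]
        exact h4.2.2 y hy _ (by simp)
      · rw [List.map_append, List.append_assoc, List.nodup_append] at h4
        exact h4.2.1
  | par a b iha ihb =>
    have hp' := hp
    obtain ⟨h1, h2, h3, h4⟩ := hp
    cases p with
    | nil => simp at h1
    | cons x q =>
      simp only [List.map_cons, List.head?_cons, Option.some.injEq, src] at h1
      have hd' : ∀ y ∈ x :: q, y ∈ a.darts G ∨ y ∈ b.darts G := fun y hy => by
        simpa [darts] using hd y hy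
      have hb : ∀ y ∈ q, ¬ (G.org y = a.src G ∨ G.org y = a.snk G) := by
        intro y hy hb
        simp only [snk, List.map_cons, List.cons_append, List.nodup_cons] at h4
        rcases hb with hb | hb
        · apply h4.1
          rw [h1, ← hb]
          exact List.mem_append_left _ (List.mem_map_of_mem hy)
        · exact (List.nodup_append.1 h4.2).2.2 _ (List.mem_map_of_mem hy) _ (by simp) hb
      rcases hd' x (by simp) with hx | hx
      · have key := forall_mem_of_isChain (G := G) (S := a.darts G) (T := b.darts G)
          (bad := fun w => w = a.src G ∨ w = a.snk G)
          (fun x hx y hy hxy => h.2.2.2.2.2 _ (hxy ▸ org_rev_mem_verts hx) (org_mem_verts hy))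
          x q h3 hx hb (fun y hy => hd' y (by simp [hy]))
        refine Or.inl (iha h.1 hp' fun y hy => ?_)
        rcases List.mem_cons.1 hy with rfl | hy
        exacts [hx, key y hy]
      · have key := forall_mem_of_isChain (G := G) (S := b.darts G) (T := a.darts G)
          (bad := fun w => w = a.src G ∨ w = a.snk G)
          (fun x hx y hy hxy => h.2.2.2.2.2 _ (org_mem_verts hy) (hxy ▸ org_rev_mem_verts hx))
          x q h3 hx hb (fun y hy => (hd' y (by simp [hy])).symm)
        refine Or.inr (ihb h.2.1 (by rw [← h.2.2.1, ← h.2.2.2.1]; exact hp') fun y hy => ?_)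
        rcases List.mem_cons.1 hy with rfl | hy
        exacts [hx, key y hy]

end SPTerm

namespace PlaneGraph

variable {V D : Type*} [Fintype V] [DecidableEq V] [Fintype D] [DecidableEq D]
  {G : PlaneGraph V D}

/-! ### Turns along paths and faces -/

/-- Right turns minus left turns at the intermediate vertices of a path. -/
noncomputable def pathTurns (G : PlaneGraph V D) (A : D → ℕ) : List D → ℤ
  | [] => 0
  | [_] => 0
  | d :: d' :: p => 2 - (G.angleSum A (G.rev d) d' : ℤ) + G.pathTurns A (d' :: p)

theorem OrthoRep.vertexTurns_eq (H : OrthoRep G) (p : List D) :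
    H.vertexTurns p = G.pathTurns H.ang p := by
  induction p with
  | nil => rfl
  | cons d p ih =>
    cases p with
    | nil => rfl
    | cons d' p => rw [OrthoRep.vertexTurns, pathTurns, ih]; rfl

theorem pathTurns_append (A : D → ℕ) {p q : List D} {d d' : D} (hd : p.getLast? = some d)
    (hd' : q.head? = some d') :
    G.pathTurns A (p ++ q) =
      G.pathTurns A p + (2 - (G.angleSum A (G.rev d) d' : ℤ)) + G.pathTurns A q := by
  induction p with
  | nil => simp at hd
  | cons x p ih =>
    cases p with
    | nil =>
      obtain rfl : x = d := by simpa using hd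
      cases q with
      | nil => simp at hd'
      | cons y q =>
        obtain rfl : y = d' := by simpa using hd'
        simp [pathTurns]
    | cons y p =>
      rw [List.getLast?_cons_cons] at hd
      have := ih hd
      rw [List.cons_append] at this
      rw [List.cons_append, List.cons_append, pathTurns, this, pathTurns]
      ring

/-- The path in the opposite direction. -/
def revPath (G : PlaneGraph V D) (p : List D) : List D := (p.map G.rev).reverse

theorem revPath_append (p q : List D) : G.revPath (p ++ q) = G.revPath q ++ G.revPath p := by
  simp [revPath]

/-- Right turns minus left turns along a part of the boundary of a face, including the turn after
its last dart. -/
def walkTurns (G : PlaneGraph V D) (A : D → ℕ) (B : D → ℤ) (p : List D) : ℤ :=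
  (p.map fun d => B d + (2 - (A (G.rev d) : ℤ))).sum

theorem walkTurns_append (A : D → ℕ) (B : D → ℤ) (p q : List D) :
    G.walkTurns A B (p ++ q) = G.walkTurns A B p + G.walkTurns A B q := by
  simp [walkTurns]

theorem IsRotationAt.rot_adjacent {w : V} {F F' : List D} (h : G.IsRotationAt w (F ++ F'))
    {f g : D} (hf : F.getLast? = some f) (hg : F'.head? = some g) : G.rot f = g := by
  obtain ⟨l, rfl⟩ := List.getLast?_eq_some_iff.1 hf
  obtain ⟨m, rfl⟩ := List.head?_eq_some_iff.1 hg
  exact (show G.IsRotationAt w (l ++ f :: g :: m) by simpa using h).rot_eq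

theorem IsRotationAt.angleSum_adjacent {w : V} {F F' : List D} (h : G.IsRotationAt w (F ++ F'))
    {f g : D} (hf : F.getLast? = some f) (hg : F'.head? = some g) (A : D → ℕ) :
    G.angleSum A f g = A f := by
  have hr := h.rot_adjacent hf hg
  have := angleSum_of_isChain (G := G) A (a := f) (b := g) (l := []) (by simpa using hr) ?_
  · simpa using this
  · have := (List.nodup_append.1 h.1).2.2 f (List.mem_of_getLast? hf) g
      (List.mem_of_head? hg)
    simpa [eq_comm] using this

end PlaneGraph

theorem closedUnder_append {D : Type*} {r : Equiv.Perm D} {p q : List D} {a b c d : D}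
    (hp : List.IsChain (fun x y => r x = y) p) (hq : List.IsChain (fun x y => r x = y) q)
    (ha : p.head? = some a) (hb : p.getLast? = some b) (hc : q.head? = some c)
    (hd : q.getLast? = some d) (hbc : r b = c) (hda : r d = a) : ClosedUnder r (p ++ q) := by
  have e : (p ++ q).head? = some a := by simp [ha]
  unfold ClosedUnder
  rw [e, List.append_assoc]
  refine List.isChain_append.2 ⟨hp, List.isChain_append.2 ⟨hq, by simp, ?_⟩, ?_⟩
  · simp [hd, hda]
  · simp [hb, hc, hbc]

namespace SPTerm

open PlaneGraph

variable {V D : Type*} [Fintype V] [DecidableEq V] [Fintype D] [DecidableEq D]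
  {G : PlaneGraph V D}

/-! ### Boundaries and faces of terms -/

theorem head?_left (t : SPTerm D) : t.left.head? = t.srcFan.head? := by
  induction t with
  | edge d => rfl
  | ser a b iha ihb => rw [left, List.head?_append_of_ne_nil _ a.thru_left.ne_nil, iha, srcFan]
  | par a b iha ihb =>
    rw [left, iha, srcFan, List.head?_append_of_ne_nil _ a.srcFan_ne_nil]

theorem head?_right (t : SPTerm D) : t.right.head? = t.srcFan.getLast? := by
  induction t with
  | edge d => rfl
  | ser a b iha ihb => rw [right, List.head?_append_of_ne_nil _ a.thru_right.ne_nil, iha, srcFan]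
  | par a b iha ihb =>
    rw [right, ihb, srcFan, List.getLast?_append_of_ne_nil _ b.srcFan_ne_nil]

theorem getLast?_left (t : SPTerm D) : t.left.getLast?.map G.rev = (t.snkFan G).head? := by
  induction t with
  | edge d => rfl
  | ser a b iha ihb =>
    rw [left, List.getLast?_append_of_ne_nil _ b.thru_left.ne_nil, ihb, snkFan]
  | par a b iha ihb =>
    rw [left, iha, snkFan, List.head?_append_of_ne_nil _ (a.snkFan_ne_nil G)]

theorem getLast?_right (t : SPTerm D) : t.right.getLast?.map G.rev = (t.snkFan G).getLast? := by
  induction t with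
  | edge d => rfl
  | ser a b iha ihb =>
    rw [right, List.getLast?_append_of_ne_nil _ b.thru_right.ne_nil, ihb, snkFan]
  | par a b iha ihb =>
    rw [right, ihb, snkFan, List.getLast?_append_of_ne_nil _ (b.snkFan_ne_nil G)]

/-- The first and last darts of the left boundary. -/
theorem exists_left_ends (G : PlaneGraph V D) (t : SPTerm D) : ∃ x y, t.left.head? = some x ∧
    t.left.getLast? = some y ∧ t.srcFan.head? = some x ∧ (t.snkFan G).head? = some (G.rev y) := by
  obtain ⟨x, hx, ex⟩ := t.thru_left.exists_head
  obtain ⟨y, hy, ey⟩ := t.thru_left.exists_getLast (G := G)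
  exact ⟨x, y, ex, ey, by rw [← head?_left, ex], by rw [← getLast?_left, ey]; rfl⟩

/-- The first and last darts of the right boundary. -/
theorem exists_right_ends (G : PlaneGraph V D) (t : SPTerm D) : ∃ x y, t.right.head? = some x ∧
    t.right.getLast? = some y ∧ t.srcFan.getLast? = some x ∧
    (t.snkFan G).getLast? = some (G.rev y) := by
  obtain ⟨x, hx, ex⟩ := t.thru_right.exists_head
  obtain ⟨y, hy, ey⟩ := t.thru_right.exists_getLast (G := G)
  exact ⟨x, y, ex, ey, by rw [← head?_right, ex], by rw [← getLast?_right, ey]; rfl⟩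

theorem head?_revPath {p : List D} {d : D} (h : p.getLast? = some d) :
    (G.revPath p).head? = some (G.rev d) := by
  simp [revPath, h]

theorem getLast?_revPath {p : List D} {d : D} (h : p.head? = some d) :
    (G.revPath p).getLast? = some (G.rev d) := by
  simp [revPath, h]

theorem Valid.isChain_right {t : SPTerm D} (h : t.Valid G) :
    List.IsChain (fun x y => G.face x = y) t.right := by
  induction t with
  | edge d => simp [right]
  | ser a b iha ihb =>
    refine List.isChain_append.2 ⟨iha h.1, ihb h.2.1, fun x hx y hy => ?_⟩
    obtain ⟨_, x', -, ex, -, hx'⟩ := a.exists_right_ends G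
    obtain ⟨y', _, ey, -, hy', -⟩ := b.exists_right_ends G
    obtain rfl : x' = x := by rw [Option.mem_def, ex] at hx; simpa using hx
    obtain rfl : y' = y := by rw [Option.mem_def, ey] at hy; simpa using hy
    exact h.2.2.2.1.rot_adjacent hx' (by rw [List.head?_reverse, hy'])
  | par a b iha ihb => exact ihb h.2.1

theorem Valid.isChain_revPath_left {t : SPTerm D} (h : t.Valid G) :
    List.IsChain (fun x y => G.face x = y) (G.revPath t.left) := by
  induction t with
  | edge d => simp [left, revPath]
  | ser a b iha ihb =>
    rw [left, revPath_append]
    obtain ⟨_, x, -, ex, -, hx⟩ := a.exists_left_ends G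
    obtain ⟨y, _, ey, -, hy, -⟩ := b.exists_left_ends G
    refine List.isChain_append.2 ⟨ihb h.2.1, iha h.1, fun z hz z' hz' => ?_⟩
    rw [Option.mem_def, getLast?_revPath ey, Option.some.injEq] at hz
    rw [Option.mem_def, head?_revPath ex, Option.some.injEq] at hz'
    subst hz hz'
    have := h.2.2.2.1.append_comm.rot_adjacent (by rw [List.getLast?_reverse, hy]) hx
    show G.rot (G.rev (G.rev y)) = _
    rw [G.rev_rev, this]
  | par a b iha ihb => exact iha h.1

/-- The boundaries of the inner faces. -/
def faces (G : PlaneGraph V D) : SPTerm D → List (List D)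
  | edge _ => []
  | ser a b => a.faces G ++ b.faces G
  | par a b => (a.right ++ G.revPath b.left) :: (a.faces G ++ b.faces G)

theorem mem_darts_of_mem_revPath {t : SPTerm D} {p : List D} (hp : t.Thru p) {d : D}
    (hd : d ∈ G.revPath p) : d ∈ t.darts G := by
  simp only [revPath, List.mem_reverse, List.mem_map] at hd
  obtain ⟨x, hx, rfl⟩ := hd
  exact rev_mem_darts (hp.subset x hx)

theorem rev_injective (G : PlaneGraph V D) : Function.Injective G.rev :=
  Function.LeftInverse.injective G.rev_rev

theorem Thru.nodup_revPath {t : SPTerm D} (h : t.Valid G) {p : List D} (hp : t.Thru p) :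
    (G.revPath p).Nodup :=
  List.nodup_reverse.2 ((hp.nodup h).map (rev_injective G))

theorem Valid.face_closed {t : SPTerm D} (h : t.Valid G) (hp : t.Placed G) {f : List D}
    (hf : f ∈ t.faces G) :
    ClosedUnder G.face f ∧ f.Nodup ∧ ∀ d ∈ f, d ∈ t.darts G := by
  induction t with
  | edge d => simp [faces] at hf
  | ser a b iha ihb =>
    rcases List.mem_append.1 hf with hf | hf
    · obtain ⟨h1, h2, h3⟩ := iha h.1 (hp.ser_left h) hf
      exact ⟨h1, h2, fun d hd => Finset.mem_union_left _ (h3 d hd)⟩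
    · obtain ⟨h1, h2, h3⟩ := ihb h.2.1 (hp.ser_right h) hf
      exact ⟨h1, h2, fun d hd => Finset.mem_union_right _ (h3 d hd)⟩
  | par a b iha ihb =>
    rw [faces, List.mem_cons, List.mem_append] at hf
    rcases hf with rfl | hf | hf
    · have m1 : ∀ d ∈ a.right, d ∈ a.darts G := a.thru_right.subset
      have m2 : ∀ d ∈ G.revPath b.left, d ∈ b.darts G := fun d =>
        mem_darts_of_mem_revPath b.thru_left
      refine ⟨?_, ?_, ?_⟩
      · obtain ⟨x, y, ex, ey, hx, hy⟩ := a.exists_right_ends G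
        obtain ⟨x', y', ex', ey', hx', hy'⟩ := b.exists_left_ends G
        obtain ⟨⟨X, -, hX⟩, Y, -, hY⟩ := hp
        refine closedUnder_append h.1.isChain_right h.2.1.isChain_revPath_left ex ey
          (head?_revPath ey') (getLast?_revPath ex') ?_ ?_
        · rw [snkFan, List.append_assoc] at hY
          exact hY.rot_adjacent hy (by simp [hy'])
        · rw [srcFan, List.reverse_append, List.append_assoc] at hX
          show G.rot (G.rev (G.rev x')) = x
          rw [G.rev_rev]
          exact hX.rot_adjacent (by simp [hx']) (by simp [hx])
      · refine List.nodup_append.2 ⟨a.thru_right.nodup h.1, b.thru_left.nodup_revPath h.2.1, ?_⟩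
        rintro x hx y hy rfl
        exact Finset.disjoint_left.1 h.2.2.2.2.1 (m1 x hx) (m2 x hy)
      · intro d hd
        simp only [darts, Finset.mem_union]
        exact (List.mem_append.1 hd).imp (m1 d) (m2 d)
    · obtain ⟨h1, h2, h3⟩ := iha h.1 hp.par_left hf
      exact ⟨h1, h2, fun d hd => Finset.mem_union_left _ (h3 d hd)⟩
    · obtain ⟨h1, h2, h3⟩ := ihb h.2.1 (hp.par_right h) hf
      exact ⟨h1, h2, fun d hd => Finset.mem_union_right _ (h3 d hd)⟩

theorem mem_boundary {t : SPTerm D} {d : D} (hd : d ∈ t.darts G) :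
    d ∈ t.right ∨ d ∈ G.revPath t.left ∨ ∃ f ∈ t.faces G, d ∈ f := by
  induction t with
  | edge e => simpa [darts, right, left, revPath, faces] using hd
  | ser a b iha ihb =>
    simp only [darts, Finset.mem_union] at hd
    simp only [right, left, revPath_append, faces, List.mem_append]
    rcases hd with hd | hd
    · rcases iha hd with h | h | ⟨f, h, h'⟩
      · tauto
      · tauto
      · exact Or.inr (Or.inr ⟨f, Or.inl h, h'⟩)
    · rcases ihb hd with h | h | ⟨f, h, h'⟩
      · tauto
      · tauto
      · exact Or.inr (Or.inr ⟨f, Or.inr h, h'⟩)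
  | par a b iha ihb =>
    simp only [darts, Finset.mem_union] at hd
    simp only [right, left, faces, List.mem_cons, List.mem_append, exists_eq_or_imp]
    rcases hd with hd | hd
    · rcases iha hd with h | h | ⟨f, h, h'⟩
      · tauto
      · tauto
      · exact Or.inr (Or.inr (Or.inr ⟨f, Or.inl h, h'⟩))
    · rcases ihb hd with h | h | ⟨f, h, h'⟩
      · tauto
      · tauto
      · exact Or.inr (Or.inr (Or.inr ⟨f, Or.inr h, h'⟩))

/-! ### Realizations -/

/-- The angles `A` and the net numbers of right bends `B` form an orthogonal representation of the
component, of spirality `K / 2`. -/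
def Realizes (G : PlaneGraph V D) (A : D → ℕ) (B : D → ℤ) : SPTerm D → ℤ → Prop
  | edge d, K => B (G.rev d) = -B d ∧ K = 2 * B d
  | ser a b, K => ∃ Ka Kb τ, a.Realizes G A B Ka ∧ b.Realizes G A B Kb ∧
      G.AnglesAt A (a.snk G) ∧ G.JunctionTurn A (a.snkFan G) b.srcFan.reverse τ ∧
      K = Ka + Kb + τ
  | par a b, K => ∃ Ka Kb δ₁ δ₂ ε₁ ε₂, a.Realizes G A B Ka ∧ b.Realizes G A B Kb ∧
      G.AnglesAt A (a.src G) ∧ G.AnglesAt A (a.snk G) ∧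
      G.Offsets A b.srcFan.reverse a.srcFan.reverse δ₁ δ₂ ∧
      G.Offsets A (a.snkFan G) (b.snkFan G) ε₁ ε₂ ∧
      K = Ka - δ₂ - ε₁ ∧ K = Kb + δ₁ + ε₂

theorem Realizes.bend_rev {A : D → ℕ} {B : D → ℤ} {t : SPTerm D} {K : ℤ}
    (h : t.Realizes G A B K) {d : D} (hd : d ∈ t.darts G) : B (G.rev d) = -B d := by
  induction t generalizing K with
  | edge e =>
    simp only [darts, Finset.mem_insert, Finset.mem_singleton] at hd
    rcases hd with rfl | rfl
    · exact h.1
    · rw [G.rev_rev, h.1, neg_neg]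
  | ser a b iha ihb =>
    obtain ⟨Ka, Kb, τ, ha, hb, -⟩ := h
    rcases Finset.mem_union.1 hd with hd | hd
    exacts [iha ha hd, ihb hb hd]
  | par a b iha ihb =>
    obtain ⟨Ka, Kb, _, _, _, _, ha, hb, -⟩ := h
    rcases Finset.mem_union.1 hd with hd | hd
    exacts [iha ha hd, ihb hb hd]

theorem Realizes.anglesAt {A : D → ℕ} {B : D → ℤ} {t : SPTerm D} {K : ℤ}
    (h : t.Realizes G A B K) {w : V} (hw : w ∈ t.own G) : G.AnglesAt A w := by
  induction t generalizing K with
  | edge e => simp [own] at hw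
  | ser a b iha ihb =>
    obtain ⟨Ka, Kb, τ, ha, hb, hA, -⟩ := h
    simp only [own, Finset.mem_insert, Finset.mem_union] at hw
    rcases hw with rfl | hw | hw
    exacts [hA, iha ha hw, ihb hb hw]
  | par a b iha ihb =>
    obtain ⟨Ka, Kb, _, _, _, _, ha, hb, hA, hA', -⟩ := h
    simp only [own, Finset.mem_insert, Finset.mem_union] at hw
    rcases hw with rfl | rfl | hw | hw
    exacts [hA, hA', iha ha hw, ihb hb hw]

/-- Along every path from the source to the sink one sees the same spirality. -/
theorem Realizes.spine {A : D → ℕ} {B : D → ℤ} {t : SPTerm D} {K : ℤ}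
    (h : t.Realizes G A B K) {p : List D} (hp : t.Thru p) {d d' : D} (hd : p.head? = some d)
    (hd' : p.getLast? = some d') :
    2 * (G.pathTurns A p + (p.map B).sum) + G.poleTurn A t.srcFan.reverse d -
      G.poleTurn A (t.snkFan G) (G.rev d') = K := by
  induction t generalizing p d d' K with
  | edge e =>
    obtain rfl : p = [e] := hp
    simp [pathTurns, srcFan, snkFan, poleTurn_singleton, h.2]
  | ser a b iha ihb =>
    obtain ⟨Ka, Kb, τ, ha, hb, hA, hJ, rfl⟩ := h
    obtain ⟨p₁, p₂, rfl, h1, h2⟩ := hp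
    obtain ⟨x, hx, ex⟩ := h1.exists_getLast (G := G)
    obtain ⟨y, hy, ey⟩ := h2.exists_head
    rw [List.head?_append_of_ne_nil _ h1.ne_nil] at hd
    rw [List.getLast?_append_of_ne_nil _ h2.ne_nil] at hd'
    rw [pathTurns_append A ex ey, List.map_append, List.sum_append, srcFan, snkFan,
      ← iha ha h1 hd ex, ← ihb hb h2 ey hd']
    linarith [hJ _ hx y (by simpa using hy)]
  | par a b iha ihb =>
    obtain ⟨Ka, Kb, δ₁, δ₂, ε₁, ε₂, ha, hb, hA, hA', hO, hO', e1, e2⟩ := h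
    rw [srcFan, List.reverse_append, snkFan]
    rcases hp with hp | hp
    · obtain ⟨x, hx, ex⟩ := hp.exists_head
      obtain ⟨y, hy, ey⟩ := hp.exists_getLast (G := G)
      obtain rfl : x = d := by rw [ex] at hd; simpa using hd
      obtain rfl : y = d' := by rw [ey] at hd'; simpa using hd'
      rw [hO.2 x (by simpa using hx), hO'.1 _ hy, e1, ← iha ha hp hd hd']
      ring
    · obtain ⟨x, hx, ex⟩ := hp.exists_head
      obtain ⟨y, hy, ey⟩ := hp.exists_getLast (G := G)
      obtain rfl : x = d := by rw [ex] at hd; simpa using hd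
      obtain rfl : y = d' := by rw [ey] at hd'; simpa using hd'
      rw [hO.1 x (by simpa using hx), hO'.2 _ hy, e2, ← ihb hb hp hd hd']
      ring

theorem Valid.walkTurns_right {t : SPTerm D} (h : t.Valid G) (A : D → ℕ) (B : D → ℤ) {d : D}
    (hd : t.right.getLast? = some d) :
    G.walkTurns A B t.right =
      G.pathTurns A t.right + (t.right.map B).sum + (2 - (A (G.rev d) : ℤ)) := by
  induction t generalizing d with
  | edge e =>
    obtain rfl : e = d := by simpa [right] using hd
    simp [walkTurns, right, pathTurns]
  | ser a b iha ihb =>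
    obtain ⟨_, x, -, ex, -, hx⟩ := a.exists_right_ends G
    obtain ⟨y, _, ey, -, hy, -⟩ := b.exists_right_ends G
    rw [right, List.getLast?_append_of_ne_nil _ b.thru_right.ne_nil] at hd
    have := h.2.2.2.1.angleSum_adjacent hx (by rw [List.head?_reverse, hy]) A
    rw [right, walkTurns_append, iha h.1 ex, ihb h.2.1 hd, pathTurns_append A ex ey, this,
      List.map_append, List.sum_append]
    ring
  | par a b iha ihb => exact ihb h.2.1 hd

theorem Valid.walkTurns_left {t : SPTerm D} (h : t.Valid G) {A : D → ℕ} {B : D → ℤ} {K : ℤ}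
    (hR : t.Realizes G A B K) {d : D} (hd : t.left.head? = some d) :
    G.walkTurns A B (G.revPath t.left) =
      -(G.pathTurns A t.left + (t.left.map B).sum) + (2 - (A d : ℤ)) := by
  induction t generalizing d K with
  | edge e =>
    obtain rfl : e = d := by simpa [left] using hd
    simp [walkTurns, left, pathTurns, revPath, hR.1, G.rev_rev]
  | ser a b iha ihb =>
    obtain ⟨Ka, Kb, τ, ha, hb, hA, -⟩ := hR
    obtain ⟨_, x, -, ex, -, hx⟩ := a.exists_left_ends G
    obtain ⟨y, _, ey, -, hy, -⟩ := b.exists_left_ends G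
    rw [left, List.head?_append_of_ne_nil _ a.thru_left.ne_nil] at hd
    have hr := h.2.2.2.1
    have hy' : b.srcFan.reverse.getLast? = some y := by rw [List.getLast?_reverse, hy]
    have h1 := hr.append_comm.angleSum_adjacent hy' hx A
    have h2 := hr.angleSum_add (a := y) (b := G.rev x)
      (List.mem_append_right _ (List.mem_of_getLast? hy'))
      (List.mem_append_left _ (List.mem_of_head? hx))
      (Ne.symm ((List.nodup_append.1 hr.1).2.2 _ (List.mem_of_head? hx) _
        (List.mem_of_getLast? hy'))) hA
    rw [left, revPath_append, walkTurns_append, iha h.1 ha hd, ihb h.2.1 hb ey,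
      pathTurns_append A ex ey, List.map_append, List.sum_append]
    have : (A y : ℤ) + G.angleSum A (G.rev x) y = 4 := by rw [← h1]; exact_mod_cast h2
    linarith
  | par a b iha ihb =>
    obtain ⟨Ka, Kb, _, _, _, _, ha, hb, -⟩ := hR
    exact iha h.1 ha hd

/-- The face between the two components of a parallel composition closes up if and only if the
spiralities of the two components match. -/
theorem Valid.walkTurns_face {a b : SPTerm D} (h : (par a b).Valid G) (hp : (par a b).Placed G)
    (hdeg : ∀ w, G.degree w ≤ 4) {A : D → ℕ} {B : D → ℤ} {Ka Kb δ₁ δ₂ ε₁ ε₂ : ℤ}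
    (ha : a.Realizes G A B Ka) (hb : b.Realizes G A B Kb)
    (hA : G.AnglesAt A (a.src G)) (hA' : G.AnglesAt A (a.snk G))
    (hO : G.Offsets A b.srcFan.reverse a.srcFan.reverse δ₁ δ₂)
    (hO' : G.Offsets A (a.snkFan G) (b.snkFan G) ε₁ ε₂) :
    G.walkTurns A B (a.right ++ G.revPath b.left) = 4 ↔ Ka - δ₂ - ε₁ = Kb + δ₁ + ε₂ := by
  obtain ⟨x, y, ex, ey, hx, hy⟩ := a.exists_right_ends G
  obtain ⟨x', y', ex', ey', hx', hy'⟩ := b.exists_left_ends G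
  obtain ⟨⟨X, hX0, hX⟩, Y, hY0, hY⟩ := hp
  rw [walkTurns_append, h.1.walkTurns_right A B ey, h.2.1.walkTurns_left hb ex']
  have s1 := ha.spine a.thru_right ex ey
  have s2 := hb.spine b.thru_left ex' ey'
  have o1 := hO.2 x (by simpa using List.mem_of_getLast? hx)
  have o2 := hO.1 x' (by simpa using List.mem_of_head? hx')
  have o3 := hO'.1 _ (List.mem_of_getLast? hy)
  have o4 := hO'.2 _ (List.mem_of_head? hy')
  obtain ⟨l1, hl1⟩ := List.getLast?_eq_some_iff.1 hx
  obtain ⟨l2, hl2⟩ := List.head?_eq_some_iff.1 hx'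
  obtain ⟨l3, hl3⟩ := List.getLast?_eq_some_iff.1 hy
  obtain ⟨l4, hl4⟩ := List.head?_eq_some_iff.1 hy'
  have d1 : G.poleTurn A (b.srcFan.reverse ++ a.srcFan.reverse) x' -
      G.poleTurn A (b.srcFan.reverse ++ a.srcFan.reverse) x = 2 * A x' := by
    have hX' : G.IsRotationAt (a.src G) (b.srcFan.reverse ++ a.srcFan.reverse ++ X) := by
      simpa [srcFan, src] using hX
    have e1 : b.srcFan.reverse = l2.reverse ++ [x'] := by simp [hl2]
    have e2 : a.srcFan.reverse = x :: l1.reverse := by simp [hl1]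
    rw [e1, e2] at hX' ⊢
    exact poleTurn_sub_poleTurn hX' hX0 (hdeg _) hA
  have d2 : G.poleTurn A (a.snkFan G ++ b.snkFan G) (G.rev y) -
      G.poleTurn A (a.snkFan G ++ b.snkFan G) (G.rev y') = 2 * A (G.rev y) := by
    have hY' : G.IsRotationAt (a.snk G) (a.snkFan G ++ b.snkFan G ++ Y) := hY
    rw [hl3, hl4] at hY' ⊢
    exact poleTurn_sub_poleTurn hY' hY0 (hdeg _) hA'
  constructor
  · intro e; linarith
  · intro e; linarith

theorem Valid.walkTurns_eq {t : SPTerm D} (h : t.Valid G) (hp : t.Placed G)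
    (hdeg : ∀ w, G.degree w ≤ 4) {A : D → ℕ} {B : D → ℤ} {K : ℤ} (hR : t.Realizes G A B K)
    {f : List D} (hf : f ∈ t.faces G) : G.walkTurns A B f = 4 := by
  induction t generalizing K with
  | edge e => simp [faces] at hf
  | ser a b iha ihb =>
    obtain ⟨Ka, Kb, τ, ha, hb, -⟩ := hR
    rcases List.mem_append.1 hf with hf | hf
    exacts [iha h.1 (hp.ser_left h) ha hf, ihb h.2.1 (hp.ser_right h) hb hf]
  | par a b iha ihb =>
    obtain ⟨Ka, Kb, _, _, _, _, ha, hb, hA, hA', hO, hO', e1, e2⟩ := hR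
    rw [faces, List.mem_cons, List.mem_append] at hf
    rcases hf with rfl | hf | hf
    · exact (h.walkTurns_face hp hdeg ha hb hA hA' hO hO').2 (e1 ▸ e2)
    · exact iha h.1 hp.par_left ha hf
    · exact ihb h.2.1 (hp.par_right h) hb hf

theorem Valid.exists_realizes {t : SPTerm D} (h : t.Valid G) (hp : t.Placed G)
    (hdeg : ∀ w, G.degree w ≤ 4) {A : D → ℕ} {B : D → ℤ} (hA : ∀ w, G.AnglesAt A w)
    (hB : ∀ d ∈ t.darts G, B (G.rev d) = -B d)
    (hf : ∀ f ∈ t.faces G, G.walkTurns A B f = 4) : ∃ K, t.Realizes G A B K := by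
  induction t with
  | edge e => exact ⟨_, hB e (by simp [darts]), rfl⟩
  | ser a b iha ihb =>
    obtain ⟨Ka, ha⟩ := iha h.1 (hp.ser_left h) (fun d hd => hB d (Finset.mem_union_left _ hd))
      (fun f hf' => hf f (List.mem_append_left _ hf'))
    obtain ⟨Kb, hb⟩ := ihb h.2.1 (hp.ser_right h) (fun d hd => hB d (Finset.mem_union_right _ hd))
      (fun f hf' => hf f (List.mem_append_right _ hf'))
    obtain ⟨τ, hτ, -⟩ := exists_junctionTurn h.2.2.2.1 (a.snkFan_ne_nil G)
      (by simpa using b.srcFan_ne_nil) (hdeg _) (hA _)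
    exact ⟨_, Ka, Kb, τ, ha, hb, hA _, hτ, rfl⟩
  | par a b iha ihb =>
    obtain ⟨Ka, ha⟩ := iha h.1 hp.par_left (fun d hd => hB d (Finset.mem_union_left _ hd))
      (fun f hf' => hf f (by simp [faces, hf']))
    obtain ⟨Kb, hb⟩ := ihb h.2.1 (hp.par_right h) (fun d hd => hB d (Finset.mem_union_right _ hd))
      (fun f hf' => hf f (by simp [faces, hf']))
    have hp' := hp
    obtain ⟨⟨X, hX0, hX⟩, Y, hY0, hY⟩ := hp
    rw [srcFan, List.reverse_append] at hX
    obtain ⟨δ₁, δ₂, hO, -⟩ := exists_offsets hX (by simpa using b.srcFan_ne_nil)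
      (by simpa using a.srcFan_ne_nil) hX0 (hdeg _) (hA _)
    obtain ⟨ε₁, ε₂, hO', -⟩ := exists_offsets hY (a.snkFan_ne_nil G) (b.snkFan_ne_nil G) hY0
      (hdeg _) (hA _)
    exact ⟨_, Ka, Kb, δ₁, δ₂, ε₁, ε₂, ha, hb, hA _, hA _, hO, hO', rfl,
      (h.walkTurns_face hp' hdeg ha hb (hA _) (hA _) hO hO').1 (hf _ (by simp [faces]))⟩

end SPTerm

namespace PlaneGraph

variable {V D : Type*} [Fintype V] [DecidableEq V] [Fintype D] [DecidableEq D]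
  {G : PlaneGraph V D}

theorem Offsets.unique {A : D → ℕ} {F₁ F₂ : List D} {δ₁ δ₂ ε₁ ε₂ : ℤ} (h₁ : F₁ ≠ [])
    (h₂ : F₂ ≠ []) (h : G.Offsets A F₁ F₂ δ₁ δ₂) (h' : G.Offsets A F₁ F₂ ε₁ ε₂) :
    δ₁ = ε₁ ∧ δ₂ = ε₂ := by
  obtain ⟨x, hx⟩ := List.exists_mem_of_ne_nil _ h₁
  obtain ⟨y, hy⟩ := List.exists_mem_of_ne_nil _ h₂
  have := h.1 x hx
  have := h'.1 x hx
  have := h.2 y hy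
  have := h'.2 y hy
  omega

theorem JunctionTurn.unique {A : D → ℕ} {F F' : List D} {τ τ' : ℤ} (h₁ : F ≠ []) (h₂ : F' ≠ [])
    (h : G.JunctionTurn A F F' τ) (h' : G.JunctionTurn A F F' τ') : τ = τ' := by
  obtain ⟨x, hx⟩ := List.exists_mem_of_ne_nil _ h₁
  obtain ⟨y, hy⟩ := List.exists_mem_of_ne_nil _ h₂
  have := h x hx y hy
  have := h' x hx y hy
  omega

theorem Offsets.transfer {w : V} {F₁ F₂ X : List D} (h : G.IsRotationAt w (F₁ ++ F₂ ++ X))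
    (h₁ : F₁ ≠ []) (h₂ : F₂ ≠ []) (h₃ : X ≠ []) (hd : G.degree w ≤ 4) {δ₁ δ₂ : ℤ}
    (hδ : AllowedOffsets F₁.length F₂.length X.length δ₁ δ₂) {A A₀ : D → ℕ}
    (hA : G.AnglesAt A w) (hO : G.Offsets A₀ F₁ F₂ δ₁ δ₂)
    (heq : F₁.length = 1 → F₂.length = 1 → ∀ d, G.org d = w → A₀ d = A d) :
    G.Offsets A F₁ F₂ δ₁ δ₂ := by
  by_cases hl : F₁.length = 1 ∧ F₂.length = 1
  · exact hO.congr (heq hl.1 hl.2) (fun f hf => (h.2.1 f).1 (by simp [hf]))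
      (fun f hf => (h.2.1 f).1 (by simp [hf]))
  · obtain ⟨ε₁, ε₂, hO', hε⟩ := exists_offsets h h₁ h₂ h₃ hd hA
    obtain ⟨rfl, rfl⟩ := hδ.unique hε (by tauto)
    exact hO'

/-- The least offset of a fan of `i` darts beside a fan of `j` darts, when there are `x` further
darts. -/
def baseOffset (i j x : ℕ) : ℤ :=
  if i = 2 then 1 else if j = 2 then 2 else if x = 1 then 0 else 1

/-- Whether the angles at the pole of a parallel composition can be chosen. -/
def slack (i j x : ℕ) : ℤ := if i = 1 ∧ j = 1 ∧ x = 1 then 1 else 0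

theorem slack_nonneg (i j x : ℕ) : 0 ≤ slack i j x := by
  unfold slack; split_ifs <;> simp

theorem size_cases {i j x : ℕ} (hi : 0 < i) (hj : 0 < j) (hx : 0 < x) (h : i + j + x ≤ 4) :
    (i = 1 ∧ j = 1 ∧ x = 1) ∨ (i = 1 ∧ j = 1 ∧ x = 2) ∨ (i = 1 ∧ j = 2 ∧ x = 1) ∨
      (i = 2 ∧ j = 1 ∧ x = 1) := by
  omega

theorem allowedOffsets_iff {i j x : ℕ} (hi : 0 < i) (hj : 0 < j) (hx : 0 < x)
    (h : i + j + x ≤ 4) (δ₁ δ₂ : ℤ) :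
    AllowedOffsets i j x δ₁ δ₂ ↔ ∃ p q, δ₁ = baseOffset i j x + 2 * p ∧
      δ₂ = baseOffset j i x + 2 * q ∧ 0 ≤ p ∧ p ≤ slack i j x ∧ 0 ≤ q ∧ q ≤ slack i j x ∧
      slack i j x ≤ p + q := by
  rcases size_cases hi hj hx h with ⟨rfl, rfl, rfl⟩ | ⟨rfl, rfl, rfl⟩ | ⟨rfl, rfl, rfl⟩ |
    ⟨rfl, rfl, rfl⟩ <;> simp [AllowedOffsets, baseOffset, slack]
  · constructor
    · intro h
      exact ⟨δ₁ / 2, by omega, δ₂ / 2, by omega⟩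
    · rintro ⟨p, hp, q, hq⟩
      omega
  all_goals
    constructor
    · intro h
      exact ⟨0, by omega, 0, by omega⟩
    · rintro ⟨p, hp, q, hq⟩
      omega

/-- The number of alias vertices of a pole of degree `n` at which a component has `i` darts. -/
def aliasCount (i n : ℕ) : ℕ := if i = 1 then 1 else n - i

theorem two_dvd_aliasCount_par {i j x : ℕ} (hi : 0 < i) (hj : 0 < j) (hx : 0 < x)
    (h : i + j + x ≤ 4) :
    (2 : ℤ) ∣ aliasCount (i + j) (i + j + x) - (aliasCount i (i + j + x) + baseOffset i j x) ∧
    (2 : ℤ) ∣ aliasCount (i + j) (i + j + x) - (aliasCount j (i + j + x) + baseOffset j i x) := by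
  rcases size_cases hi hj hx h with ⟨rfl, rfl, rfl⟩ | ⟨rfl, rfl, rfl⟩ | ⟨rfl, rfl, rfl⟩ |
    ⟨rfl, rfl, rfl⟩ <;> simp [aliasCount, baseOffset]

theorem two_dvd_aliasCount_ser {i j : ℕ} (hi : 0 < i) (hj : 0 < j) (h : i + j ≤ 4) :
    (2 : ℤ) ∣ aliasCount i (i + j) + aliasCount j (i + j) := by
  have : (i = 1 ∧ j = 1) ∨ (i = 1 ∧ j = 2) ∨ (i = 1 ∧ j = 3) ∨ (i = 2 ∧ j = 1) ∨
    (i = 2 ∧ j = 2) ∨ (i = 3 ∧ j = 1) := by omega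
  rcases this with ⟨rfl, rfl⟩ | ⟨rfl, rfl⟩ | ⟨rfl, rfl⟩ | ⟨rfl, rfl⟩ | ⟨rfl, rfl⟩ | ⟨rfl, rfl⟩ <;>
    simp [aliasCount]

end PlaneGraph

namespace SPTerm

open PlaneGraph

variable {V D : Type*} [Fintype V] [DecidableEq V] [Fintype D] [DecidableEq D]
  {G : PlaneGraph V D}

/-! ### Locality and gluing of realizations -/

/-- The two sets of data coincide where the component `t` can see it. -/
def Agree (G : PlaneGraph V D) (t : SPTerm D) (A : D → ℕ) (B : D → ℤ) (A' : D → ℕ) (B' : D → ℤ) :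
    Prop :=
  (∀ d, G.org d ∈ t.own G → A d = A' d) ∧ ∀ d ∈ t.darts G, B d = B' d

theorem Agree.trans {t : SPTerm D} {A A' A'' : D → ℕ} {B B' B'' : D → ℤ}
    (h : t.Agree G A B A' B') (h' : t.Agree G A' B' A'' B'') : t.Agree G A B A'' B'' :=
  ⟨fun d hd => (h.1 d hd).trans (h'.1 d hd), fun d hd => (h.2 d hd).trans (h'.2 d hd)⟩

theorem Agree.sub {s t : SPTerm D} (hs : Sub s t) {A A' : D → ℕ} {B B' : D → ℤ}
    (h : t.Agree G A B A' B') : s.Agree G A B A' B' :=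
  ⟨fun d hd => h.1 d (hs.own_subset hd), fun d hd => h.2 d (hs.darts_subset hd)⟩

theorem Realizes.congr {t : SPTerm D} (h : t.Valid G) {A A' : D → ℕ} {B B' : D → ℤ} {K : ℤ}
    (hR : t.Realizes G A B K) (hag : t.Agree G A B A' B') : t.Realizes G A' B' K := by
  induction t generalizing K with
  | edge e =>
    have h1 := hag.2 e (by simp [darts])
    have h2 := hag.2 (G.rev e) (by simp [darts])
    obtain ⟨h3, h4⟩ := hR
    exact ⟨by omega, by omega⟩
  | ser a b iha ihb =>
    obtain ⟨Ka, Kb, τ, ha, hb, hA, hJ, rfl⟩ := hR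
    have hw : ∀ d, G.org d = a.snk G → A d = A' d := fun d hd =>
      hag.1 d (by simp [own, hd])
    exact ⟨Ka, Kb, τ, iha h.1 ha (hag.sub (.serLeft _ (.refl _))),
      ihb h.2.1 hb (hag.sub (.serRight _ (.refl _))), hA.congr hw,
      hJ.congr hw (fun f hf => ((h.1.mem_snkFan f).1 hf).2)
        (fun f hf => by
          rw [List.mem_reverse, h.2.1.mem_srcFan, ← h.2.2.1] at hf; exact hf.2), rfl⟩
  | par a b iha ihb =>
    obtain ⟨Ka, Kb, δ₁, δ₂, ε₁, ε₂, ha, hb, hA, hA', hO, hO', e1, e2⟩ := hR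
    have hu : ∀ d, G.org d = a.src G → A d = A' d := fun d hd =>
      hag.1 d (by simp [own, hd])
    have hv : ∀ d, G.org d = a.snk G → A d = A' d := fun d hd =>
      hag.1 d (by simp [own, hd])
    exact ⟨Ka, Kb, δ₁, δ₂, ε₁, ε₂, iha h.1 ha (hag.sub (.parLeft _ (.refl _))),
      ihb h.2.1 hb (hag.sub (.parRight _ (.refl _))), hA.congr hu, hA'.congr hv,
      hO.congr hu
        (fun f hf => by
          rw [List.mem_reverse, h.2.1.mem_srcFan, ← h.2.2.1] at hf; exact hf.2)
        (fun f hf => by rw [List.mem_reverse, h.1.mem_srcFan] at hf; exact hf.2),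
      hO'.congr hv (fun f hf => ((h.1.mem_snkFan f).1 hf).2)
        (fun f hf => by rw [h.2.1.mem_snkFan, ← h.2.2.2.1] at hf; exact hf.2), e1, e2⟩

theorem Valid.glue_ser {a b : SPTerm D} (h : (ser a b).Valid G) (hdeg : ∀ w, G.degree w ≤ 4)
    {A₁ A₂ : D → ℕ} {B₁ B₂ : D → ℤ} {Ka Kb τ : ℤ} (ha : a.Realizes G A₁ B₁ Ka)
    (hb : b.Realizes G A₂ B₂ Kb)
    (hτ : AllowedJunction (a.snkFan G).length b.srcFan.length τ) :
    ∃ A B, a.Agree G A₁ B₁ A B ∧ b.Agree G A₂ B₂ A B ∧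
      (ser a b).Realizes G A B (Ka + Kb + τ) := by
  have hr := h.2.2.2.1
  have hl := hr.degree_eq ▸ hdeg (a.snk G)
  have hsnk := h.1.snk_mem_own
  have hsrc := h.2.1.src_mem_own
  rw [← h.2.2.1] at hsrc
  have pa := a.length_snkFan_pos G
  have pb := b.length_srcFan_pos
  simp only [List.length_append, List.length_reverse] at hl
  have ne1 := a.snkFan_ne_nil G
  have ne2 : b.srcFan.reverse ≠ [] := by simpa using b.srcFan_ne_nil
  obtain ⟨A₀, hA₀⟩ : ∃ A₀ : D → ℕ, (a.snkFan G).length = 1 → b.srcFan.length = 1 →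
      G.AnglesAt A₀ (a.snk G) ∧ G.JunctionTurn A₀ (a.snkFan G) b.srcFan.reverse τ := by
    by_cases h1 : (a.snkFan G).length = 1 ∧ b.srcFan.length = 1
    · obtain ⟨A₀, h2, h3⟩ := exists_angles_of_junctionTurn hr h1.1 (by simpa using h1.2)
        (τ := τ) (by simpa using hτ)
      exact ⟨A₀, fun _ _ => ⟨h2, h3⟩⟩
    · exact ⟨A₁, fun h2 h3 => absurd ⟨h2, h3⟩ h1⟩
  let A : D → ℕ := fun d =>
    if G.org d ∈ a.own G then A₁ d else if G.org d ∈ b.own G then A₂ d else A₀ d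
  let B : D → ℤ := fun d => if d ∈ a.darts G then B₁ d else B₂ d
  have aga : a.Agree G A₁ B₁ A B := ⟨fun d hd => by simp [A, hd], fun d hd => by simp [B, hd]⟩
  have agb : b.Agree G A₂ B₂ A B := by
    refine ⟨fun d hd => ?_, fun d hd => ?_⟩
    · by_cases hd' : G.org d ∈ a.own G
      · have hw := h.2.2.2.2.2 _ (a.own_subset_verts hd') (b.own_subset_verts hd)
        have l4 : (a.snkFan G ++ b.srcFan.reverse).length = 4 := by
          have := hsnk.1 (hw ▸ hd')
          have := hsrc.1 (hw ▸ hd)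
          simp; omega
        have e1 := hr.eq_one l4 (ha.anglesAt (hw ▸ hd')) hw
        have e2 := hr.eq_one l4 (hb.anglesAt (hw ▸ hd)) hw
        simp only [A, if_pos hd', e1, e2]
      · simp [A, hd', hd]
    · have := Finset.disjoint_right.1 h.2.2.2.2.1 hd
      simp [B, this]
  have e0 : (a.snkFan G).length = 1 → b.srcFan.length = 1 →
      ∀ d, G.org d = a.snk G → A₀ d = A d := fun h1 h2 d hd => by
    have n1 : a.snk G ∉ a.own G := by rw [hsnk]; omega
    have n2 : a.snk G ∉ b.own G := by rw [hsrc]; omega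
    simp [A, hd, n1, n2]
  have hA : G.AnglesAt A (a.snk G) := by
    by_cases h1 : a.snk G ∈ a.own G
    · exact (ha.anglesAt h1).congr fun d hd => aga.1 d (hd ▸ h1)
    · by_cases h2 : a.snk G ∈ b.own G
      · exact (hb.anglesAt h2).congr fun d hd => agb.1 d (hd ▸ h2)
      · rw [hsnk] at h1
        rw [hsrc] at h2
        exact (hA₀ (by omega) (by omega)).1.congr (e0 (by omega) (by omega))
  refine ⟨A, B, aga, agb, Ka, Kb, τ, ha.congr h.1 aga, hb.congr h.2.1 agb, hA, ?_, rfl⟩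
  by_cases h1 : (a.snkFan G).length = 1 ∧ b.srcFan.length = 1
  · exact (hA₀ h1.1 h1.2).2.congr (e0 h1.1 h1.2) (fun f hf => (hr.2.1 f).1 (by simp [hf]))
      (fun f hf => (hr.2.1 f).1 (by simp only [List.mem_append, hf, or_true]))
  · obtain ⟨τ', hJ, hτ'⟩ := exists_junctionTurn hr ne1 ne2 (hdeg _) hA
    rw [List.length_reverse] at hτ'
    obtain rfl : τ' = τ := by unfold AllowedJunction at hτ hτ'; omega
    exact hJ

/-- The number of darts at the source outside of a parallel composition. -/
def srcOut (G : PlaneGraph V D) (a b : SPTerm D) : ℕ :=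
  G.degree (a.src G) - (a.srcFan.length + b.srcFan.length)

/-- The number of darts at the sink outside of a parallel composition. -/
def snkOut (G : PlaneGraph V D) (a b : SPTerm D) : ℕ :=
  G.degree (a.snk G) - ((a.snkFan G).length + (b.snkFan G).length)

theorem Placed.exists_src {a b : SPTerm D} (hp : (par a b).Placed G) :
    ∃ X, X ≠ [] ∧ G.IsRotationAt (a.src G) (b.srcFan.reverse ++ a.srcFan.reverse ++ X) ∧
      X.length = srcOut G a b ∧
      G.degree (a.src G) = a.srcFan.length + b.srcFan.length + srcOut G a b := by
  obtain ⟨X, hX0, hX⟩ := hp.1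
  rw [srcFan, List.reverse_append] at hX
  have hd : G.degree (a.src G) = _ := hX.degree_eq
  simp only [List.length_append, List.length_reverse] at hd
  refine ⟨X, hX0, hX, ?_, ?_⟩ <;> unfold srcOut <;> omega

theorem Placed.exists_snk {a b : SPTerm D} (hp : (par a b).Placed G) :
    ∃ Y, Y ≠ [] ∧ G.IsRotationAt (a.snk G) (a.snkFan G ++ b.snkFan G ++ Y) ∧
      Y.length = snkOut G a b ∧
      G.degree (a.snk G) = (a.snkFan G).length + (b.snkFan G).length + snkOut G a b := by
  obtain ⟨Y, hY0, hY⟩ := hp.2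
  rw [snkFan] at hY
  have hd : G.degree (a.snk G) = _ := hY.degree_eq
  simp only [List.length_append] at hd
  refine ⟨Y, hY0, hY, ?_, ?_⟩ <;> unfold snkOut <;> omega

theorem Placed.srcOut_pos {a b : SPTerm D} (hp : (par a b).Placed G) : 0 < srcOut G a b := by
  obtain ⟨X, h1, -, h2, -⟩ := hp.exists_src
  rw [← h2]; exact List.length_pos_of_ne_nil h1

theorem Placed.snkOut_pos {a b : SPTerm D} (hp : (par a b).Placed G) : 0 < snkOut G a b := by
  obtain ⟨X, h1, -, h2, -⟩ := hp.exists_snk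
  rw [← h2]; exact List.length_pos_of_ne_nil h1

theorem Valid.glue_par {a b : SPTerm D} (h : (par a b).Valid G) (hp : (par a b).Placed G)
    (hdeg : ∀ w, G.degree w ≤ 4)
    {A₁ A₂ : D → ℕ} {B₁ B₂ : D → ℤ} {Ka Kb K δ₁ δ₂ ε₁ ε₂ : ℤ} (ha : a.Realizes G A₁ B₁ Ka)
    (hb : b.Realizes G A₂ B₂ Kb)
    (hδ : AllowedOffsets b.srcFan.length a.srcFan.length (srcOut G a b) δ₁ δ₂)
    (hε : AllowedOffsets (a.snkFan G).length (b.snkFan G).length (snkOut G a b) ε₁ ε₂)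
    (e1 : K = Ka - δ₂ - ε₁) (e2 : K = Kb + δ₁ + ε₂) :
    ∃ A B, a.Agree G A₁ B₁ A B ∧ b.Agree G A₂ B₂ A B ∧ (par a b).Realizes G A B K := by
  obtain ⟨X, hX0, hX, hXl, hXd⟩ := hp.exists_src
  obtain ⟨Y, hY0, hY, hYl, hYd⟩ := hp.exists_snk
  have xp := hp.srcOut_pos
  have yp := hp.snkOut_pos
  have hdu := hdeg (a.src G)
  have hdv := hdeg (a.snk G)
  have p1 := a.length_srcFan_pos
  have p2 := b.length_srcFan_pos
  have p3 := a.length_snkFan_pos G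
  have p4 := b.length_snkFan_pos G
  have ne1 : a.srcFan.reverse ≠ [] := by simpa using a.srcFan_ne_nil
  have ne2 : b.srcFan.reverse ≠ [] := by simpa using b.srcFan_ne_nil
  have ne3 := a.snkFan_ne_nil G
  have ne4 := b.snkFan_ne_nil G
  have o1 := h.1.src_mem_own
  have o2 := h.2.1.src_mem_own
  have o3 := h.1.snk_mem_own
  have o4 := h.2.1.snk_mem_own
  rw [← h.2.2.1] at o2
  rw [← h.2.2.2.1] at o4
  have hδ' : AllowedOffsets b.srcFan.reverse.length a.srcFan.reverse.length X.length δ₁ δ₂ := by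
    simpa [hXl] using hδ
  have hε' : AllowedOffsets (a.snkFan G).length (b.snkFan G).length Y.length ε₁ ε₂ := by
    simpa [hYl] using hε
  obtain ⟨Au, hAu, hOu⟩ := exists_angles_of_offsets hX ne2 ne1 hX0 hdu hδ'
  obtain ⟨Av, hAv, hOv⟩ := exists_angles_of_offsets hY ne3 ne4 hY0 hdv hε'
  let A : D → ℕ := fun d =>
    if G.org d ∈ a.own G then A₁ d else if G.org d ∈ b.own G then A₂ d else
      if G.org d = a.src G then Au d else Av d
  let B : D → ℤ := fun d => if d ∈ a.darts G then B₁ d else B₂ d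
  have aga : a.Agree G A₁ B₁ A B := ⟨fun d hd => by simp [A, hd], fun d hd => by simp [B, hd]⟩
  have agb : b.Agree G A₂ B₂ A B := by
    refine ⟨fun d hd => ?_, fun d hd => ?_⟩
    · have hd' : G.org d ∉ a.own G := fun hd' => by
        rcases h.2.2.2.2.2 _ (a.own_subset_verts hd') (b.own_subset_verts hd) with hw | hw
        · rw [hw, o1] at hd'
          rw [hw, o2] at hd
          omega
        · rw [hw, o3] at hd'
          rw [hw, o4] at hd
          omega
      simp [A, hd', hd]
    · have := Finset.disjoint_right.1 h.2.2.2.2.1 hd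
      simp [B, this]
  have eu : a.src G ∉ a.own G → a.src G ∉ b.own G →
      ∀ d, G.org d = a.src G → Au d = A d := fun n1 n2 d hd => by
    simp [A, hd, n1, n2]
  have ev : a.snk G ∉ a.own G → a.snk G ∉ b.own G →
      ∀ d, G.org d = a.snk G → Av d = A d := fun n1 n2 d hd => by
    simp [A, hd, n1, n2, h.1.src_ne_snk.symm]
  have hAu' : G.AnglesAt A (a.src G) := by
    by_cases h1 : a.src G ∈ a.own G
    · exact (ha.anglesAt h1).congr fun d hd => aga.1 d (hd ▸ h1)
    · by_cases h2 : a.src G ∈ b.own G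
      · exact (hb.anglesAt h2).congr fun d hd => agb.1 d (hd ▸ h2)
      · exact hAu.congr (eu h1 h2)
  have hAv' : G.AnglesAt A (a.snk G) := by
    by_cases h1 : a.snk G ∈ a.own G
    · exact (ha.anglesAt h1).congr fun d hd => aga.1 d (hd ▸ h1)
    · by_cases h2 : a.snk G ∈ b.own G
      · exact (hb.anglesAt h2).congr fun d hd => agb.1 d (hd ▸ h2)
      · exact hAv.congr (ev h1 h2)
  refine ⟨A, B, aga, agb, Ka, Kb, δ₁, δ₂, ε₁, ε₂, ha.congr h.1 aga, hb.congr h.2.1 agb, hAu', hAv',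
    hOu.transfer hX ne2 ne1 hX0 hdu hδ' hAu' fun l1 l2 => ?_,
    hOv.transfer hY ne3 ne4 hY0 hdv hε' hAv' fun l1 l2 => ?_, e1, e2⟩
  · rw [List.length_reverse] at l1 l2
    exact eu (by rw [o1]; omega) (by rw [o2]; omega)
  · exact ev (by rw [o3]; omega) (by rw [o4]; omega)

/-! ### Spiralities of series and parallel compositions -/

/-- The least offset of the spirality of the left component of a parallel composition. -/
def offsetLeft (G : PlaneGraph V D) (a b : SPTerm D) : ℤ :=
  baseOffset a.srcFan.length b.srcFan.length (srcOut G a b) +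
    baseOffset (a.snkFan G).length (b.snkFan G).length (snkOut G a b)

/-- The least offset of the spirality of the right component of a parallel composition. -/
def offsetRight (G : PlaneGraph V D) (a b : SPTerm D) : ℤ :=
  baseOffset b.srcFan.length a.srcFan.length (srcOut G a b) +
    baseOffset (b.snkFan G).length (a.snkFan G).length (snkOut G a b)

/-- The number of poles of a parallel composition at which the angles can be chosen. -/
def parSlack (G : PlaneGraph V D) (a b : SPTerm D) : ℤ :=
  slack a.srcFan.length b.srcFan.length (srcOut G a b) +
    slack (a.snkFan G).length (b.snkFan G).length (snkOut G a b)

/-- The amount of choice at the vertex between two components in series. -/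
def serSlack (G : PlaneGraph V D) (a b : SPTerm D) : ℤ :=
  if (a.snkFan G).length = 1 ∧ b.srcFan.length = 1 then 2 else 0

/-- The total number of alias vertices of the two poles. -/
def aliasSum (G : PlaneGraph V D) (t : SPTerm D) : ℕ :=
  aliasCount t.srcFan.length (G.degree (t.src G)) +
    aliasCount (t.snkFan G).length (G.degree (t.snk G))

theorem parSlack_nonneg (a b : SPTerm D) : 0 ≤ parSlack G a b :=
  add_nonneg (slack_nonneg _ _ _) (slack_nonneg _ _ _)

theorem slack_comm (i j x : ℕ) : slack i j x = slack j i x := by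
  unfold slack
  simp only [and_left_comm]

theorem Valid.of_realizes_ser {a b : SPTerm D} (h : (ser a b).Valid G)
    (hdeg : ∀ w, G.degree w ≤ 4) {A : D → ℕ} {B : D → ℤ} {K : ℤ}
    (hR : (ser a b).Realizes G A B K) : ∃ Ka Kb τ, a.Realizes G A B Ka ∧ b.Realizes G A B Kb ∧
      K = Ka + Kb + τ ∧ (τ = 0 ∨ τ = serSlack G a b ∨ τ = -serSlack G a b) := by
  obtain ⟨Ka, Kb, τ, ha, hb, hA, hJ, rfl⟩ := hR
  have ne2 : b.srcFan.reverse ≠ [] := by simpa using b.srcFan_ne_nil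
  obtain ⟨τ', hJ', hτ'⟩ :=
    exists_junctionTurn h.2.2.2.1 (a.snkFan_ne_nil G) ne2 (hdeg _) hA
  obtain rfl := hJ.unique (a.snkFan_ne_nil G) ne2 hJ'
  refine ⟨Ka, Kb, τ, ha, hb, rfl, ?_⟩
  rw [List.length_reverse] at hτ'
  unfold AllowedJunction at hτ'
  unfold serSlack
  split_ifs <;> omega

theorem Valid.realizes_ser {a b : SPTerm D} (h : (ser a b).Valid G)
    (hdeg : ∀ w, G.degree w ≤ 4)
    {A₁ A₂ : D → ℕ} {B₁ B₂ : D → ℤ} {Ka Kb τ : ℤ} (ha : a.Realizes G A₁ B₁ Ka)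
    (hb : b.Realizes G A₂ B₂ Kb)
    (hτ : τ = 0 ∨ τ = serSlack G a b ∨ τ = -serSlack G a b) :
    ∃ A B, a.Agree G A₁ B₁ A B ∧ b.Agree G A₂ B₂ A B ∧
      (ser a b).Realizes G A B (Ka + Kb + τ) := by
  refine h.glue_ser hdeg ha hb ?_
  unfold serSlack at hτ
  unfold AllowedJunction
  split_ifs at hτ <;> omega

theorem Placed.of_realizes_par {a b : SPTerm D} (hp : (par a b).Placed G)
    (hdeg : ∀ w, G.degree w ≤ 4) {A : D → ℕ} {B : D → ℤ} {K : ℤ}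
    (hR : (par a b).Realizes G A B K) : ∃ Ka Kb p q, a.Realizes G A B Ka ∧ b.Realizes G A B Kb ∧
      K = Ka - offsetLeft G a b - 2 * p ∧ K = Kb + offsetRight G a b + 2 * q ∧ 0 ≤ p ∧
      p ≤ parSlack G a b ∧ 0 ≤ q ∧ q ≤ parSlack G a b ∧ parSlack G a b ≤ p + q := by
  obtain ⟨Ka, Kb, δ₁, δ₂, ε₁, ε₂, ha, hb, hA, hA', hO, hO', e1, e2⟩ := hR
  obtain ⟨X, hX0, hX, hXl, hXd⟩ := hp.exists_src
  obtain ⟨Y, hY0, hY, hYl, hYd⟩ := hp.exists_snk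
  have hdu := hdeg (a.src G)
  have hdv := hdeg (a.snk G)
  have ne1 : a.srcFan.reverse ≠ [] := by simpa using a.srcFan_ne_nil
  have ne2 : b.srcFan.reverse ≠ [] := by simpa using b.srcFan_ne_nil
  have ne3 := a.snkFan_ne_nil G
  have ne4 := b.snkFan_ne_nil G
  obtain ⟨δ₁', δ₂', hU, hδ⟩ := exists_offsets hX ne2 ne1 hX0 hdu hA
  obtain ⟨rfl, rfl⟩ := hO.unique ne2 ne1 hU
  obtain ⟨ε₁', ε₂', hU', hε⟩ := exists_offsets hY ne3 ne4 hY0 hdv hA'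
  obtain ⟨rfl, rfl⟩ := hO'.unique ne3 ne4 hU'
  rw [List.length_reverse, List.length_reverse, hXl, allowedOffsets_iff b.length_srcFan_pos
    a.length_srcFan_pos hp.srcOut_pos (by omega)] at hδ
  rw [hYl, allowedOffsets_iff (a.length_snkFan_pos G) (b.length_snkFan_pos G) hp.snkOut_pos
    (by omega)] at hε
  obtain ⟨p, q, h1, h2, h3, h4, h5, h6, h7⟩ := hδ
  obtain ⟨p', q', h1', h2', h3', h4', h5', h6', h7'⟩ := hε
  rw [slack_comm] at h4 h6 h7
  refine ⟨Ka, Kb, q + p', p + q', ha, hb, ?_, ?_, ?_, ?_, ?_, ?_, ?_⟩ <;>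
    first
    | omega
    | simp only [offsetLeft, offsetRight, parSlack]
      omega

theorem Valid.realizes_par {a b : SPTerm D} (h : (par a b).Valid G) (hp : (par a b).Placed G)
    (hdeg : ∀ w, G.degree w ≤ 4)
    {A₁ A₂ : D → ℕ} {B₁ B₂ : D → ℤ} {Ka Kb K p q : ℤ} (ha : a.Realizes G A₁ B₁ Ka)
    (hb : b.Realizes G A₂ B₂ Kb) (e1 : K = Ka - offsetLeft G a b - 2 * p)
    (e2 : K = Kb + offsetRight G a b + 2 * q) (hp0 : 0 ≤ p) (hp1 : p ≤ parSlack G a b)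
    (hq0 : 0 ≤ q) (hq1 : q ≤ parSlack G a b) (hpq : parSlack G a b ≤ p + q) :
    ∃ A B, a.Agree G A₁ B₁ A B ∧ b.Agree G A₂ B₂ A B ∧ (par a b).Realizes G A B K := by
  obtain ⟨-, -, -, -, hXd⟩ := hp.exists_src
  obtain ⟨-, -, -, -, hYd⟩ := hp.exists_snk
  have hdu := hdeg (a.src G)
  have hdv := hdeg (a.snk G)
  unfold parSlack at hp1 hq1 hpq
  have s1 := slack_nonneg a.srcFan.length b.srcFan.length (srcOut G a b)
  have s2 := slack_nonneg (a.snkFan G).length (b.snkFan G).length (snkOut G a b)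
  have s3 : slack a.srcFan.length b.srcFan.length (srcOut G a b) ≤ 1 := by
    unfold slack; split_ifs <;> simp
  have s4 : slack (a.snkFan G).length (b.snkFan G).length (snkOut G a b) ≤ 1 := by
    unfold slack; split_ifs <;> simp
  have sc := slack_comm a.srcFan.length b.srcFan.length (srcOut G a b)
  generalize hsu : slack a.srcFan.length b.srcFan.length (srcOut G a b) = su at *
  generalize hsv : slack (a.snkFan G).length (b.snkFan G).length (snkOut G a b) = sv at *
  have hδ := (allowedOffsets_iff b.length_srcFan_pos a.length_srcFan_pos hp.srcOut_pos (by omega)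
    _ _).2 ⟨q - min q sv, min p su, rfl, rfl, by omega, by omega, by omega, by omega, by omega⟩
  have hε := (allowedOffsets_iff (a.length_snkFan_pos G) (b.length_snkFan_pos G) hp.snkOut_pos
    (by omega) _ _).2 ⟨p - min p su, min q sv, rfl, rfl, by omega, by omega, by omega, by omega,
      by omega⟩
  refine h.glue_par hp hdeg ha hb hδ hε ?_ ?_
  · rw [e1, offsetLeft]; ring
  · rw [e2, offsetRight]; ring

theorem Valid.two_dvd_aliasSum_ser {a b : SPTerm D} (h : (ser a b).Valid G)
    (hdeg : ∀ w, G.degree w ≤ 4) :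
    (2 : ℤ) ∣ (ser a b).aliasSum G - (a.aliasSum G + b.aliasSum G) := by
  have hl := h.2.2.2.1.degree_eq
  simp only [List.length_append, List.length_reverse] at hl
  have hd := hdeg (a.snk G)
  have := two_dvd_aliasCount_ser (a.length_snkFan_pos G) b.length_srcFan_pos (by omega)
  rw [← hl] at this
  simp only [aliasSum, srcFan, snkFan, src, snk, ← h.2.2.1]
  push_cast
  omega

theorem Valid.two_dvd_aliasSum_par {a b : SPTerm D} (h : (par a b).Valid G)
    (hp : (par a b).Placed G) (hdeg : ∀ w, G.degree w ≤ 4) :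
    (2 : ℤ) ∣ (par a b).aliasSum G - (a.aliasSum G + offsetLeft G a b) ∧
    (2 : ℤ) ∣ (par a b).aliasSum G - (b.aliasSum G + offsetRight G a b) := by
  obtain ⟨-, -, -, -, hXd⟩ := hp.exists_src
  obtain ⟨-, -, -, -, hYd⟩ := hp.exists_snk
  have hdu := hdeg (a.src G)
  have hdv := hdeg (a.snk G)
  have h1 := two_dvd_aliasCount_par a.length_srcFan_pos b.length_srcFan_pos hp.srcOut_pos
    (by omega)
  have h2 := two_dvd_aliasCount_par (a.length_snkFan_pos G) (b.length_snkFan_pos G) hp.snkOut_pos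
    (by omega)
  rw [← hXd] at h1
  rw [← hYd] at h2
  simp only [aliasSum, srcFan, snkFan, src, snk, ← h.2.2.1, ← h.2.2.2.1, List.length_append,
    offsetLeft, offsetRight]
  push_cast
  omega

theorem Valid.two_dvd {t : SPTerm D} (h : t.Valid G) (hp : t.Placed G)
    (hdeg : ∀ w, G.degree w ≤ 4) {A : D → ℕ} {B : D → ℤ} {K : ℤ} (hR : t.Realizes G A B K) :
    (2 : ℤ) ∣ K - t.aliasSum G := by
  induction t generalizing K with
  | edge e =>
    obtain ⟨-, rfl⟩ := hR
    simp [aliasSum, srcFan, snkFan, aliasCount]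
  | ser a b iha ihb =>
    obtain ⟨Ka, Kb, τ, ha, hb, rfl, hτ⟩ := h.of_realizes_ser hdeg hR
    have h1 := iha h.1 (hp.ser_left h) ha
    have h2 := ihb h.2.1 (hp.ser_right h) hb
    have h3 := h.two_dvd_aliasSum_ser hdeg
    unfold serSlack at hτ
    split_ifs at hτ <;> omega
  | par a b iha ihb =>
    obtain ⟨Ka, Kb, p, q, ha, hb, e1, e2, -⟩ := hp.of_realizes_par hdeg hR
    have h1 := iha h.1 hp.par_left ha
    have h3 := h.two_dvd_aliasSum_par hp hdeg
    omega

/-! ### Realizations with bends -/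

theorem Valid.exists_realizes_of_two_dvd {t : SPTerm D} (h : t.Valid G) (hp : t.Placed G)
    (hdeg : ∀ w, G.degree w ≤ 4) {K : ℤ} (hK : (2 : ℤ) ∣ K - t.aliasSum G) :
    ∃ A B, t.Realizes G A B K := by
  induction t generalizing K with
  | edge e =>
    simp [aliasSum, srcFan, snkFan, aliasCount] at hK
    refine ⟨fun _ => 1, fun d => if d = e then K / 2 else -(K / 2), ?_, ?_⟩
    · simp [G.rev_ne e]
    · simp; omega
  | ser a b iha ihb =>
    have h3 := h.two_dvd_aliasSum_ser hdeg
    obtain ⟨A₁, B₁, ha⟩ := iha h.1 (hp.ser_left h) (K := K - b.aliasSum G) (by omega)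
    obtain ⟨A₂, B₂, hb⟩ := ihb h.2.1 (hp.ser_right h) (K := b.aliasSum G) (by omega)
    obtain ⟨A, B, -, -, hR⟩ := h.realizes_ser hdeg ha hb (Or.inl rfl)
    exact ⟨A, B, by convert hR using 1; ring⟩
  | par a b iha ihb =>
    have h3 := h.two_dvd_aliasSum_par hp hdeg
    have h4 := parSlack_nonneg (G := G) a b
    obtain ⟨A₁, B₁, ha⟩ := iha h.1 hp.par_left
      (K := K + offsetLeft G a b + 2 * parSlack G a b) (by omega)
    obtain ⟨A₂, B₂, hb⟩ := ihb h.2.1 (hp.par_right h)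
      (K := K - offsetRight G a b - 2 * parSlack G a b) (by omega)
    obtain ⟨A, B, -, -, hR⟩ := h.realizes_par hp hdeg (K := K) (p := parSlack G a b)
      (q := parSlack G a b) ha hb (by ring) (by ring) h4 le_rfl h4 le_rfl (by omega)
    exact ⟨A, B, hR⟩

theorem Sub.exists_realizes {s t : SPTerm D} (hs : Sub s t) (h : t.Valid G) (hp : t.Placed G)
    (hdeg : ∀ w, G.degree w ≤ 4) {A₀ : D → ℕ} {B₀ : D → ℤ} {K₀ : ℤ}
    (hR : s.Realizes G A₀ B₀ K₀) : ∃ A B K, s.Agree G A₀ B₀ A B ∧ t.Realizes G A B K := by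
  induction hs with
  | refl => exact ⟨A₀, B₀, K₀, ⟨fun _ _ => rfl, fun _ _ => rfl⟩, hR⟩
  | serLeft b hs ih =>
    obtain ⟨A₁, B₁, Ka, hag, ha⟩ := ih h.1 (hp.ser_left h)
    obtain ⟨A₂, B₂, hb⟩ := h.2.1.exists_realizes_of_two_dvd (hp.ser_right h) hdeg
      (K := b.aliasSum G) (by simp)
    obtain ⟨A, B, aga, -, hR⟩ := h.realizes_ser hdeg ha hb (Or.inl rfl)
    exact ⟨A, B, _, hag.trans (aga.sub hs), hR⟩
  | serRight a hs ih =>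
    obtain ⟨A₁, B₁, Kb, hag, hb⟩ := ih h.2.1 (hp.ser_right h)
    obtain ⟨A₂, B₂, ha⟩ := h.1.exists_realizes_of_two_dvd (hp.ser_left h) hdeg
      (K := a.aliasSum G) (by simp)
    obtain ⟨A, B, -, agb, hR⟩ := h.realizes_ser hdeg ha hb (Or.inl rfl)
    exact ⟨A, B, _, hag.trans (agb.sub hs), hR⟩
  | parLeft b hs ih =>
    rename_i a
    obtain ⟨A₁, B₁, Ka, hag, ha⟩ := ih h.1 hp.par_left
    have h2 := h.1.two_dvd hp.par_left hdeg ha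
    have h3 := h.two_dvd_aliasSum_par hp hdeg
    have h4 := parSlack_nonneg (G := G) a b
    obtain ⟨A₂, B₂, hb⟩ := h.2.1.exists_realizes_of_two_dvd (hp.par_right h) hdeg
      (K := Ka - offsetLeft G a b - 2 * parSlack G a b - offsetRight G a b - 2 * parSlack G a b)
      (by omega)
    obtain ⟨A, B, aga, -, hR⟩ := h.realizes_par hp hdeg (p := parSlack G a b)
      (q := parSlack G a b) ha hb rfl (by ring) h4 le_rfl h4 le_rfl (by omega)
    exact ⟨A, B, _, hag.trans (aga.sub hs), hR⟩
  | parRight a hs ih =>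
    rename_i b
    obtain ⟨A₁, B₁, Kb, hag, hb⟩ := ih h.2.1 (hp.par_right h)
    have h2 := h.2.1.two_dvd (hp.par_right h) hdeg hb
    have h3 := h.two_dvd_aliasSum_par hp hdeg
    have h4 := parSlack_nonneg (G := G) a b
    obtain ⟨A₂, B₂, ha⟩ := h.1.exists_realizes_of_two_dvd hp.par_left hdeg
      (K := Kb + offsetRight G a b + 2 * parSlack G a b + offsetLeft G a b + 2 * parSlack G a b)
      (by omega)
    obtain ⟨A, B, -, agb, hR⟩ := h.realizes_par hp hdeg (p := parSlack G a b)
      (q := parSlack G a b) ha hb (by ring) rfl h4 le_rfl h4 le_rfl (by omega)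
    exact ⟨A, B, _, hag.trans (agb.sub hs), hR⟩

/-! ### Realizations without bends -/

/-- Twice the endpoints of the representability interval. -/
def ivl (G : PlaneGraph V D) : SPTerm D → ℤ × ℤ
  | edge _ => (0, 0)
  | ser a b => ((a.ivl G).1 + (b.ivl G).1 - serSlack G a b,
      (a.ivl G).2 + (b.ivl G).2 + serSlack G a b)
  | par a b => (max ((a.ivl G).1 - offsetLeft G a b - 2 * parSlack G a b)
        ((b.ivl G).1 + offsetRight G a b),
      min ((a.ivl G).2 - offsetLeft G a b)
        ((b.ivl G).2 + offsetRight G a b + 2 * parSlack G a b))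

/-- The representability condition for terms. -/
def Cond (G : PlaneGraph V D) : SPTerm D → Prop
  | edge _ => True
  | ser a b => a.Cond G ∧ b.Cond G
  | par a b => a.Cond G ∧ b.Cond G ∧
      offsetLeft G a b + offsetRight G a b + 2 * parSlack G a b ≤ (a.ivl G).2 - (b.ivl G).1 ∧
      (a.ivl G).1 - (b.ivl G).2 ≤ offsetLeft G a b + offsetRight G a b + 4 * parSlack G a b

theorem Valid.ivl_of_cond {t : SPTerm D} (h : t.Valid G) (hp : t.Placed G)
    (hdeg : ∀ w, G.degree w ≤ 4) (hc : t.Cond G) :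
    (t.ivl G).1 ≤ (t.ivl G).2 ∧ (2 : ℤ) ∣ (t.ivl G).1 - t.aliasSum G ∧
      (2 : ℤ) ∣ (t.ivl G).2 - t.aliasSum G := by
  induction t with
  | edge e => simp [ivl, aliasSum, srcFan, snkFan, aliasCount]
  | ser a b iha ihb =>
    have h1 := iha h.1 (hp.ser_left h) hc.1
    have h2 := ihb h.2.1 (hp.ser_right h) hc.2
    have h3 := h.two_dvd_aliasSum_ser hdeg
    simp only [ivl]
    unfold serSlack
    split_ifs <;> omega
  | par a b iha ihb =>
    have h1 := iha h.1 hp.par_left hc.1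
    have h2 := ihb h.2.1 (hp.par_right h) hc.2.1
    have h3 := h.two_dvd_aliasSum_par hp hdeg
    have h4 := parSlack_nonneg (G := G) a b
    have h5 := hc.2.2
    simp only [ivl]
    omega

theorem Valid.cond_of_realizes {t : SPTerm D} (h : t.Valid G) (hp : t.Placed G)
    (hdeg : ∀ w, G.degree w ≤ 4) {A : D → ℕ} {B : D → ℤ} {K : ℤ} (hR : t.Realizes G A B K)
    (hB : ∀ d ∈ t.darts G, B d = 0) : t.Cond G ∧ (t.ivl G).1 ≤ K ∧ K ≤ (t.ivl G).2 := by
  induction t generalizing K with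
  | edge e =>
    have := hB e (by simp [darts])
    obtain ⟨-, rfl⟩ := hR
    simp [Cond, ivl, this]
  | ser a b iha ihb =>
    obtain ⟨Ka, Kb, τ, ha, hb, rfl, hτ⟩ := h.of_realizes_ser hdeg hR
    have h1 := iha h.1 (hp.ser_left h) ha fun d hd => hB d (Finset.mem_union_left _ hd)
    have h2 := ihb h.2.1 (hp.ser_right h) hb fun d hd => hB d (Finset.mem_union_right _ hd)
    refine ⟨⟨h1.1, h2.1⟩, ?_⟩
    simp only [ivl]
    unfold serSlack at hτ ⊢
    split_ifs at hτ ⊢ <;> omega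
  | par a b iha ihb =>
    obtain ⟨Ka, Kb, p, q, ha, hb, e1, e2, hpq⟩ := hp.of_realizes_par hdeg hR
    have h1 := iha h.1 hp.par_left ha fun d hd => hB d (Finset.mem_union_left _ hd)
    have h2 := ihb h.2.1 (hp.par_right h) hb fun d hd => hB d (Finset.mem_union_right _ hd)
    refine ⟨⟨h1.1, h2.1, by omega, by omega⟩, ?_⟩
    simp only [ivl]
    omega

theorem Valid.realizes_of_cond {t : SPTerm D} (h : t.Valid G) (hp : t.Placed G)
    (hdeg : ∀ w, G.degree w ≤ 4) (hc : t.Cond G) {K : ℤ} (hK : (2 : ℤ) ∣ K - t.aliasSum G)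
    (hK₁ : (t.ivl G).1 ≤ K) (hK₂ : K ≤ (t.ivl G).2) :
    ∃ A B, t.Realizes G A B K ∧ ∀ d ∈ t.darts G, B d = 0 := by
  induction t generalizing K with
  | edge e =>
    simp only [ivl] at hK₁ hK₂
    exact ⟨fun _ => 1, fun _ => 0, ⟨by simp, by show K = 2 * 0; omega⟩, fun _ _ => rfl⟩
  | ser a b iha ihb =>
    have h1 := h.1.ivl_of_cond (hp.ser_left h) hdeg hc.1
    have h2 := h.2.1.ivl_of_cond (hp.ser_right h) hdeg hc.2
    have h3 := h.two_dvd_aliasSum_ser hdeg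
    simp only [ivl] at hK₁ hK₂
    obtain ⟨τ, hτ, h4, h5, h6⟩ : ∃ τ, (τ = 0 ∨ τ = serSlack G a b ∨ τ = -serSlack G a b) ∧
        (a.ivl G).1 + (b.ivl G).1 ≤ K - τ ∧ K - τ ≤ (a.ivl G).2 + (b.ivl G).2 ∧ (2 : ℤ) ∣ τ := by
      unfold serSlack at hK₁ hK₂ ⊢
      split_ifs at hK₁ hK₂ ⊢
      · refine ⟨if K < (a.ivl G).1 + (b.ivl G).1 then -2 else
          if (a.ivl G).2 + (b.ivl G).2 < K then 2 else 0, ?_, ?_, ?_, ?_⟩ <;> split_ifs <;> omega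
      · exact ⟨0, by omega⟩
    obtain ⟨A₁, B₁, ha, hB₁⟩ := iha h.1 (hp.ser_left h) hc.1
      (K := min (a.ivl G).2 (K - τ - (b.ivl G).1)) (by omega) (by omega) (by omega)
    obtain ⟨A₂, B₂, hb, hB₂⟩ := ihb h.2.1 (hp.ser_right h) hc.2
      (K := K - τ - min (a.ivl G).2 (K - τ - (b.ivl G).1)) (by omega) (by omega) (by omega)
    obtain ⟨A, B, aga, agb, hR⟩ := h.realizes_ser hdeg ha hb hτ
    refine ⟨A, B, by convert hR using 1; ring, fun d hd => ?_⟩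
    rcases Finset.mem_union.1 hd with hd | hd
    · rw [← aga.2 d hd, hB₁ d hd]
    · rw [← agb.2 d hd, hB₂ d hd]
  | par a b iha ihb =>
    have h1 := h.1.ivl_of_cond hp.par_left hdeg hc.1
    have h2 := h.2.1.ivl_of_cond (hp.par_right h) hdeg hc.2.1
    have h3 := h.two_dvd_aliasSum_par hp hdeg
    have h4 := parSlack_nonneg (G := G) a b
    have h5 := hc.2.2
    simp only [ivl] at hK₁ hK₂
    obtain ⟨p, hp'⟩ : ∃ p, p = min (parSlack G a b) (((a.ivl G).2 - K - offsetLeft G a b) / 2) :=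
      ⟨_, rfl⟩
    obtain ⟨q, hq'⟩ : ∃ q, q = min (parSlack G a b) ((K - offsetRight G a b - (b.ivl G).1) / 2) :=
      ⟨_, rfl⟩
    obtain ⟨A₁, B₁, ha, hB₁⟩ := iha h.1 hp.par_left hc.1
      (K := K + offsetLeft G a b + 2 * p) (by omega) (by omega) (by omega)
    obtain ⟨A₂, B₂, hb, hB₂⟩ := ihb h.2.1 (hp.par_right h) hc.2.1
      (K := K - offsetRight G a b - 2 * q) (by omega) (by omega) (by omega)
    obtain ⟨A, B, aga, agb, hR⟩ := h.realizes_par hp hdeg (K := K) (p := p) (q := q) ha hb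
      (by ring) (by ring) (by omega) (by omega) (by omega) (by omega) (by omega)
    refine ⟨A, B, hR, fun d hd => ?_⟩
    rcases Finset.mem_union.1 hd with hd | hd
    · rw [← aga.2 d hd, hB₁ d hd]
    · rw [← agb.2 d hd, hB₂ d hd]

end SPTerm

/-! ### Bends -/

namespace Turn

/-- A sequence of bends with `z` right turns more than left turns. -/
def ofInt (z : ℤ) : List Turn :=
  List.replicate z.toNat right ++ List.replicate (-z).toNat left

theorem sum_ofInt (z : ℤ) : ((ofInt z).map val).sum = z := by
  simp [ofInt, val]
  omega

theorem ofInt_neg (z : ℤ) : ofInt (-z) = ((ofInt z).map flip).reverse := by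
  simp [ofInt, flip]

theorem sum_flip_reverse (l : List Turn) :
    (((l.map flip).reverse).map val).sum = -(l.map val).sum := by
  induction l with
  | nil => simp
  | cons t l ih => cases t <;> simp_all [flip, val]

end Turn

namespace PlaneGraph

variable {V D : Type*} [Fintype V] [DecidableEq V] [Fintype D] [DecidableEq D]
  {G : PlaneGraph V D}

/-- The number of right bends minus the number of left bends of a dart. -/
def OrthoRep.net (H : OrthoRep G) (d : D) : ℤ := ((H.bends d).map Turn.val).sum

theorem OrthoRep.net_rev (H : OrthoRep G) (d : D) : H.net (G.rev d) = -H.net d := by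
  rw [OrthoRep.net, H.bends_rev, Turn.sum_flip_reverse, OrthoRep.net]

theorem OrthoRep.anglesAt (H : OrthoRep G) (w : V) : G.AnglesAt H.ang w :=
  ⟨fun d _ => H.ang_pos d, H.vertex_sum w⟩

theorem IsRotationAt.poleTurn_head_getLast {w : V} {F : List D} {x f g : D}
    (h : G.IsRotationAt w (F ++ [x])) {A : D → ℕ} (hA : G.AnglesAt A w)
    (h1 : F.length = 1 → A x = 2) (hf : F.head? = some f) (hg : F.getLast? = some g) :
    G.poleTurn A F f = 4 - 2 * (A x : ℤ) ∧ G.poleTurn A F g = 2 * (A g : ℤ) - 4 := by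
  by_cases hl : F.length = 1
  · obtain ⟨z, rfl⟩ := List.length_eq_one_iff.1 hl
    obtain rfl : z = f := by simpa using hf
    obtain rfl : z = g := by simpa using hg
    have := ((h.anglesAt_iff A).1 hA).2
    have hx := h1 hl
    simp at this
    simp only [poleTurn_singleton]
    omega
  · have hne : F ≠ [] := by rintro rfl; simp at hf
    have hgm := List.mem_of_getLast? hg
    have e1 := h.append_comm.angleSum_adjacent (f := x) (g := f) (by simp) hf A
    have e2 := h.angleSum_adjacent (f := g) (g := x) hg (by simp) A
    have e3 := h.angleSum_add (a := g) (b := x) (by simp [hgm]) (by simp)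
      ((List.nodup_append.1 h.1).2.2 _ hgm _ (by simp)) hA
    rw [h.poleTurn_eq hl hne, h.poleTurn_eq hl hne, e1]
    omega

end PlaneGraph

namespace SPTerm

open PlaneGraph

variable {V D : Type*} [Fintype V] [DecidableEq V] [Fintype D] [DecidableEq D]
  {G : PlaneGraph V D}

theorem Realizes.sub {s t : SPTerm D} (hs : Sub s t) {A : D → ℕ} {B : D → ℤ} {K : ℤ}
    (h : t.Realizes G A B K) : ∃ K', s.Realizes G A B K' := by
  induction hs generalizing K with
  | refl => exact ⟨K, h⟩
  | serLeft b _ ih => obtain ⟨_, _, _, ha, -⟩ := h; exact ih ha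
  | serRight a _ ih => obtain ⟨_, _, _, -, hb, -⟩ := h; exact ih hb
  | parLeft b _ ih => obtain ⟨_, _, _, _, _, _, ha, -⟩ := h; exact ih ha
  | parRight a _ ih => obtain ⟨_, _, _, _, _, _, -, hb, -⟩ := h; exact ih hb

/-- The plane graph `G` consists of the component `t` and of the edge `e` to the right of `t`,
which joins the poles of `t`; the external face is to the right of `e`. -/
structure IsRest (G : PlaneGraph V D) (t : SPTerm D) (e : D) : Prop where
  valid : t.Valid G
  src_eq : t.src G = G.org e
  snk_eq : t.snk G = G.org (G.rev e)
  mem_darts : ∀ d, d ∈ t.darts G ↔ d ≠ e ∧ d ≠ G.rev e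
  rot_src : G.IsRotationAt (t.src G) (t.srcFan.reverse ++ [e])
  rot_snk : G.IsRotationAt (t.snk G) (t.snkFan G ++ [G.rev e])
  outer : G.face.SameCycle G.outer e

namespace IsRest

variable {t : SPTerm D} {e : D}

theorem placed (h : t.IsRest G e) : t.Placed G :=
  ⟨⟨_, by simp, h.rot_src⟩, _, by simp, h.rot_snk⟩

theorem faces_ne_nil {t : SPTerm D} {f : List D} (hf : f ∈ t.faces G) : f ≠ [] := by
  induction t with
  | edge d => simp [faces] at hf
  | ser a b iha ihb => exact (List.mem_append.1 hf).elim iha ihb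
  | par a b iha ihb =>
    rw [faces, List.mem_cons, List.mem_append] at hf
    rcases hf with rfl | hf | hf
    · simp [a.thru_right.ne_nil]
    · exact iha hf
    · exact ihb hf

theorem not_sameCycle_outer (h : t.IsRest G e) {L : List D} (hL : ClosedUnder G.face L)
    (he : e ∉ L) {d : D} (hd : d ∈ L) : ¬ G.face.SameCycle G.outer d := fun hs =>
  he (hL.mem_of_sameCycle hd (hs.symm.trans h.outer))

theorem exists_realizes (h : t.IsRest G e) (hdeg : ∀ w, G.degree w ≤ 4) (H : OrthoRep G) :
    ∃ K, t.Realizes G H.ang H.net K := by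
  refine h.valid.exists_realizes h.placed hdeg H.anglesAt (fun d _ => H.net_rev d)
    fun f hf => ?_
  obtain ⟨h1, h2, h3⟩ := h.valid.face_closed h.placed hf
  obtain ⟨d, hd⟩ := List.exists_mem_of_ne_nil _ (faces_ne_nil hf)
  classical
  have hs := H.face_sum d
  have he : e ∉ f := fun he => ((h.mem_darts e).1 (h3 e he)).1 rfl
  rw [if_neg (h.not_sameCycle_outer h1 he hd), h1.sum_sameCycle h2 hd] at hs
  exact hs

/-- The angles, completed by straight angles at the poles of degree two. -/
def extendAng (G : PlaneGraph V D) (t : SPTerm D) (A : D → ℕ) (d : D) : ℕ :=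
  if G.org d ∈ t.own G then A d else 2

/-- The bends, completed by bends of the edge `e`. -/
def extendBends (G : PlaneGraph V D) (e : D) (B : D → ℤ) (c : ℤ) (d : D) : ℤ :=
  if d = e then c else if d = G.rev e then -c else B d

theorem agree_extend (h : t.IsRest G e) (A : D → ℕ) (B : D → ℤ) (c : ℤ) :
    t.Agree G A B (extendAng G t A) (extendBends G e B c) := by
  refine ⟨fun d hd => by simp [extendAng, hd], fun d hd => ?_⟩
  rw [h.mem_darts] at hd
  simp [extendBends, hd]

theorem extendAng_src (h : t.IsRest G e) (A : D → ℕ) (hl : t.srcFan.length = 1) {d : D}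
    (hd : G.org d = t.src G) : extendAng G t A d = 2 := by
  have : t.src G ∉ t.own G := by rw [h.valid.src_mem_own]; omega
  simp [extendAng, hd, this]

theorem extendAng_snk (h : t.IsRest G e) (A : D → ℕ) (hl : (t.snkFan G).length = 1) {d : D}
    (hd : G.org d = t.snk G) : extendAng G t A d = 2 := by
  have : t.snk G ∉ t.own G := by rw [h.valid.snk_mem_own]; omega
  simp [extendAng, hd, this]

theorem anglesAt_extend (h : t.IsRest G e) {A : D → ℕ} {B : D → ℤ} {K : ℤ}
    (hR : t.Realizes G A B K) (w : V) : G.AnglesAt (extendAng G t A) w := by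
  by_cases hw : w ∈ t.own G
  · exact (hR.anglesAt hw).congr fun d hd => by simp [extendAng, hd, hw]
  · have hw' : w = t.src G ∨ w = t.snk G := by
      obtain ⟨d, rfl⟩ := G.org_surjective w
      by_cases h1 : d = e
      · left; rw [h.src_eq, h1]
      · by_cases h2 : d = G.rev e
        · right; rw [h.snk_eq, h2]
        · exact (h.valid.mem_own_or (org_mem_verts ((h.mem_darts d).2 ⟨h1, h2⟩))).resolve_left hw
    rcases hw' with rfl | rfl
    · have hl : t.srcFan.length = 1 := by
        have := t.length_srcFan_pos
        rw [h.valid.src_mem_own] at hw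
        omega
      have e2 : ∀ d ∈ t.srcFan.reverse ++ [e], extendAng G t A d = 2 := fun d hd =>
        h.extendAng_src A hl ((h.rot_src.2.1 d).1 hd)
      rw [h.rot_src.anglesAt_iff]
      refine ⟨fun d hd => by rw [e2 d hd]; simp, ?_⟩
      rw [List.map_congr_left e2]
      simp [hl]
    · have hl : (t.snkFan G).length = 1 := by
        have := t.length_snkFan_pos G
        rw [h.valid.snk_mem_own] at hw
        omega
      have e2 : ∀ d ∈ t.snkFan G ++ [G.rev e], extendAng G t A d = 2 := fun d hd =>
        h.extendAng_snk A hl ((h.rot_snk.2.1 d).1 hd)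
      rw [h.rot_snk.anglesAt_iff]
      refine ⟨fun d hd => by rw [e2 d hd]; simp, ?_⟩
      rw [List.map_congr_left e2]
      simp [hl]

theorem two_dvd (h : t.IsRest G e) (hdeg : ∀ w, G.degree w ≤ 4) {A : D → ℕ} {B : D → ℤ} {K : ℤ}
    (hR : t.Realizes G A B K) : (2 : ℤ) ∣ K := by
  have h1 := h.valid.two_dvd h.placed hdeg hR
  have h2 := h.rot_src.degree_eq
  have h3 := h.rot_snk.degree_eq
  simp only [List.length_append, List.length_reverse, List.length_singleton] at h2 h3
  have h4 : ∀ n, aliasCount n (n + 1) = 1 := fun n => by simp [aliasCount]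
  simp only [aliasSum, h2, h3, h4] at h1
  omega

theorem closedUnder_right (h : t.IsRest G e) :
    ClosedUnder G.face (t.right ++ [G.rev e]) ∧ (t.right ++ [G.rev e]).Nodup ∧
      e ∉ t.right ++ [G.rev e] := by
  obtain ⟨x, y, ex, ey, hx, hy⟩ := t.exists_right_ends G
  refine ⟨closedUnder_append h.valid.isChain_right (by simp) ex ey (c := G.rev e) (d := G.rev e)
    rfl rfl ?_ ?_, ?_, ?_⟩
  · exact h.rot_snk.rot_adjacent hy rfl
  · show G.rot (G.rev (G.rev e)) = x
    rw [G.rev_rev]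
    exact h.rot_src.append_comm.rot_adjacent rfl (by simp [hx])
  · refine List.nodup_append.2 ⟨t.thru_right.nodup h.valid, by simp, fun z hz z' hz' => ?_⟩
    rw [List.mem_singleton.1 hz']
    exact ((h.mem_darts z).1 (t.thru_right.subset z hz)).2
  · intro he
    rcases List.mem_append.1 he with he | he
    · exact ((h.mem_darts e).1 (t.thru_right.subset e he)).1 rfl
    · exact G.rev_ne e (List.mem_singleton.1 he).symm

theorem closedUnder_left (h : t.IsRest G e) :
    ClosedUnder G.face ([e] ++ G.revPath t.left) ∧ ([e] ++ G.revPath t.left).Nodup := by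
  obtain ⟨x, y, ex, ey, hx, hy⟩ := t.exists_left_ends G
  refine ⟨closedUnder_append (by simp) h.valid.isChain_revPath_left (a := e) (b := e) rfl rfl
    (head?_revPath ey) (getLast?_revPath ex) ?_ ?_, ?_⟩
  · exact h.rot_snk.append_comm.rot_adjacent rfl hy
  · show G.rot (G.rev (G.rev x)) = e
    rw [G.rev_rev]
    exact h.rot_src.rot_adjacent (by simp [hx]) rfl
  · refine List.nodup_append.2 ⟨by simp, t.thru_left.nodup_revPath h.valid, fun z hz z' hz' => ?_⟩
    rw [List.mem_singleton.1 hz]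
    exact (((h.mem_darts z').1 (mem_darts_of_mem_revPath t.thru_left hz')).1).symm

theorem walkTurns_extend (h : t.IsRest G e) {A : D → ℕ} {B : D → ℤ}
    {K c : ℤ} (hR : t.Realizes G A B K) (hc : K = 8 + 2 * c) :
    G.walkTurns (extendAng G t A) (extendBends G e B c) (t.right ++ [G.rev e]) = 4 ∧
    G.walkTurns (extendAng G t A) (extendBends G e B c) ([e] ++ G.revPath t.left) = -4 := by
  have hR' := hR.congr h.valid (h.agree_extend A B c)
  have hA := h.anglesAt_extend hR
  have hBe : extendBends G e B c e = c := by simp [extendBends]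
  have hBr : extendBends G e B c (G.rev e) = -c := by simp [extendBends, G.rev_ne e]
  have hs : t.srcFan.reverse.length = 1 → extendAng G t A e = 2 := fun hl =>
    h.extendAng_src A (by simpa using hl) h.src_eq.symm
  have ht : (t.snkFan G).length = 1 → extendAng G t A (G.rev e) = 2 := fun hl =>
    h.extendAng_snk A hl h.snk_eq.symm
  obtain ⟨x, y, ex, ey, hx, hy⟩ := t.exists_right_ends G
  obtain ⟨x', y', ex', ey', hx', hy'⟩ := t.exists_left_ends G
  have p1 := h.rot_src.poleTurn_head_getLast (f := x) (g := x') (hA _) hs (by simp [hx])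
    (by simp [hx'])
  have p2 := h.rot_snk.poleTurn_head_getLast (hA _) ht hy' hy
  have s1 := hR'.spine t.thru_right ex ey
  have s2 := hR'.spine t.thru_left ex' ey'
  rw [p1.1, p2.2] at s1
  rw [p1.2, p2.1] at s2
  rw [walkTurns_append, walkTurns_append, h.valid.walkTurns_right _ _ ey,
    h.valid.walkTurns_left hR' ex']
  simp only [walkTurns, List.map_cons, List.map_nil, List.sum_cons, List.sum_nil, hBe, hBr,
    G.rev_rev]
  constructor <;> linarith

theorem exists_orthoRep (h : t.IsRest G e) (hdeg : ∀ w, G.degree w ≤ 4) {A : D → ℕ} {B : D → ℤ}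
    {K : ℤ} (hR : t.Realizes G A B K) :
    ∃ H : OrthoRep G, t.Agree G A B H.ang H.net ∧ (∀ d, H.net d = 0 → H.bends d = []) ∧
      2 * H.net e = K - 8 := by
  obtain ⟨c, hc⟩ : ∃ c, K = 8 + 2 * c := by
    obtain ⟨c, hc⟩ := h.two_dvd hdeg hR
    exact ⟨c - 4, by omega⟩
  have hR' := hR.congr h.valid (h.agree_extend A B c)
  have hw := h.walkTurns_extend hR hc
  have hB : ∀ d, extendBends G e B c (G.rev d) = -extendBends G e B c d := fun d => by
    by_cases h1 : d = e
    · subst h1; simp [extendBends, G.rev_ne d]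
    · by_cases h2 : d = G.rev e
      · subst h2; simp [extendBends, G.rev_rev, G.rev_ne e]
      · exact hR'.bend_rev ((h.mem_darts d).2 ⟨h1, h2⟩)
  have key : ∀ L : List D, ClosedUnder G.face L → L.Nodup → ∀ d ∈ L, ∀ v : ℤ,
      G.walkTurns (extendAng G t A) (extendBends G e B c) L = v →
      ∀ [DecidablePred fun d' => G.face.SameCycle d d'],
      ∑ d' with G.face.SameCycle d d', (((Turn.ofInt (extendBends G e B c d')).map Turn.val).sum +
        (2 - (extendAng G t A (G.rev d') : ℤ))) = v := fun L h1 h2 d hd v hv _ => by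
    simp only [Turn.sum_ofInt]
    rw [h1.sum_sameCycle h2 hd]
    exact hv
  classical
  let H : OrthoRep G :=
    { ang := extendAng G t A
      bends := fun d => Turn.ofInt (extendBends G e B c d)
      ang_pos := fun d => (h.anglesAt_extend hR (G.org d)).1 d rfl
      bends_rev := fun d => by rw [hB, Turn.ofInt_neg]
      vertex_sum := fun w => (h.anglesAt_extend hR w).2
      face_sum := fun d => by
        have c1 := h.closedUnder_right
        have c2 := h.closedUnder_left
        have he : e ∈ [e] ++ G.revPath t.left := by simp
        by_cases hd1 : d ∈ [e] ++ G.revPath t.left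
        · rw [if_pos (h.outer.trans (c2.1.sameCycle he hd1))]
          exact key _ c2.1 c2.2 d hd1 _ hw.2
        · by_cases hd2 : d ∈ t.right ++ [G.rev e]
          · rw [if_neg (h.not_sameCycle_outer c1.1 c1.2.2 hd2)]
            exact key _ c1.1 c1.2.1 d hd2 _ hw.1
          · have hd : d ∈ t.darts G := (h.mem_darts d).2
              ⟨fun e1 => hd1 (by simp [e1]), fun e1 => hd2 (by simp [e1])⟩
            obtain ⟨f, hf, hdf⟩ := ((mem_boundary hd).resolve_left
              (fun h1 => hd2 (by simp [h1]))).resolve_left (fun h1 => hd1 (by simp [h1]))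
            obtain ⟨h1, h2, h3⟩ := h.valid.face_closed h.placed hf
            have hef : e ∉ f := fun he => ((h.mem_darts e).1 (h3 e he)).1 rfl
            rw [if_neg (h.not_sameCycle_outer h1 hef hdf)]
            exact key _ h1 h2 d hdf _ (h.valid.walkTurns_eq h.placed hdeg hR' hf) }
  have hnet : ∀ d, H.net d = extendBends G e B c d := fun d => Turn.sum_ofInt _
  refine ⟨H, ⟨(h.agree_extend A B c).1, fun d hd => ?_⟩, fun d hd => ?_, ?_⟩
  · rw [hnet]; exact (h.agree_extend A B c).2 d hd
  · rw [hnet] at hd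
    show Turn.ofInt (extendBends G e B c d) = []
    simp [hd, Turn.ofInt]
  · rw [hnet]
    simp [extendBends]
    omega

end IsRest

end SPTerm

namespace PlaneGraph

open SPTerm

variable {V D : Type*} [Fintype V] [DecidableEq V] [Fintype D] [DecidableEq D]
  {G : PlaneGraph V D}

/-! ### Alias vertices and spirality -/

/-- The alias vertices of a pole with fan `F` and further darts `X`. -/
def aliasSet (F X : List D) : Finset (Option D) :=
  if F.length = 1 then {none} else X.toFinset.image some

/-- The turn at a pole of a spine that comes from the alias vertex `a` and continues with `d`. -/
noncomputable def aliasTurn (G : PlaneGraph V D) (A : D → ℕ) (a : Option D) (d : D) : ℤ :=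
  a.elim 0 fun x => 2 - (G.angleSum A x d : ℤ)

theorem IsRotationAt.length_cases {w : V} {F X : List D} (h : G.IsRotationAt w (F ++ X))
    (hF : F ≠ []) (hX : X ≠ []) (hd : G.degree w ≤ 4) :
    F.length = 1 ∨ (F.length ≠ 1 ∧ ∃ x, X = [x]) ∨ ∃ f g x y, F = [f, g] ∧ X = [x, y] := by
  rw [h.degree_eq] at hd
  match F, X, hF, hX with
  | [f], X, _, _ => simp
  | f :: g :: F, [x], _, _ => simp
  | [f, g], [x, y], _, _ => simp
  | f :: g :: h :: F, x :: y :: X, _, _ => simp at hd; omega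
  | f :: g :: F, x :: y :: z :: X, _, _ => simp at hd; omega

theorem IsRotationAt.aliasTurn_add {w : V} {F X : List D} (h : G.IsRotationAt w (F ++ X))
    (hF : F ≠ []) (hX : X ≠ []) (hd : G.degree w ≤ 4) (A : D → ℕ) {a a' : Option D}
    (ha : aliasSet F X = {a, a'}) (d : D) :
    G.aliasTurn A a d + G.aliasTurn A a' d = G.poleTurn A F d := by
  rcases h.length_cases hF hX hd with h1 | ⟨h1, x, rfl⟩ | ⟨f, g, x, y, rfl, rfl⟩
  · have e1 : a ∈ aliasSet F X := by simp [ha]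
    have e2 : a' ∈ aliasSet F X := by simp [ha]
    simp only [aliasSet, h1, if_true, Finset.mem_singleton] at e1 e2
    simp [e1, e2, aliasTurn, poleTurn, h1]
  · have e1 : a ∈ aliasSet F [x] := by simp [ha]
    have e2 : a' ∈ aliasSet F [x] := by simp [ha]
    simp [aliasSet, h1] at e1 e2
    rw [h.poleTurn_eq h1 hF, e1, e2]
    simp [aliasTurn]
    ring
  · have hn := h.1
    simp at hn
    have e1 : a ∈ aliasSet [f, g] [x, y] := by simp [ha]
    have e2 : a' ∈ aliasSet [f, g] [x, y] := by simp [ha]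
    have e3 : some x ∈ aliasSet [f, g] [x, y] := by simp [aliasSet]
    have e4 : some y ∈ aliasSet [f, g] [x, y] := by simp [aliasSet]
    rw [ha] at e3 e4
    simp [aliasSet] at e1 e2 e3 e4
    have r1 : G.rot g = x := (show G.IsRotationAt w ([f] ++ g :: x :: [y]) from h).rot_eq
    have r2 : G.rot y = f := (show G.IsRotationAt w (f :: [g, x] ++ [y]) from h).rot_getLast
    have r3 : G.rot.symm f = y := by rw [← r2, Equiv.symm_apply_apply]
    have hxy : x ≠ y := by tauto
    have hp : G.poleTurn A [f, g] d = 4 - G.angleSum A x d - G.angleSum A y d := by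
      simp [poleTurn, r1, r3]
    rw [hp]
    rcases e1 with rfl | rfl
    · obtain rfl : some y = a' := e4.resolve_left (by simpa using hxy.symm)
      simp [aliasTurn]; ring
    · obtain rfl : some x = a' := e3.resolve_left (by simpa using hxy)
      simp [aliasTurn]; ring

theorem IsRotationAt.exists_aliases {w : V} {F X : List D} (h : G.IsRotationAt w (F ++ X))
    (hF : F ≠ []) (hX : X ≠ []) (hd : G.degree w ≤ 4) :
    ∃ a a', aliasSet F X = {a, a'} ∧ (a ≠ a' → a.map G.rot = a') := by
  rcases h.length_cases hF hX hd with h1 | ⟨h1, x, rfl⟩ | ⟨f, g, x, y, rfl, rfl⟩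
  · exact ⟨none, none, by simp [aliasSet, h1], by simp⟩
  · exact ⟨some x, some x, by simp [aliasSet, h1], by simp⟩
  · have r1 : G.rot x = y := (show G.IsRotationAt w ([f, g] ++ x :: y :: []) from h).rot_eq
    exact ⟨some x, some y, by simp [aliasSet], by simp [r1]⟩

/-- The term `t` describes the pertinent graph of the node `μ`. -/
structure Represents (G : PlaneGraph V D) (μ : SPQTree V D) (t : SPTerm D) : Prop where
  source_eq : t.src G = μ.source
  sink_eq : t.snk G = μ.sink
  darts_eq : t.darts G = G.darts μ
  sourceFan_eq : t.srcFan = G.sourceFan μ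
  sinkFan_eq : t.snkFan G = G.sinkFan μ

namespace Represents

variable {μ : SPQTree V D} {t : SPTerm D}

theorem verts_eq (h : G.Represents μ t) : t.verts G = G.verts μ := by
  rw [SPTerm.verts, h.darts_eq, PlaneGraph.verts]

theorem filter_mem (h : G.Represents μ t) {w : V} {F X : List D}
    (hr : G.IsRotationAt w (F ++ X)) (hF : ∀ d, d ∈ F ↔ d ∈ t.darts G ∧ G.org d = w) :
    G.indeg μ w = F.length ∧ G.outdeg μ w = X.length ∧ G.aliases μ w = aliasSet F X := by
  have hn := List.nodup_append.1 hr.1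
  have e1 : (Finset.univ.filter fun d => G.org d = w ∧ d ∈ G.darts μ) = F.toFinset := by
    ext d
    simp [hF, h.darts_eq, and_comm]
  have e2 : (Finset.univ.filter fun d => G.org d = w ∧ d ∉ G.darts μ) = X.toFinset := by
    ext d
    simp only [Finset.mem_filter, Finset.mem_univ, true_and, List.mem_toFinset, ← h.darts_eq]
    constructor
    · rintro ⟨h1, h2⟩
      have := (hr.2.1 d).2 h1
      rw [List.mem_append, hF] at this
      exact this.resolve_left fun h3 => h2 h3.1
    · intro hd
      have h1 := (hr.2.1 d).1 (List.mem_append_right _ hd)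
      exact ⟨h1, fun h2 => hn.2.2 d ((hF d).2 ⟨h2, h1⟩) d hd rfl⟩
  have e3 : G.indeg μ w = F.length := by
    rw [indeg, e1, List.toFinset_card_of_nodup hn.1]
  refine ⟨e3, ?_, ?_⟩
  · rw [outdeg, e2, List.toFinset_card_of_nodup hn.2.1]
  · rw [aliases, aliasSet, e3, e2]

theorem source_pole (h : G.Represents μ t) (hv : t.Valid G) {X : List D}
    (hX : G.IsRotationAt (t.src G) (t.srcFan.reverse ++ X)) :
    G.indeg μ μ.source = t.srcFan.length ∧ G.outdeg μ μ.source = X.length ∧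
      G.aliases μ μ.source = aliasSet t.srcFan.reverse X := by
  have := h.filter_mem hX fun d => by rw [List.mem_reverse, hv.mem_srcFan]
  rwa [h.source_eq, List.length_reverse] at this

theorem sink_pole (h : G.Represents μ t) (hv : t.Valid G) {Y : List D}
    (hY : G.IsRotationAt (t.snk G) (t.snkFan G ++ Y)) :
    G.indeg μ μ.sink = (t.snkFan G).length ∧ G.outdeg μ μ.sink = Y.length ∧
      G.aliases μ μ.sink = aliasSet (t.snkFan G) Y := by
  have := h.filter_mem hY fun d => by rw [hv.mem_snkFan]
  rwa [h.sink_eq] at this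

theorem card_aliasSet {w : V} {F X : List D} (hr : G.IsRotationAt w (F ++ X)) :
    (aliasSet F X).card = aliasCount F.length (G.degree w) := by
  rw [hr.degree_eq, aliasSet, aliasCount]
  split_ifs
  · simp
  · rw [Finset.card_image_of_injective _ (Option.some_injective D),
      List.toFinset_card_of_nodup (List.nodup_append.1 hr.1).2.1]
    simp

theorem card_aliases (h : G.Represents μ t) (hv : t.Valid G) (hp : t.Placed G) :
    (G.aliases μ μ.source).card + (G.aliases μ μ.sink).card = t.aliasSum G := by
  obtain ⟨⟨X, -, hX⟩, Y, -, hY⟩ := hp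
  rw [(h.source_pole hv hX).2.2, (h.sink_pole hv hY).2.2, card_aliasSet hX, card_aliasSet hY,
    List.length_reverse, aliasSum]

theorem pathTurns_cons_toList (A : D → ℕ) (a : Option D) {p : List D} {d : D}
    (hd : p.head? = some d) :
    G.pathTurns A ((a.map G.rev).toList ++ p) = G.aliasTurn A a d + G.pathTurns A p := by
  cases a with
  | none => simp [aliasTurn]
  | some x =>
    have := pathTurns_append (G := G) A (p := [G.rev x]) (d := G.rev x) rfl hd
    simpa [aliasTurn, pathTurns, G.rev_rev] using this

theorem pathTurns_append_toList {w : V} {L : List D} (hr : G.IsRotationAt w L) {A : D → ℕ}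
    (hA : G.AnglesAt A w) (b : Option D) {p : List D} {d : D} (hd : p.getLast? = some d)
    (hb : ∀ y, b = some y → y ∈ L ∧ y ≠ G.rev d) (hdL : G.rev d ∈ L) :
    G.pathTurns A (p ++ b.toList) = G.pathTurns A p - G.aliasTurn A b (G.rev d) := by
  cases b with
  | none => simp [aliasTurn]
  | some y =>
    have := pathTurns_append (G := G) A (q := [y]) (d' := y) hd rfl
    obtain ⟨h1, h2⟩ := hb y rfl
    have h3 := hr.angleSum_add h1 hdL h2 hA
    simp [aliasTurn, pathTurns] at this ⊢
    rw [this]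
    omega

theorem mem_of_mem_aliasSet {F X : List D} {y : D} (h : some y ∈ aliasSet F X) : y ∈ X := by
  unfold aliasSet at h
  split_ifs at h
  · simp at h
  · simpa using h

theorem hasSpirality_iff (h : G.Represents μ t) (hv : t.Valid G) (hp : t.Placed G)
    (hdeg : ∀ w, G.degree w ≤ 4) {H : OrthoRep G} {K : ℤ} (hR : t.Realizes G H.ang H.net K)
    (k : ℚ) : HasSpirality H μ k ↔ k = K / 2 := by
  obtain ⟨⟨X, hX0, hX⟩, Y, hY0, hY⟩ := hp
  have hs := (h.source_pole hv hX).2.2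
  have ht := (h.sink_pole hv hY).2.2
  have ne1 : t.srcFan.reverse ≠ [] := by simpa using t.srcFan_ne_nil
  have ne2 := t.snkFan_ne_nil G
  have key : ∀ p a a' b b', G.IsSpinePair μ p a a' b b' →
      spineTurns H a p b + spineTurns H a' p b' = K := by
    rintro p a a' b b' ⟨hp, hpd, ha, hb, -, -⟩
    rw [← h.source_eq, ← h.sink_eq] at hp
    rw [← h.darts_eq] at hpd
    have hT := thru_of_isSimplePath hv hp hpd
    obtain ⟨x, hx, ex⟩ := hT.exists_head
    obtain ⟨y, hy, ey⟩ := hT.exists_getLast (G := G)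
    rw [hs] at ha
    rw [ht] at hb
    have q : ∀ (c c' : Option D), c' ∈ aliasSet (t.snkFan G) Y → spineTurns H c p c' =
        G.aliasTurn H.ang c x + G.pathTurns H.ang p - G.aliasTurn H.ang c' (G.rev y) +
          (p.map H.net).sum := by
      intro c c' hc'
      have hl : ((c.map G.rev).toList ++ p).getLast? = some y := by
        rw [List.getLast?_append_of_ne_nil _ hT.ne_nil, ey]
      rw [spineTurns, OrthoRep.vertexTurns_eq, pathTurns_append_toList hY (H.anglesAt _) c' hl
        (fun z hz => ?_) (List.mem_append_left _ hy), pathTurns_cons_toList _ _ ex]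
      · rfl
      · have hzY := mem_of_mem_aliasSet (hz ▸ hc')
        exact ⟨List.mem_append_right _ hzY,
          ((List.nodup_append.1 hY.1).2.2 _ hy _ hzY).symm⟩
    rw [q a b (by simp [hb]), q a' b' (by simp [hb])]
    have s1 := hX.aliasTurn_add ne1 hX0 (hdeg _) H.ang ha x
    have s2 := hY.aliasTurn_add ne2 hY0 (hdeg _) H.ang hb (G.rev y)
    have s3 := hR.spine hT ex ey
    linarith
  have hex : ∃ p a a' b b', G.IsSpinePair μ p a a' b b' := by
    obtain ⟨a, a', ha, ha'⟩ := hX.exists_aliases ne1 hX0 (hdeg _)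
    obtain ⟨b', b, hb, hb'⟩ := hY.exists_aliases ne2 hY0 (hdeg _)
    refine ⟨t.left, a, a', b, b', ?_, ?_, by rw [hs, ha], by rw [ht, hb, Finset.pair_comm], ha',
      fun hne => hb' hne.symm⟩
    · rw [← h.source_eq, ← h.sink_eq]
      exact t.thru_left.isSimplePath hv
    · rw [← h.darts_eq]
      exact t.thru_left.subset
  have key' : ∀ p a a' b b', G.IsSpinePair μ p a a' b b' →
      ((spineTurns H a p b : ℚ) + (spineTurns H a' p b' : ℚ)) / 2 = K / 2 := by
    intro p a a' b b' hsp
    rw [← key p a a' b b' hsp]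
    push_cast
    rfl
  constructor
  · rintro ⟨-, hall⟩
    obtain ⟨p, a, a', b, b', hsp⟩ := hex
    rw [← hall p a a' b b' hsp, key' p a a' b b' hsp]
  · rintro rfl
    exact ⟨hex, key'⟩

/-- The characterization of the rectilinear representations of a component, provided that the
component can be restricted from and extended to the whole graph. -/
theorem rectilinearPlanar_iff (h : G.Represents μ t) (hv : t.Valid G) (hp : t.Placed G)
    (hdeg : ∀ w, G.degree w ≤ 4) (hrestr : ∀ H : OrthoRep G, ∃ K, t.Realizes G H.ang H.net K)
    (hext : ∀ A B K, t.Realizes G A B K → (∀ d ∈ t.darts G, B d = 0) →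
      ∃ H : OrthoRep G, t.Agree G A B H.ang H.net ∧ ∀ d, H.net d = 0 → H.bends d = [])
    (hc : G.RepresentabilityCondition μ ↔ t.Cond G)
    (hi : G.interval μ = (((t.ivl G).1 : ℚ) / 2, ((t.ivl G).2 : ℚ) / 2)) :
    (G.IsRectilinearPlanar μ ↔ G.RepresentabilityCondition μ) ∧
    (G.RepresentabilityCondition μ →
      ∀ k : ℚ, G.IsRectilinearPlanarWith μ k ↔ G.IsRepresentabilityValue μ k) := by
  have nec : ∀ H : OrthoRep G, H.IsRectilinearOn μ → ∃ K, t.Realizes G H.ang H.net K ∧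
      t.Cond G ∧ (t.ivl G).1 ≤ K ∧ K ≤ (t.ivl G).2 := fun H hH => by
    obtain ⟨K, hK⟩ := hrestr H
    refine ⟨K, hK, hv.cond_of_realizes hp hdeg hK fun d hd => ?_⟩
    rw [h.darts_eq] at hd
    rw [OrthoRep.net, hH d hd]
    rfl
  have suf : t.Cond G → ∀ K : ℤ, (2 : ℤ) ∣ K - t.aliasSum G → (t.ivl G).1 ≤ K →
      K ≤ (t.ivl G).2 → ∃ H : OrthoRep G, H.IsRectilinearOn μ ∧ t.Realizes G H.ang H.net K :=
    fun hC K h1 h2 h3 => by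
    obtain ⟨A, B, hR, hB⟩ := hv.realizes_of_cond hp hdeg hC h1 h2 h3
    obtain ⟨H, hag, hH⟩ := hext A B K hR hB
    refine ⟨H, fun d hd => hH d ?_, hR.congr hv hag⟩
    rw [← h.darts_eq] at hd
    rw [← hag.2 d hd, hB d hd]
  refine ⟨⟨?_, fun hC => ?_⟩, fun hC k => ⟨?_, ?_⟩⟩
  · rintro ⟨H, hH⟩
    obtain ⟨K, -, h1, -⟩ := nec H hH
    exact hc.2 h1
  · have h1 := hv.ivl_of_cond hp hdeg (hc.1 hC)
    obtain ⟨H, hH, -⟩ := suf (hc.1 hC) _ h1.2.1 le_rfl h1.1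
    exact ⟨H, hH⟩
  · rintro ⟨H, hH, hk⟩
    obtain ⟨K, hR, -, h1, h2⟩ := nec H hH
    rw [h.hasSpirality_iff hv hp hdeg hR] at hk
    obtain ⟨z, hz⟩ := hv.two_dvd hp hdeg hR
    refine ⟨?_, z, ?_⟩
    · rw [hi, hk, Set.mem_Icc]
      have h1' : ((t.ivl G).1 : ℚ) ≤ K := by exact_mod_cast h1
      have h2' : (K : ℚ) ≤ (t.ivl G).2 := by exact_mod_cast h2
      constructor <;> dsimp only <;> linarith
    · rw [h.card_aliases hv hp, hk]
      have hz' : (K : ℚ) - t.aliasSum G = 2 * z := by exact_mod_cast hz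
      linarith
  · rintro ⟨hk, z, hz⟩
    rw [h.card_aliases hv hp] at hz
    rw [hi, Set.mem_Icc] at hk
    have hK : k = ((2 * z + t.aliasSum G : ℤ) : ℚ) / 2 := by
      rw [hz]; push_cast; ring
    have h1 : (t.ivl G).1 ≤ 2 * z + t.aliasSum G := by
      have : ((t.ivl G).1 : ℚ) ≤ ((2 * z + t.aliasSum G : ℤ) : ℚ) := by
        have := hk.1; dsimp only at this; linarith
      exact_mod_cast this
    have h2 : 2 * z + t.aliasSum G ≤ (t.ivl G).2 := by
      have : ((2 * z + t.aliasSum G : ℤ) : ℚ) ≤ ((t.ivl G).2 : ℚ) := by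
        have := hk.2; dsimp only at this; linarith
      exact_mod_cast this
    obtain ⟨H, hH, hR⟩ := suf (hc.1 hC) _ (by simp) h1 h2
    exact ⟨H, hH, (h.hasSpirality_iff hv hp hdeg hR k).2 hK⟩

end Represents

end PlaneGraph

namespace SPTerm

variable {V D : Type*} [Fintype V] [DecidableEq V] [Fintype D] [DecidableEq D]
  {G : PlaneGraph V D}

theorem Sub.trans {r s t : SPTerm D} (h : Sub r s) (h' : Sub s t) : Sub r t := by
  induction h' with
  | refl => exact h
  | serLeft b _ ih => exact .serLeft b ih
  | serRight a _ ih => exact .serRight a ih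
  | parLeft b _ ih => exact .parLeft b ih
  | parRight a _ ih => exact .parRight a ih

/-! ### Series compositions of several terms -/

/-- The series composition of a nonempty family of terms. -/
def serFin : (n : ℕ) → (Fin (n + 1) → SPTerm D) → SPTerm D
  | 0, f => f 0
  | n + 1, f => ser (f 0) (serFin n fun i => f i.succ)

theorem src_serFin (n : ℕ) (f : Fin (n + 1) → SPTerm D) : (serFin n f).src G = (f 0).src G := by
  cases n <;> rfl

theorem srcFan_serFin (n : ℕ) (f : Fin (n + 1) → SPTerm D) :
    (serFin n f).srcFan = (f 0).srcFan := by
  cases n <;> rfl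

theorem snk_serFin (n : ℕ) (f : Fin (n + 1) → SPTerm D) :
    (serFin n f).snk G = (f (Fin.last n)).snk G := by
  induction n with
  | zero => rfl
  | succ n ih => exact ih _

theorem snkFan_serFin (n : ℕ) (f : Fin (n + 1) → SPTerm D) :
    (serFin n f).snkFan G = (f (Fin.last n)).snkFan G := by
  induction n with
  | zero => rfl
  | succ n ih => exact ih _

theorem mem_darts_serFin (n : ℕ) (f : Fin (n + 1) → SPTerm D) (d : D) :
    d ∈ (serFin n f).darts G ↔ ∃ i, d ∈ (f i).darts G := by
  induction n with
  | zero => rw [Fin.exists_fin_one]; rfl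
  | succ n ih => rw [serFin, darts, Finset.mem_union, ih, Fin.exists_fin_succ (n := n + 1)]

theorem sub_serFin (n : ℕ) (f : Fin (n + 1) → SPTerm D) (i : Fin (n + 1)) :
    Sub (f i) (serFin n f) := by
  induction n with
  | zero => rw [Fin.fin_one_eq_zero i]; exact .refl _
  | succ n ih =>
    refine Fin.cases ?_ (fun i => ?_) i
    · exact .serLeft _ (.refl _)
    · exact .serRight _ (ih (fun i => f i.succ) i)

theorem valid_serFin (n : ℕ) (f : Fin (n + 1) → SPTerm D) (hv : ∀ i, (f i).Valid G)
    (hj : ∀ i : Fin n, (f i.castSucc).snk G = (f i.succ).src G ∧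
      G.IsRotationAt ((f i.castSucc).snk G)
        ((f i.castSucc).snkFan G ++ (f i.succ).srcFan.reverse))
    (hd : ∀ i j, i < j → Disjoint ((f i).darts G) ((f j).darts G) ∧
      ∀ w ∈ (f i).verts G, w ∈ (f j).verts G → w = (f i).snk G) : (serFin n f).Valid G := by
  induction n with
  | zero => exact hv 0
  | succ n ih =>
    refine ⟨hv 0, ih _ (fun i => hv i.succ) (fun i => ?_) (fun i j hij => ?_), ?_, ?_, ?_, ?_⟩
    · have := hj i.succ
      rwa [← Fin.succ_castSucc] at this
    · exact hd i.succ j.succ (Fin.succ_lt_succ_iff.2 hij)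
    · rw [src_serFin]; exact (hj 0).1
    · rw [srcFan_serFin]; exact (hj 0).2
    · rw [Finset.disjoint_left]
      intro d h0 h1
      rw [mem_darts_serFin] at h1
      obtain ⟨i, hi⟩ := h1
      exact Finset.disjoint_left.1 (hd 0 i.succ (Fin.succ_pos i)).1 h0 hi
    · intro w h0 h1
      obtain ⟨d, hd', rfl⟩ := Finset.mem_image.1 h1
      rw [mem_darts_serFin] at hd'
      obtain ⟨i, hi⟩ := hd'
      exact (hd 0 i.succ (Fin.succ_pos i)).2 _ h0 (org_mem_verts hi)

theorem cond_serFin (n : ℕ) (f : Fin (n + 1) → SPTerm D) :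
    (serFin n f).Cond G ↔ ∀ i, (f i).Cond G := by
  induction n with
  | zero => rw [Fin.forall_fin_one]; rfl
  | succ n ih => rw [serFin, Cond, ih, Fin.forall_fin_succ (n := n + 1)]

theorem ivl_serFin (n : ℕ) (f : Fin (n + 1) → SPTerm D)
    (h : ∀ i : Fin n, serSlack G (f i.castSucc) (f i.succ) = 0) :
    (serFin n f).ivl G = (∑ i, ((f i).ivl G).1, ∑ i, ((f i).ivl G).2) := by
  induction n with
  | zero => simp [serFin]
  | succ n ih =>
    have h0 : serSlack G (f 0) (serFin n fun i => f i.succ) = 0 := by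
      rw [serSlack, srcFan_serFin]; exact h 0
    have := ih (fun i => f i.succ) fun i => by
      have := h i.succ
      rwa [← Fin.succ_castSucc] at this
    rw [serFin, ivl, h0, this, Fin.sum_univ_succ (fun i => ((f i).ivl G).1),
      Fin.sum_univ_succ (fun i => ((f i).ivl G).2), sub_zero, add_zero]

/-! ### Chains of edges -/

/-- The series composition of the edges of a path. -/
def chain (G : PlaneGraph V D) : List D → SPTerm D
  | [] => edge G.outer
  | [d] => edge d
  | d :: d' :: p => ser (edge d) (chain G (d' :: p))

theorem src_chain (d : D) (p : List D) : (chain G (d :: p)).src G = G.org d := by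
  cases p <;> rfl

theorem srcFan_chain (d : D) (p : List D) : (chain G (d :: p)).srcFan = [d] := by
  cases p <;> rfl

theorem snk_chain {p : List D} {v : V}
    (h : (p.map fun d => G.org (G.rev d)).getLast? = some v) : (chain G p).snk G = v := by
  induction p with
  | nil => simp at h
  | cons d p ih =>
    cases p with
    | nil => simpa [chain, snk] using h
    | cons d' p => exact ih (by simpa using h)

theorem snkFan_chain {p : List D} (h : p ≠ []) :
    (chain G p).snkFan G = (p.getLast?.map G.rev).toList := by
  induction p with
  | nil => exact absurd rfl h
  | cons d p ih =>
    cases p with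
    | nil => rfl
    | cons d' p => rw [List.getLast?_cons_cons]; exact ih (by simp)

theorem mem_darts_chain {p : List D} (h : p ≠ []) (d : D) :
    d ∈ (chain G p).darts G ↔ d ∈ p ∨ d ∈ p.map G.rev := by
  induction p with
  | nil => exact absurd rfl h
  | cons e p ih =>
    cases p with
    | nil => simp [chain, darts]
    | cons e' p =>
      rw [chain, darts, Finset.mem_union, ih (by simp)]
      simp [darts]
      tauto

theorem map_target_eq_tail {p : List D} {v : V}
    (hc : List.IsChain (fun d d' => G.org (G.rev d) = G.org d') p)
    (hl : (p.map fun d => G.org (G.rev d)).getLast? = some v) :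
    (p.map fun d => G.org (G.rev d)) = (p.map G.org ++ [v]).tail := by
  induction p with
  | nil => simp at hl
  | cons d p ih =>
    cases p with
    | nil => simpa using hl
    | cons d' p =>
      rw [List.isChain_cons_cons] at hc
      rw [List.map_cons, ih hc.2 (by simpa using hl), hc.1]
      simp

theorem mem_of_mem_verts_chain {p : List D} (h : p ≠ []) {v : V}
    (hc : List.IsChain (fun d d' => G.org (G.rev d) = G.org d') p)
    (hl : (p.map fun d => G.org (G.rev d)).getLast? = some v) {w : V}
    (hw : w ∈ (chain G p).verts G) : w ∈ p.map G.org ++ [v] := by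
  obtain ⟨d, hd, rfl⟩ := Finset.mem_image.1 hw
  rw [mem_darts_chain h, List.mem_map] at hd
  rcases hd with hd | ⟨x, hx, rfl⟩
  · exact List.mem_append_left _ (List.mem_map_of_mem hd)
  · apply List.mem_of_mem_tail
    rw [← map_target_eq_tail hc hl]
    exact List.mem_map_of_mem (f := fun d => G.org (G.rev d)) hx

theorem valid_chain {p : List D} (h : p ≠ []) {v : V}
    (hc : List.IsChain (fun d d' => G.org (G.rev d) = G.org d') p)
    (hl : (p.map fun d => G.org (G.rev d)).getLast? = some v)
    (hn : (p.map G.org ++ [v]).Nodup)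
    (hr : List.IsChain (fun d d' => G.IsRotationAt (G.org d') [G.rev d, d']) p) :
    (chain G p).Valid G := by
  induction p with
  | nil => exact absurd rfl h
  | cons d p ih =>
    cases p with
    | nil =>
      have h1 : G.org (G.rev d) = v := by simpa using hl
      have h2 : ¬ G.org d = v := by simpa using hn
      show G.org d ≠ G.org (G.rev d)
      rw [h1]; exact h2
    | cons d' p =>
      rw [List.isChain_cons_cons] at hc hr
      have hl' : ((d' :: p).map fun d => G.org (G.rev d)).getLast? = some v := by simpa using hl
      rw [List.map_cons, List.cons_append, List.nodup_cons] at hn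
      have hdv : G.org d ∉ (chain G (d' :: p)).verts G := fun hm =>
        hn.1 (mem_of_mem_verts_chain (by simp) hc.2 hl' hm)
      refine ⟨fun e => hn.1 ?_, ih (by simp) hc.2 hl' hn.2 hr.2, ?_, ?_, ?_, ?_⟩
      · rw [e, hc.1]; simp
      · rw [src_chain]; exact hc.1
      · rw [srcFan_chain]
        show G.IsRotationAt (G.org (G.rev d)) [G.rev d, d']
        rw [hc.1]; exact hr.1
      · rw [Finset.disjoint_left]
        intro x hx hx'
        simp only [darts, Finset.mem_insert, Finset.mem_singleton] at hx
        rcases hx with rfl | rfl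
        · exact hdv (org_mem_verts hx')
        · have := rev_mem_darts hx'
          rw [G.rev_rev] at this
          exact hdv (org_mem_verts this)
      · intro w hw hw'
        simp only [verts, darts, Finset.image_insert, Finset.image_singleton, Finset.mem_insert,
          Finset.mem_singleton] at hw
        rcases hw with rfl | rfl
        · exact absurd hw' hdv
        · rfl

theorem cond_chain (p : List D) : (chain G p).Cond G := by
  induction p with
  | nil => trivial
  | cons d p ih =>
    cases p with
    | nil => trivial
    | cons d' p => exact ⟨trivial, ih⟩

theorem ivl_chain (d : D) (p : List D) :
    (chain G (d :: p)).ivl G = (-(2 * p.length : ℤ), (2 * p.length : ℤ)) := by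
  induction p generalizing d with
  | nil => simp [chain, ivl]
  | cons d' p ih =>
    have : serSlack G (edge d) (chain G (d' :: p)) = 2 := by
      simp [serSlack, srcFan_chain, snkFan]
    rw [chain, ivl, ih, this]
    simp [ivl]
    constructor <;> ring

end SPTerm

namespace PlaneGraph

open SPTerm

variable {V D : Type*} [Fintype V] [DecidableEq V] [Fintype D] [DecidableEq D]
  {G : PlaneGraph V D}

theorem isRotationAt_pair {a b : D} {w : V} (hab : a ≠ b)
    (h : ∀ d, d = a ∨ d = b ↔ G.org d = w) : G.IsRotationAt w [a, b] := by
  have ha := (h a).1 (Or.inl rfl)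
  have hb := (h b).1 (Or.inr rfl)
  have hs := G.sameCycle_of_org_eq a b (ha.trans hb.symm)
  have h1 : G.rot a = b := by
    refine ((h _).2 (by rw [G.org_rot, ha])).resolve_left fun e => hab ?_
    exact hs.eq_of_left e
  have h2 : G.rot b = a := by
    refine ((h _).2 (by rw [G.org_rot, hb])).resolve_right fun e => hab ?_
    exact (hs.symm.eq_of_left e).symm
  refine ⟨by simp [hab], fun d => by rw [← h d]; simp, ?_⟩
  simp [ClosedUnder, h1, h2]

theorem isChain_of_split {R : D → D → Prop} {p : List D}
    (h : ∀ l d d' m, p = l ++ d :: d' :: m → R d d') : List.IsChain R p := by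
  induction p with
  | nil => simp
  | cons x p ih =>
    cases p with
    | nil => simp
    | cons y p =>
      rw [List.isChain_cons_cons]
      exact ⟨h [] x y p rfl, ih fun l d d' m e => h (x :: l) d d' m (by rw [e]; rfl)⟩

/-- All darts that leave a vertex of the pertinent graph of `μ` other than its poles belong to
this graph. -/
def IsClosedNode (G : PlaneGraph V D) (μ : SPQTree V D) : Prop :=
  ∀ x, G.org x ∈ G.verts μ → G.org x ≠ μ.source → G.org x ≠ μ.sink → x ∈ G.darts μ

theorem IsSimplePath.isChain_isRotationAt {u v : V} {p : List D} (h : G.IsSimplePath u v p)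
    (hcl : G.IsClosedNode (.Q u v p)) :
    List.IsChain (fun d d' => G.IsRotationAt (G.org d') [G.rev d, d']) p := by
  obtain ⟨h1, h2, h3, h4⟩ := h
  have ho := List.inj_on_of_nodup_map (List.nodup_append.1 h4).1
  have ht : (p.map fun d => G.org (G.rev d)).Nodup := by
    rw [map_target_eq_tail h3 h2]; exact h4.tail
  have ht' := List.inj_on_of_nodup_map ht
  refine isChain_of_split fun l d d' m e => ?_
  have hd : d ∈ p := by simp [e]
  have hd' : d' ∈ p := by simp [e]
  have hdd : G.org (G.rev d) = G.org d' := by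
    rw [e] at h3
    exact (List.isChain_cons_cons.1 (List.isChain_append.1 h3).2.1).1
  have hnd : p.Nodup := List.Nodup.of_map _ (List.nodup_append.1 h4).1
  have hu : G.org d' ≠ u := by
    intro hu
    cases p with
    | nil => simp at hd
    | cons x q =>
      have hx : G.org x = u := by simpa using h1
      have : d' = x := ho hd' (by simp) (hu.trans hx.symm)
      subst this
      cases l with
      | nil =>
        simp only [List.nil_append, List.cons.injEq] at e
        rw [e.2, List.nodup_cons] at hnd
        exact hnd.1 (by simp)
      | cons y l =>
        simp only [List.cons_append, List.cons.injEq] at e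
        rw [e.2] at hnd
        simp at hnd
  have hv : G.org d' ≠ v := (List.nodup_append.1 h4).2.2 _ (List.mem_map_of_mem hd') v (by simp)
  refine isRotationAt_pair ?_ fun x => ⟨?_, fun hx => ?_⟩
  · intro hr
    have e1 : G.org (G.rev d') = G.org d := by rw [← hr, G.rev_rev]
    rw [e] at h2 h4 h3
    rw [List.map_append, List.append_assoc, List.nodup_append] at h4
    have h5 := h4.2.1
    simp only [List.map_cons, List.cons_append, List.nodup_cons] at h5
    have h3' := (List.isChain_cons_cons.1 (List.isChain_append.1 h3).2.1).2
    rw [List.map_append, List.getLast?_append_of_ne_nil _ (by simp)] at h2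
    have h6 := map_target_eq_tail (G := G) (p := d' :: m) h3' (by simpa using h2)
    apply h5.1
    refine List.mem_cons_of_mem _ ?_
    have : G.org (G.rev d') ∈ (List.map G.org (d' :: m) ++ [v]).tail := by
      rw [← h6]; simp
    rw [e1] at this
    simpa using this
  · rintro (rfl | rfl)
    · exact hdd
    · rfl
  · have hm : G.org x ∈ G.verts (.Q u v p) := by
      rw [hx]
      exact Finset.mem_image_of_mem _ (by simp [darts, hd'])
    have := hcl x hm (hx ▸ hu) (hx ▸ hv)
    simp only [darts, Finset.mem_union, List.mem_toFinset, List.mem_map] at this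
    rcases this with hxp | ⟨y, hy, rfl⟩
    · exact Or.inr (ho hxp hd' hx)
    · exact Or.inl (congrArg G.rev (ht' hy hd (hx.trans hdd.symm)))

/-- The term that belongs to a decomposition tree. -/
def toTerm (G : PlaneGraph V D) : SPQTree V D → SPTerm D
  | .Q _ _ p => chain G p
  | .S _ _ n c => serFin (n + 1) fun i => G.toTerm (c i)
  | .P2 _ _ l r => par (G.toTerm l) (G.toTerm r)
  | .P3 _ _ l m r => par (par (G.toTerm l) (G.toTerm m)) (G.toTerm r)

theorem IsDecomposition.represents {μ : SPQTree V D} (h : G.IsDecomposition μ) :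
    G.Represents μ (G.toTerm μ) := by
  induction μ with
  | Q u v p =>
    obtain ⟨h1, h2, h3, h4⟩ := h
    have hne : p ≠ [] := by rintro rfl; simp at h1
    refine ⟨?_, snk_chain h2, ?_, ?_, snkFan_chain hne⟩
    · cases p with
      | nil => simp at h1
      | cons d p => simpa [toTerm, src_chain, SPQTree.source] using h1
    · ext d
      rw [toTerm, mem_darts_chain hne]
      simp [darts]
    · cases p with
      | nil => simp at h1
      | cons d p => exact srcFan_chain d p
  | S u v n c ih =>
    rw [IsDecomposition] at h
    obtain ⟨h1, h2, h3, -⟩ := h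
    refine ⟨?_, ?_, ?_, ?_, ?_⟩
    · rw [toTerm, src_serFin, (ih 0 (h1 0)).source_eq, h2]; rfl
    · rw [toTerm, snk_serFin, (ih _ (h1 _)).sink_eq, h3]; rfl
    · ext d
      rw [toTerm, mem_darts_serFin, darts]
      simp [(ih _ (h1 _)).darts_eq]
    · rw [toTerm, srcFan_serFin, (ih 0 (h1 0)).sourceFan_eq, sourceFan]
    · rw [toTerm, snkFan_serFin, (ih _ (h1 _)).sinkFan_eq, sinkFan]
  | P2 u v l r ihl ihr =>
    rw [IsDecomposition] at h
    obtain ⟨hl, hr, el, er, -⟩ := h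
    have il := ihl hl
    have ir := ihr hr
    exact ⟨by rw [toTerm, src, il.source_eq, el.1]; rfl, by rw [toTerm, snk, il.sink_eq, el.2]; rfl,
      by rw [toTerm, SPTerm.darts, il.darts_eq, ir.darts_eq, PlaneGraph.darts],
      by rw [toTerm, srcFan, il.sourceFan_eq, ir.sourceFan_eq, sourceFan],
      by rw [toTerm, snkFan, il.sinkFan_eq, ir.sinkFan_eq, sinkFan]⟩
  | P3 u v l m r ihl ihm ihr =>
    rw [IsDecomposition] at h
    obtain ⟨hl, hm, hr, el, em, er, -⟩ := h
    have il := ihl hl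
    have im := ihm hm
    have ir := ihr hr
    exact ⟨by rw [toTerm, src, src, il.source_eq, el.1]; rfl,
      by rw [toTerm, snk, snk, il.sink_eq, el.2]; rfl,
      by rw [toTerm, SPTerm.darts, SPTerm.darts, il.darts_eq, im.darts_eq, ir.darts_eq,
        PlaneGraph.darts],
      by rw [toTerm, srcFan, srcFan, il.sourceFan_eq, im.sourceFan_eq, ir.sourceFan_eq, sourceFan],
      by rw [toTerm, snkFan, snkFan, il.sinkFan_eq, im.sinkFan_eq, ir.sinkFan_eq, sinkFan]⟩

theorem IsDecomposition.source_mem {μ : SPQTree V D} (h : G.IsDecomposition μ) :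
    μ.source ∈ G.verts μ := by
  rw [← h.represents.source_eq, ← h.represents.verts_eq]
  exact src_mem_verts _

theorem IsDecomposition.sink_mem {μ : SPQTree V D} (h : G.IsDecomposition μ) :
    μ.sink ∈ G.verts μ := by
  rw [← h.represents.sink_eq, ← h.represents.verts_eq]
  exact snk_mem_verts _

theorem verts_mono {μ μ' : SPQTree V D} (h : G.darts μ ⊆ G.darts μ') : G.verts μ ⊆ G.verts μ' :=
  Finset.image_subset_image h

theorem org_mem_verts {μ : SPQTree V D} {x : D} (h : x ∈ G.darts μ) : G.org x ∈ G.verts μ :=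
  Finset.mem_image_of_mem _ h

theorem IsDecomposition.child {μ ν : SPQTree V D} (h : G.IsDecomposition μ)
    (hc : G.IsClosedNode μ) (hν : SPQTree.IsChild ν μ) :
    G.IsDecomposition ν ∧ G.IsClosedNode ν := by
  cases hν with
  | series u v n c i =>
    rw [IsDecomposition] at h
    obtain ⟨h1, h2, h3, h4, h5, h6⟩ := h
    refine ⟨h1 i, fun x hx hs ht => ?_⟩
    have hsub : G.darts (c i) ⊆ G.darts (.S u v n c) := by
      rw [darts]
      exact Finset.subset_biUnion_of_mem (fun i => G.darts (c i)) (Finset.mem_univ i)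
    have key : ∀ j, G.org x ∈ G.verts (c j) → j = i := fun j hj => by
      rcases lt_trichotomy i j with hij | rfl | hij
      · exact absurd ((h6 i j hij).2 _ (Finset.mem_inter.2 ⟨hx, hj⟩)).2 ht
      · rfl
      · obtain ⟨e1, e2⟩ := (h6 j i hij).2 _ (Finset.mem_inter.2 ⟨hj, hx⟩)
        have hjn : (j : ℕ) < n + 1 := by have := i.2; omega
        have a1 : (⟨j, hjn⟩ : Fin (n + 1)).castSucc = j := rfl
        have a2 : (⟨j, hjn⟩ : Fin (n + 1)).succ = i := Fin.ext (by simp [e1])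
        have := (h4 ⟨j, hjn⟩).1
        rw [a1, a2] at this
        exact absurd (e2.trans this) hs
    have hxS : x ∈ G.darts (.S u v n c) := by
      refine hc x (verts_mono hsub hx) (fun e => ?_) (fun e => ?_)
      · have e' : G.org x = (c 0).source := e.trans h2.symm
        have := key 0 (e' ▸ (h1 0).source_mem)
        rw [this] at e'
        exact hs e'
      · have e' : G.org x = (c (Fin.last (n + 1))).sink := e.trans h3.symm
        have := key _ (e' ▸ (h1 _).sink_mem)
        rw [this] at e'
        exact ht e'
    rw [darts, Finset.mem_biUnion] at hxS
    obtain ⟨j, -, hj⟩ := hxS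
    rwa [key j (org_mem_verts hj)] at hj
  | left2 u v l r =>
    rw [IsDecomposition] at h
    obtain ⟨hl, hr, el, er, -, -, hd⟩ := h
    refine ⟨hl, fun x hx hs ht => ?_⟩
    rw [el.1] at hs
    rw [el.2] at ht
    have := hc x (verts_mono (by rw [darts]; exact Finset.subset_union_left) hx) hs ht
    rw [darts, Finset.mem_union] at this
    refine this.resolve_right fun h1 => ?_
    exact (hd.2 _ (Finset.mem_inter.2 ⟨hx, org_mem_verts h1⟩)).elim hs ht
  | right2 u v l r =>
    rw [IsDecomposition] at h
    obtain ⟨hl, hr, el, er, -, -, hd⟩ := h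
    refine ⟨hr, fun x hx hs ht => ?_⟩
    rw [er.1] at hs
    rw [er.2] at ht
    have := hc x (verts_mono (by rw [darts]; exact Finset.subset_union_right) hx) hs ht
    rw [darts, Finset.mem_union] at this
    refine this.resolve_left fun h1 => ?_
    exact (hd.2 _ (Finset.mem_inter.2 ⟨org_mem_verts h1, hx⟩)).elim hs ht
  | left3 u v l m r =>
    rw [IsDecomposition] at h
    obtain ⟨hl, hm, hr, el, em, er, -, -, -, dlm, dmr, dlr⟩ := h
    refine ⟨hl, fun x hx hs ht => ?_⟩
    rw [el.1] at hs
    rw [el.2] at ht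
    have := hc x (verts_mono (by
      rw [darts]; exact Finset.subset_union_left.trans Finset.subset_union_left) hx) hs ht
    rw [darts, Finset.mem_union, Finset.mem_union] at this
    rcases this with (h1 | h1) | h1
    · exact h1
    · exact ((dlm.2 _ (Finset.mem_inter.2 ⟨hx, org_mem_verts h1⟩)).elim hs ht).elim
    · exact ((dlr.2 _ (Finset.mem_inter.2 ⟨hx, org_mem_verts h1⟩)).elim hs ht).elim
  | mid3 u v l m r =>
    rw [IsDecomposition] at h
    obtain ⟨hl, hm, hr, el, em, er, -, -, -, dlm, dmr, dlr⟩ := h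
    refine ⟨hm, fun x hx hs ht => ?_⟩
    rw [em.1] at hs
    rw [em.2] at ht
    have := hc x (verts_mono (by
      rw [darts]; exact Finset.subset_union_right.trans Finset.subset_union_left) hx) hs ht
    rw [darts, Finset.mem_union, Finset.mem_union] at this
    rcases this with (h1 | h1) | h1
    · exact ((dlm.2 _ (Finset.mem_inter.2 ⟨org_mem_verts h1, hx⟩)).elim hs ht).elim
    · exact h1
    · exact ((dmr.2 _ (Finset.mem_inter.2 ⟨hx, org_mem_verts h1⟩)).elim hs ht).elim
  | right3 u v l m r =>
    rw [IsDecomposition] at h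
    obtain ⟨hl, hm, hr, el, em, er, -, -, -, dlm, dmr, dlr⟩ := h
    refine ⟨hr, fun x hx hs ht => ?_⟩
    rw [er.1] at hs
    rw [er.2] at ht
    have := hc x (verts_mono (by rw [darts]; exact Finset.subset_union_right) hx) hs ht
    rw [darts, Finset.mem_union, Finset.mem_union] at this
    rcases this with (h1 | h1) | h1
    · exact ((dlr.2 _ (Finset.mem_inter.2 ⟨org_mem_verts h1, hx⟩)).elim hs ht).elim
    · exact ((dmr.2 _ (Finset.mem_inter.2 ⟨org_mem_verts h1, hx⟩)).elim hs ht).elim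
    · exact h1

theorem sub_toTerm {μ ν : SPQTree V D} (h : SPQTree.IsChild ν μ) :
    Sub (G.toTerm ν) (G.toTerm μ) := by
  cases h with
  | series u v n c i => exact sub_serFin (n + 1) (fun i => G.toTerm (c i)) i
  | left2 u v l r => exact .parLeft _ (.refl _)
  | right2 u v l r => exact .parRight _ (.refl _)
  | left3 u v l m r => exact .parLeft _ (.parLeft _ (.refl _))
  | mid3 u v l m r => exact .parLeft _ (.parRight _ (.refl _))
  | right3 u v l m r => exact .parRight _ (.refl _)

theorem IsDecomposition.descendant {μ ν : SPQTree V D} (h : G.IsDecomposition μ)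
    (hc : G.IsClosedNode μ) (hν : Relation.ReflTransGen SPQTree.IsChild ν μ) :
    G.IsDecomposition ν ∧ G.IsClosedNode ν ∧ Sub (G.toTerm ν) (G.toTerm μ) := by
  induction hν using Relation.ReflTransGen.head_induction_on with
  | refl => exact ⟨h, hc, .refl _⟩
  | head h1 _ ih =>
    obtain ⟨i1, i2, i3⟩ := ih
    obtain ⟨j1, j2⟩ := i1.child i2 h1
    exact ⟨j1, j2, (sub_toTerm h1).trans i3⟩

theorem IsDecomposition.valid {μ : SPQTree V D} (h : G.IsDecomposition μ)
    (hc : G.IsClosedNode μ) : (G.toTerm μ).Valid G := by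
  induction μ with
  | Q u v p =>
    have h' : G.IsSimplePath u v p := h
    obtain ⟨h1, h2, h3, h4⟩ := h
    exact valid_chain (by rintro rfl; simp at h1) h3 h2 h4 (h'.isChain_isRotationAt hc)
  | S u v n c ih =>
    have hch := fun i => h.child hc (.series u v n c i)
    rw [IsDecomposition] at h
    obtain ⟨h1, h2, h3, h4, h5, h6⟩ := h
    refine valid_serFin _ _ (fun i => ih i (hch i).1 (hch i).2) (fun i => ?_) fun i j hij => ?_
    · have r1 := (h1 i.castSucc).represents
      have r2 := (h1 i.succ).represents
      rw [r1.sink_eq, r2.source_eq, r1.sinkFan_eq, r2.sourceFan_eq]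
      exact ⟨(h4 i).1, (h4 i).2.1⟩
    · have r1 := (h1 i).represents
      have r2 := (h1 j).represents
      rw [r1.darts_eq, r2.darts_eq, r1.verts_eq, r2.verts_eq, r1.sink_eq]
      exact ⟨(h6 i j hij).1, fun w hw hw' =>
        ((h6 i j hij).2 w (Finset.mem_inter.2 ⟨hw, hw'⟩)).2⟩
  | P2 u v l r ihl ihr =>
    have c1 := h.child hc (.left2 u v l r)
    have c2 := h.child hc (.right2 u v l r)
    rw [IsDecomposition] at h
    obtain ⟨hl, hr, el, er, -, -, hd⟩ := h
    have r1 := hl.represents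
    have r2 := hr.represents
    refine ⟨ihl c1.1 c1.2, ihr c2.1 c2.2, ?_, ?_, ?_, ?_⟩
    · rw [r1.source_eq, r2.source_eq, el.1, er.1]
    · rw [r1.sink_eq, r2.sink_eq, el.2, er.2]
    · rw [r1.darts_eq, r2.darts_eq]; exact hd.1
    · rw [r1.verts_eq, r2.verts_eq, r1.source_eq, r1.sink_eq, el.1, el.2]
      exact fun w h1 h2 => hd.2 w (Finset.mem_inter.2 ⟨h1, h2⟩)
  | P3 u v l m r ihl ihm ihr =>
    have c1 := h.child hc (.left3 u v l m r)
    have c2 := h.child hc (.mid3 u v l m r)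
    have c3 := h.child hc (.right3 u v l m r)
    rw [IsDecomposition] at h
    obtain ⟨hl, hm, hr, el, em, er, -, -, -, dlm, dmr, dlr⟩ := h
    have r1 := hl.represents
    have r2 := hm.represents
    have r3 := hr.represents
    refine ⟨⟨ihl c1.1 c1.2, ihm c2.1 c2.2, ?_, ?_, ?_, ?_⟩, ihr c3.1 c3.2, ?_, ?_, ?_, ?_⟩
    · rw [r1.source_eq, r2.source_eq, el.1, em.1]
    · rw [r1.sink_eq, r2.sink_eq, el.2, em.2]
    · rw [r1.darts_eq, r2.darts_eq]; exact dlm.1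
    · rw [r1.verts_eq, r2.verts_eq, r1.source_eq, r1.sink_eq, el.1, el.2]
      exact fun w h1 h2 => dlm.2 w (Finset.mem_inter.2 ⟨h1, h2⟩)
    · rw [src, r1.source_eq, r3.source_eq, el.1, er.1]
    · rw [snk, r1.sink_eq, r3.sink_eq, el.2, er.2]
    · rw [SPTerm.darts, r1.darts_eq, r2.darts_eq, r3.darts_eq]
      exact Finset.disjoint_union_left.2 ⟨dlr.1, dmr.1⟩
    · rw [verts_par, r1.verts_eq, r2.verts_eq, r3.verts_eq, src, snk, r1.source_eq, r1.sink_eq,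
        el.1, el.2]
      intro w h1 h2
      rcases Finset.mem_union.1 h1 with h1 | h1
      · exact dlr.2 w (Finset.mem_inter.2 ⟨h1, h2⟩)
      · exact dmr.2 w (Finset.mem_inter.2 ⟨h1, h2⟩)

end PlaneGraph

namespace PlaneGraph

open SPTerm

variable {V D : Type*} [Fintype V] [DecidableEq V] [Fintype D] [DecidableEq D]
  {G : PlaneGraph V D}

/-! ### Representability intervals and conditions -/

theorem max_add_eq_half {p q : ℤ} {x y c : ℚ} (h₁ : 2 * (x + c) = p) (h₂ : 2 * (y + c) = q) :
    max x y + c = ((max p q : ℤ) : ℚ) / 2 := by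
  rw [Int.cast_max, ← h₁, ← h₂, ← mul_max_of_nonneg _ _ (by norm_num : (0 : ℚ) ≤ 2),
    max_add_add_right]
  ring

theorem max_sub_eq_half {p q : ℤ} {x y c : ℚ} (h₁ : 2 * (x - c) = p) (h₂ : 2 * (y - c) = q) :
    max x y - c = ((max p q : ℤ) : ℚ) / 2 := by
  rw [sub_eq_add_neg] at *
  exact max_add_eq_half h₁ h₂

theorem min_sub_eq_half {p q : ℤ} {x y c : ℚ} (h₁ : 2 * (x - c) = p) (h₂ : 2 * (y - c) = q) :
    min x y - c = ((min p q : ℤ) : ℚ) / 2 := by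
  rw [Int.cast_min, ← h₁, ← h₂, ← mul_min_of_nonneg _ _ (by norm_num : (0 : ℚ) ≤ 2),
    min_sub_sub_right]
  ring

theorem icc_inter_icc_nonempty {a b c d : ℚ} (hab : a ≤ b) (hcd : c ≤ d) :
    (Set.Icc a b ∩ Set.Icc c d).Nonempty ↔ c ≤ b ∧ a ≤ d := by
  rw [Set.Icc_inter_Icc, Set.nonempty_Icc, sup_le_iff, le_inf_iff, le_inf_iff]
  tauto

theorem two_le_length_srcFan {μ : SPQTree V D} (hQ : ¬ μ.IsQ) (hS : ¬ μ.IsS) :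
    2 ≤ (G.toTerm μ).srcFan.length := by
  cases μ with
  | Q u v p => exact absurd trivial hQ
  | S u v n c => exact absurd trivial hS
  | P2 u v l r =>
    have := (G.toTerm l).length_srcFan_pos
    have := (G.toTerm r).length_srcFan_pos
    simp only [toTerm, srcFan, List.length_append]
    omega
  | P3 u v l m r =>
    have := (G.toTerm l).length_srcFan_pos
    have := (G.toTerm r).length_srcFan_pos
    simp only [toTerm, srcFan, List.length_append]
    omega

theorem two_le_length_snkFan {μ : SPQTree V D} (hQ : ¬ μ.IsQ) (hS : ¬ μ.IsS) :
    2 ≤ ((G.toTerm μ).snkFan G).length := by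
  cases μ with
  | Q u v p => exact absurd trivial hQ
  | S u v n c => exact absurd trivial hS
  | P2 u v l r =>
    have := (G.toTerm l).length_snkFan_pos G
    have := (G.toTerm r).length_snkFan_pos G
    simp only [toTerm, snkFan, List.length_append]
    omega
  | P3 u v l m r =>
    have := (G.toTerm l).length_snkFan_pos G
    have := (G.toTerm r).length_snkFan_pos G
    simp only [toTerm, snkFan, List.length_append]
    omega

/-- The degrees at the poles of a P-node with two children, in terms of the fans of the
children. -/
theorem IsDecomposition.degrees_P2 {u v : V} {l r : SPQTree V D}
    (h : G.IsDecomposition (.P2 u v l r)) (hv : (G.toTerm (.P2 u v l r)).Valid G)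
    (hp : (G.toTerm (.P2 u v l r)).Placed G) :
    (G.indeg (.P2 u v l r) u = (G.toTerm l).srcFan.length + (G.toTerm r).srcFan.length ∧
      G.outdeg (.P2 u v l r) u = srcOut G (G.toTerm l) (G.toTerm r) ∧
      G.indeg r u = (G.toTerm r).srcFan.length) ∧
    (G.indeg (.P2 u v l r) v = ((G.toTerm l).snkFan G).length + ((G.toTerm r).snkFan G).length ∧
      G.outdeg (.P2 u v l r) v = snkOut G (G.toTerm l) (G.toTerm r) ∧
      G.indeg r v = ((G.toTerm r).snkFan G).length) := by
  have hrep := h.represents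
  rw [IsDecomposition] at h
  obtain ⟨hl, hr, el, er, -⟩ := h
  obtain ⟨⟨X', -, hX'⟩, Y', -, hY'⟩ := Placed.par_right hv hp
  have r1 := hr.represents.source_pole hv.2.1 hX'
  have r2 := hr.represents.sink_pole hv.2.1 hY'
  rw [er.1] at r1
  rw [er.2] at r2
  obtain ⟨X, -, hX, hXl, -⟩ := Placed.exists_src hp
  obtain ⟨Y, -, hY, hYl, -⟩ := Placed.exists_snk hp
  have p1 := hrep.source_pole hv (X := X) (by simpa [toTerm, srcFan, src] using hX)
  have p2 := hrep.sink_pole hv (Y := Y) (by simpa [toTerm, snkFan, snk] using hY)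
  simp only [toTerm, srcFan, snkFan, List.length_append] at p1 p2
  exact ⟨⟨p1.1, p1.2.1.trans hXl, r1.1⟩, p2.1, p2.2.1.trans hYl, r2.1⟩

/-- The interval and the condition of a node are, up to the unit, those of its term. -/
def Corresponds (G : PlaneGraph V D) (μ : SPQTree V D) : Prop :=
  G.interval μ = ((((G.toTerm μ).ivl G).1 : ℚ) / 2, (((G.toTerm μ).ivl G).2 : ℚ) / 2) ∧
    (G.RepresentabilityCondition μ ↔ (G.toTerm μ).Cond G)

theorem IsDecomposition.corresponds_P2 {u v : V} {l r : SPQTree V D}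
    (h : G.IsDecomposition (.P2 u v l r)) (hv : (G.toTerm (.P2 u v l r)).Valid G)
    (hp : (G.toTerm (.P2 u v l r)).Placed G) (hdeg : ∀ w, G.degree w ≤ 4)
    (cl : G.Corresponds l) (cr : G.Corresponds r) : G.Corresponds (.P2 u v l r) := by
  obtain ⟨il, cl⟩ := cl
  obtain ⟨ir, cr⟩ := cr
  obtain ⟨⟨iu, ou, ru⟩, iv, ov, rv⟩ := h.degrees_P2 hv hp
  have hp' : (par (G.toTerm l) (G.toTerm r)).Placed G := hp
  have hv' : (par (G.toTerm l) (G.toTerm r)).Valid G := hv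
  obtain ⟨-, -, -, -, hXd⟩ := hp'.exists_src
  obtain ⟨-, -, -, -, hYd⟩ := hp'.exists_snk
  have hdu := hdeg ((G.toTerm l).src G)
  have hdv := hdeg ((G.toTerm l).snk G)
  have ml : (G.toTerm l).Cond G → ((G.toTerm l).ivl G).1 ≤ ((G.toTerm l).ivl G).2 := fun hc =>
    (hv'.1.ivl_of_cond hp'.par_left hdeg hc).1
  have mr : (G.toTerm r).Cond G → ((G.toTerm r).ivl G).1 ≤ ((G.toTerm r).ivl G).2 := fun hc =>
    (hv'.2.1.ivl_of_cond (hp'.par_right hv') hdeg hc).1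
  have su := size_cases (G.toTerm l).length_srcFan_pos (G.toTerm r).length_srcFan_pos
    hp'.srcOut_pos (by omega)
  have sv := size_cases ((G.toTerm l).length_snkFan_pos G) ((G.toTerm r).length_snkFan_pos G)
    hp'.snkOut_pos (by omega)
  rw [Corresponds, interval, RepresentabilityCondition, toTerm, ivl, Cond, il, ir, cl, cr]
  simp only [IsType2, IsType3dd, gamma, rho, SPQTree.source, SPQTree.sink, iu, ou, ru, iv, ov, rv,
    offsetLeft, offsetRight, parSlack]
  generalize ((G.toTerm l).ivl G).1 = a at *
  generalize ((G.toTerm l).ivl G).2 = b at *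
  generalize ((G.toTerm r).ivl G).1 = c at *
  generalize ((G.toTerm r).ivl G).2 = d at *
  rcases su with ⟨e1, e2, e3⟩ | ⟨e1, e2, e3⟩ | ⟨e1, e2, e3⟩ | ⟨e1, e2, e3⟩ <;>
  rcases sv with ⟨f1, f2, f3⟩ | ⟨f1, f2, f3⟩ | ⟨f1, f2, f3⟩ | ⟨f1, f2, f3⟩ <;>
  · simp only [e1, e2, e3, f1, f2, f3, baseOffset, slack]
    norm_num only [and_self, and_true, true_and, and_false, false_and, if_true, if_false]
    try simp only [ru, rv, e2, f2]
    refine ⟨Prod.ext ?_ ?_, and_congr_right fun hl => and_congr_right fun hr => ?_⟩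
    · first
      | exact max_add_eq_half (by push_cast; norm_num; try ring) (by push_cast; norm_num; try ring)
      | exact max_sub_eq_half (by push_cast; norm_num; try ring) (by push_cast; norm_num; try ring)
    · exact min_sub_eq_half (by push_cast; norm_num; try ring) (by push_cast; norm_num; try ring)
    · have hab := ml hl
      have hcd := mr hr
      qify at hab hcd ⊢
      first
      | rw [icc_inter_icc_nonempty (by linarith) (by norm_num)]
      | rw [Set.mem_Icc]
      constructor <;> rintro ⟨h₁, h₂⟩ <;> constructor <;> linarith

end PlaneGraph

namespace PlaneGraph

open SPTerm

variable {V D : Type*} [Fintype V] [DecidableEq V] [Fintype D] [DecidableEq D]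
  {G : PlaneGraph V D}

theorem icc_inter_icc_inter_icc_nonempty {a b c d e f : ℚ} (hab : a ≤ b) (hcd : c ≤ d)
    (hef : e ≤ f) : (Set.Icc a b ∩ Set.Icc c d ∩ Set.Icc e f).Nonempty ↔
      (c ≤ b ∧ a ≤ d) ∧ (e ≤ b ∧ e ≤ d) ∧ a ≤ f ∧ c ≤ f := by
  rw [Set.Icc_inter_Icc, Set.Icc_inter_Icc, Set.nonempty_Icc]
  simp only [sup_le_iff, le_inf_iff]
  tauto

theorem offsets_par_par {a b c : SPTerm D} (hp : (par (par a b) c).Placed G)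
    (hdeg : ∀ w, G.degree w ≤ 4) :
    (offsetLeft G a b = 2 ∧ offsetRight G a b = 2 ∧ parSlack G a b = 0) ∧
    offsetLeft G (par a b) c = 2 ∧ offsetRight G (par a b) c = 4 ∧ parSlack G (par a b) c = 0 := by
  obtain ⟨-, -, -, -, hX⟩ := hp.exists_src
  obtain ⟨-, -, -, -, hY⟩ := hp.exists_snk
  have h1 := hp.srcOut_pos
  have h2 := hp.snkOut_pos
  have hu := hdeg (a.src G)
  have hv := hdeg (a.snk G)
  have := a.length_srcFan_pos
  have := b.length_srcFan_pos
  have := c.length_srcFan_pos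
  have := a.length_snkFan_pos G
  have := b.length_snkFan_pos G
  have := c.length_snkFan_pos G
  simp only [srcFan, snkFan, src, snk, List.length_append] at hX hY
  have e1 : a.srcFan.length = 1 := by omega
  have e2 : b.srcFan.length = 1 := by omega
  have e3 : c.srcFan.length = 1 := by omega
  have e4 : srcOut G (par a b) c = 1 := by omega
  have e5 : srcOut G a b = 2 := by unfold srcOut; omega
  have f1 : (a.snkFan G).length = 1 := by omega
  have f2 : (b.snkFan G).length = 1 := by omega
  have f3 : (c.snkFan G).length = 1 := by omega
  have f4 : snkOut G (par a b) c = 1 := by omega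
  have f5 : snkOut G a b = 2 := by unfold snkOut; omega
  simp [offsetLeft, offsetRight, parSlack, srcFan, snkFan, e1, e2, e3, e4, e5, f1, f2, f3, f4, f5,
    baseOffset, slack]

theorem corresponds_P3 {u v : V} {l m r : SPQTree V D}
    (hv : (G.toTerm (.P3 u v l m r)).Valid G) (hp : (G.toTerm (.P3 u v l m r)).Placed G)
    (hdeg : ∀ w, G.degree w ≤ 4) (cl : G.Corresponds l) (cm : G.Corresponds m)
    (cr : G.Corresponds r) : G.Corresponds (.P3 u v l m r) := by
  obtain ⟨il, cl⟩ := cl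
  obtain ⟨im, cm⟩ := cm
  obtain ⟨ir, cr⟩ := cr
  have hmono : ∀ s, Sub s (G.toTerm (.P3 u v l m r)) → s.Cond G → (s.ivl G).1 ≤ (s.ivl G).2 :=
    fun s hs hc => ((hs.valid_placed hv hp).1.ivl_of_cond (hs.valid_placed hv hp).2 hdeg hc).1
  have ml := hmono _ (sub_toTerm (.left3 u v l m r))
  have mm := hmono _ (sub_toTerm (.mid3 u v l m r))
  have mr := hmono _ (sub_toTerm (.right3 u v l m r))
  obtain ⟨⟨e1, e2, e3⟩, e4, e5, e6⟩ := offsets_par_par hp hdeg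
  rw [Corresponds, interval, RepresentabilityCondition, toTerm]
  simp only [ivl, Cond, il, im, ir, cl, cm, cr, e1, e2, e3, e4, e5, e6]
  generalize ((G.toTerm l).ivl G).1 = a at *
  generalize ((G.toTerm l).ivl G).2 = b at *
  generalize ((G.toTerm m).ivl G).1 = c at *
  generalize ((G.toTerm m).ivl G).2 = d at *
  generalize ((G.toTerm r).ivl G).1 = x at *
  generalize ((G.toTerm r).ivl G).2 = y at *
  have k1 : max ((a : ℚ) / 2 - 2) (c / 2) + 1 = ((max (a - 2 - 2 * 0) (c + 2) : ℤ) : ℚ) / 2 :=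
    max_add_eq_half (by push_cast; ring) (by push_cast; ring)
  have k2 : min ((b : ℚ) / 2 - 2) (d / 2) - (-1) = ((min (b - 2) (d + 2 + 2 * 0) : ℤ) : ℚ) / 2 :=
    min_sub_eq_half (by push_cast; ring) (by push_cast; ring)
  refine ⟨Prod.ext ?_ ?_, ?_⟩
  · rw [← add_zero (max _ _)]
    refine max_add_eq_half ?_ (by push_cast; ring)
    push_cast at k1 ⊢
    linarith
  · rw [← sub_zero (min _ _)]
    refine min_sub_eq_half ?_ (by push_cast; ring)
    push_cast at k2 ⊢
    linarith
  · constructor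
    · rintro ⟨h1, h2, h3, h4⟩
      have q1 := ml h1
      have q2 := mm h2
      have q3 := mr h3
      qify at q1 q2 q3
      rw [icc_inter_icc_inter_icc_nonempty (by linarith) (by linarith) (by linarith)] at h4
      obtain ⟨⟨h4, h5⟩, ⟨h6, h7⟩, h8, h9⟩ := h4
      have h4 : c + 4 ≤ b := by qify; linarith
      have h5 : a ≤ d + 4 := by qify; linarith
      have h6 : x + 8 ≤ b := by qify; linarith
      have h7 : x + 4 ≤ d := by qify; linarith
      have h8 : a ≤ y + 8 := by qify; linarith
      have h9 : c ≤ y + 4 := by qify; linarith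
      refine ⟨⟨h1, h2, ?_⟩, h3, ?_⟩ <;> omega
    · rintro ⟨⟨h1, h2, h4, h5⟩, h3, h6, h7⟩
      have q1 := ml h1
      have q2 := mm h2
      have q3 := mr h3
      have r1 : x + 8 ≤ b := by omega
      have r2 : x + 4 ≤ d := by omega
      have r3 : a ≤ y + 8 := by omega
      have r4 : c ≤ y + 4 := by omega
      qify at q1 q2 q3 h4 h5 r1 r2 r3 r4
      refine ⟨h1, h2, h3, ?_⟩
      rw [icc_inter_icc_inter_icc_nonempty (by linarith) (by linarith) (by linarith)]
      refine ⟨⟨?_, ?_⟩, ⟨?_, ?_⟩, ?_, ?_⟩ <;> linarith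

theorem IsDecomposition.corresponds {μ : SPQTree V D} (h : G.IsDecomposition μ)
    (hv : (G.toTerm μ).Valid G) (hp : (G.toTerm μ).Placed G) (hdeg : ∀ w, G.degree w ≤ 4) :
    G.Corresponds μ := by
  have hchild : ∀ {ν}, SPQTree.IsChild ν μ → (G.toTerm ν).Valid G ∧ (G.toTerm ν).Placed G :=
    fun hν => (sub_toTerm hν).valid_placed hv hp
  induction μ with
  | Q u v p =>
    cases p with
    | nil => simp [IsDecomposition, IsSimplePath] at h
    | cons d p =>
      refine ⟨?_, ?_⟩
      · rw [interval, toTerm, ivl_chain]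
        push_cast [List.length_cons]
        ext <;> ring
      · rw [RepresentabilityCondition, toTerm]
        exact iff_of_true trivial (cond_chain _)
  | S u v n c ih =>
    rw [IsDecomposition] at h
    obtain ⟨h1, -, -, h4, h5, -⟩ := h
    have ih' := fun i => ih i (h1 i) (hchild (.series u v n c i)).1 (hchild (.series u v n c i)).2
      fun hν => (sub_toTerm hν).valid_placed (hchild (.series u v n c i)).1
        (hchild (.series u v n c i)).2
    have hs : ∀ i : Fin (n + 1), serSlack G (G.toTerm (c i.castSucc)) (G.toTerm (c i.succ)) = 0 := by
      intro i
      rw [serSlack, if_neg]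
      rintro ⟨k1, k2⟩
      refine (h4 i).2.2 ⟨?_, ?_⟩
      · by_contra hQ
        have := two_le_length_snkFan (G := G) hQ (h5 _)
        omega
      · by_contra hQ
        have := two_le_length_srcFan (G := G) hQ (h5 _)
        omega
    refine ⟨?_, ?_⟩
    · rw [interval, toTerm, ivl_serFin _ _ hs]
      simp only [(ih' _).1, Int.cast_sum, Finset.sum_div]
    · rw [RepresentabilityCondition, toTerm, cond_serFin]
      exact forall_congr' fun i => (ih' i).2
  | P2 u v l r ihl ihr =>
    have k1 := hchild (.left2 u v l r)
    have k2 := hchild (.right2 u v l r)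
    have h' := h
    rw [IsDecomposition] at h
    have cl := ihl h.1 k1.1 k1.2 fun hν => (sub_toTerm hν).valid_placed k1.1 k1.2
    have cr := ihr h.2.1 k2.1 k2.2 fun hν => (sub_toTerm hν).valid_placed k2.1 k2.2
    exact h'.corresponds_P2 hv hp hdeg cl cr
  | P3 u v l m r ihl ihm ihr =>
    have k1 := hchild (.left3 u v l m r)
    have k2 := hchild (.mid3 u v l m r)
    have k3 := hchild (.right3 u v l m r)
    rw [IsDecomposition] at h
    exact corresponds_P3 hv hp hdeg
      (ihl h.1 k1.1 k1.2 fun hν => (sub_toTerm hν).valid_placed k1.1 k1.2)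
      (ihm h.2.1 k2.1 k2.2 fun hν => (sub_toTerm hν).valid_placed k2.1 k2.2)
      (ihr h.2.2.1 k3.1 k3.2 fun hν => (sub_toTerm hν).valid_placed k3.1 k3.2)

end PlaneGraph

namespace SPTerm

open PlaneGraph

variable {V D : Type*} [Fintype V] [DecidableEq V] [Fintype D] [DecidableEq D]
  {G : PlaneGraph V D}

/-! ### The theorem for the nodes of the tree -/

theorem IsRest.rectilinearPlanar_iff_of_descendant {η ν : SPQTree V D} {e : D}
    (hr : (G.toTerm η).IsRest G e) (hdeg : ∀ w, G.degree w ≤ 4) (hη : G.IsDecomposition η)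
    (hc : G.IsClosedNode η) (hν : Relation.ReflTransGen SPQTree.IsChild ν η) :
    (G.IsRectilinearPlanar ν ↔ G.RepresentabilityCondition ν) ∧
    (G.RepresentabilityCondition ν →
      ∀ k : ℚ, G.IsRectilinearPlanarWith ν k ↔ G.IsRepresentabilityValue ν k) := by
  obtain ⟨h1, -, hs⟩ := hη.descendant hc hν
  obtain ⟨hv, hp⟩ := hs.valid_placed hr.valid hr.placed
  obtain ⟨hi, hcond⟩ := h1.corresponds hv hp hdeg
  refine h1.represents.rectilinearPlanar_iff hv hp hdeg (fun H => ?_) (fun A B K hR _ => ?_) hcond hi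
  · obtain ⟨K, hK⟩ := hr.exists_realizes hdeg H
    exact hK.sub hs
  · obtain ⟨A', B', K', hag, hR'⟩ := hs.exists_realizes hr.valid hr.placed hdeg hR
    obtain ⟨H, hag', hH, -⟩ := hr.exists_orthoRep hdeg hR'
    exact ⟨H, hag.trans (hag'.sub hs), hH⟩

theorem IsRest.exists_realizes_eight {t : SPTerm D} {e : D} (hr : t.IsRest G e)
    (hdeg : ∀ w, G.degree w ≤ 4) : ∃ A B, t.Realizes G A B 8 := by
  refine hr.valid.exists_realizes_of_two_dvd hr.placed hdeg ?_
  have h2 := hr.rot_src.degree_eq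
  have h3 := hr.rot_snk.degree_eq
  simp only [List.length_append, List.length_reverse, List.length_singleton] at h2 h3
  have h4 : ∀ n, aliasCount n (n + 1) = 1 := fun n => by simp [aliasCount]
  simp only [aliasSum, h2, h3, h4]
  norm_num

theorem IsRest.rectilinearPlanar_iff_reference {t : SPTerm D} {e : D} (hr : t.IsRest G e)
    (hdeg : ∀ w, G.degree w ≤ 4) :
    (G.IsRectilinearPlanar (.Q (G.org e) (G.org (G.rev e)) [e]) ↔
      G.RepresentabilityCondition (.Q (G.org e) (G.org (G.rev e)) [e])) ∧
    (G.RepresentabilityCondition (.Q (G.org e) (G.org (G.rev e)) [e]) →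
      ∀ k : ℚ, G.IsRectilinearPlanarWith (.Q (G.org e) (G.org (G.rev e)) [e]) k ↔
        G.IsRepresentabilityValue (.Q (G.org e) (G.org (G.rev e)) [e]) k) := by
  have hv : (edge e).Valid G := by
    have := hr.valid.src_ne_snk
    rwa [hr.src_eq, hr.snk_eq] at this
  have hp : (edge e).Placed G := by
    refine ⟨⟨t.srcFan.reverse, by simpa using t.srcFan_ne_nil, ?_⟩, t.snkFan G,
      t.snkFan_ne_nil G, ?_⟩
    · have := hr.rot_src.append_comm
      rwa [hr.src_eq] at this
    · have := hr.rot_snk.append_comm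
      rwa [hr.snk_eq] at this
  have hd : G.IsDecomposition (.Q (G.org e) (G.org (G.rev e)) [e]) := by
    have hne : G.org e ≠ G.org (G.rev e) := hv
    simp [IsDecomposition, IsSimplePath, hne]
  obtain ⟨hi, hcond⟩ := hd.corresponds hv hp hdeg
  refine hd.represents.rectilinearPlanar_iff hv hp hdeg (fun H => ⟨_, H.net_rev e, rfl⟩) (fun A B K hR hB => ?_)
    hcond hi
  obtain ⟨A', B', hR'⟩ := hr.exists_realizes_eight hdeg
  obtain ⟨H, -, hH, h0⟩ := hr.exists_orthoRep hdeg hR'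
  have h0 : H.net e = 0 := by omega
  refine ⟨H, ⟨fun d hd => by simp [toTerm, chain, own] at hd, fun d hd => ?_⟩, hH⟩
  rw [hB d hd]
  simp only [toTerm, chain, SPTerm.darts, Finset.mem_insert, Finset.mem_singleton] at hd
  rcases hd with rfl | rfl
  · exact h0.symm
  · rw [H.net_rev, h0, neg_zero]

end SPTerm

theorem theorem1 {V D : Type*} [Fintype V] [DecidableEq V] [Fintype D] [DecidableEq D]
    (G : PlaneGraph V D) (hdeg : ∀ w, G.degree w ≤ 4)
    (T : SPQTree V D) (hT : G.IsSPQTree T)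
    (ν : SPQTree V D) (hν : ν.IsNonRootNode T) :
    (G.IsRectilinearPlanar ν ↔ G.RepresentabilityCondition ν) ∧
    (G.RepresentabilityCondition ν →
      ∀ k : ℚ, G.IsRectilinearPlanarWith ν k ↔ G.IsRepresentabilityValue ν k) := by
  obtain ⟨s, t, e, η, rfl, rfl, rfl, hη, h1, h2, h3, h4, h5, h6⟩ := hT
  have hc : G.IsClosedNode η := fun x _ hs ht => by
    rw [h1] at hs
    rw [h2] at ht
    exact (h3 x).2 ⟨fun h => hs (congrArg _ h), fun h => ht (congrArg _ h)⟩
  have hrep := hη.represents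
  have hr : (G.toTerm η).IsRest G e :=
    { valid := hη.valid hc
      src_eq := hrep.source_eq.trans h1
      snk_eq := hrep.sink_eq.trans h2
      mem_darts := fun d => by rw [hrep.darts_eq]; exact h3 d
      rot_src := by
        rw [hrep.source_eq, h1, hrep.sourceFan_eq]
        exact PlaneGraph.IsRotationAt.append_comm (h4 : G.IsRotationAt _ ([e] ++ _))
      rot_snk := by
        rw [hrep.sink_eq, h2, hrep.sinkFan_eq]
        exact h5
      outer := h6 }
  obtain ⟨b, hb, hbT⟩ := Relation.TransGen.tail'_iff.1 hν
  cases hbT with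
  | left2 => exact hr.rectilinearPlanar_iff_of_descendant hdeg hη hc hb
  | right2 =>
    rcases Relation.ReflTransGen.cases_tail hb with rfl | ⟨x, -, hx⟩
    · exact hr.rectilinearPlanar_iff_reference hdeg
    · cases hx
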